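/- **Setting.** Let $d,p$ be natural numbers. For each $\theta\in\mathbb R^d$ one run of a stochastic system returns a pair $(X(\theta),Y(\theta))=(X(\theta,\xi),Y(\theta,\xi))$ of real random variables driven by a random element $\xi$ with law $\mu$. Let $q(\theta,x,\nu)$, $m_j(\theta,y,\lambda_1,\dots,\lambda_j)$ ($1\le j\le p$) and $g(\theta,\lambda)$, $\lambda\in\mathbb R^p$, be real functions ($X,Y,q,m_j$ jointly measurable), and let $\Theta=\{\theta: \boldsymbol c_i(\theta)\le 0\ \forall i\}$ be convex and compact, with finitely many $C^1$ constraints satisfying $\nabla\boldsymbol c_i\ne0$ where $\boldsymbol c_i=0$. Put $\bar q(\theta,\nu)=E[q(\theta,X(\theta),\nu)]$, and let $\bar m_j(\theta,\lambda_1,\dots,\lambda_j,\nu)$ be a version of $E[m_j(\theta,Y(\theta),\lambda_1,\dots,\lambda_j)\mid X(\theta)=\nu]$. With $N\subset\mathbb R^d$ the open set of Assumption 1, for $\theta\in\Theta\cup N$ the pair $(X(\theta),Y(\theta))$ has a joint density, $X(\theta)$ has the density $f(\cdot,\theta)$, $\nu(\theta)$ is the unique root of $\bar q(\theta,\cdot)=0$,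 and $\lambda(\theta)=(\lambda_1(\theta),\dots,\lambda_p(\theta))$ is the unique solution of $\bar m_j(\theta,\lambda_1,\dots,\lambda_j,\nu(\theta))=0$, $j=1,\dots,p$. Let $\bar g(\theta)=g(\theta,\lambda(\theta))$. **Algorithm.** Let $K:\mathbb R\to\mathbb R$ be a kernel, $\alpha_n,\beta_n,c_n,h_n$ ($n\ge1$) be real sequences, and let $\theta_0,\nu_0,\boldsymbol\lambda_0,G_{\nu,0},G_{1,0},\dots,G_{p,0}$ be deterministic. Given the iterates with index $n-1$ and a random direction $\Delta_n\in\{-1,1\}^d$, put $$\bar c_n=\frac{c_n}{\max\{1,\|G_{\nu,n-1}\|/\sqrt d,\|G_{1,n-1}\|/\sqrt d,\dots,\|G_{p,n-1}\|/\sqrt d\}},$$ $\theta^\pm=\theta_{n-1}\pm\bar c_n\Delta_n$, $\nu^\pm=\nu_{n-1}\pm\bar c_n\Delta_n^{\mathsf T}G_{\nu,n-1}$, $\lambda_j^\pm=\lambda_{j,n-1}\pm\bar c_n\Delta_n^{\mathsf T}G_{j,n-1}$ (the *perturbed points*). Let $(X,Y)$, $(X^+,Y^+)$, $(X^-,Y^-)$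 be the outputs of three independent runs at $\theta_{n-1},\theta^+,\theta^-$, and put $\kappa=\frac1{h_n}K\big(\frac{\nu_{n-1}-X}{h_n}\big)$, $\kappa^\pm=\frac1{h_n}K\big(\frac{\nu^\pm-X^\pm}{h_n}\big)$. Then (division by $\Delta_n$ is coordinatewise, $\Pi_\Theta$ is the Euclidean projection) $$\nu_n=\nu_{n-1}+\beta_n q(\theta_{n-1},X,\nu_{n-1}),\qquad \lambda_{j,n}=\lambda_{j,n-1}+\beta_n\,m_j(\theta_{n-1},Y,\lambda_{1,n-1},\dots,\lambda_{j,n-1})\,\kappa,$$ $$G_{\nu,n}=G_{\nu,n-1}+\beta_n\frac{q(\theta^+,X^+,\nu^+)-q(\theta^-,X^-,\nu^-)}{2\bar c_n\Delta_n},$$ $$G_{j,n}=G_{j,n-1}+\beta_n\frac{\big[m_j(\theta^+,Y^+,\lambda_1^+,\dots,\lambda_j^+)-m_j(\theta^-,Y^-,\lambda_1^-,\dots,\lambda_j^-)\big]\kappa^+\kappa^-}{2\bar c_n\Delta_n},$$ $$\theta_n=\Pi_\Theta\Big[\theta_{n-1}-\alpha_n\Big(\nabla_\theta g(\theta_{n-1},\boldsymbol\lambda_{n-1})+\sum_{j=1}^p\frac{\partial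 g}{\partial\lambda_j}(\theta_{n-1},\boldsymbol\lambda_{n-1})\,G_{j,n-1}\Big)\Big].$$ **Assumption 1.** There are open convex sets $N\subset\mathbb R^d$, $\mathcal X\subset\mathbb R$, $\Lambda\subset\mathbb R^p$, independent of $n$ and of the sample path, such that: for some $r>0$, almost surely for all $n$ the open balls of radius $r$ around $\theta_n,\nu_n,\boldsymbol\lambda_n$ lie in $N,\mathcal X,\Lambda$ respectively; almost surely all perturbed points lie in $N\times\mathcal X\times\Lambda$; and $\nu(\theta)\in\mathcal X$, $\lambda(\theta)\in\Lambda$ for $\theta\in\Theta\cap N$. Moreover: (a) $(\theta,x)\mapsto f(x,\theta)$ is $C^3$ on $N\times\mathbb R$ with bounded derivatives of orders 1 to 3, and $f\ge\varepsilon$ on $\mathcal X\times N$ for some $\varepsilon>0$; (b) $\bar q$ is $C^3$ on $N\times\mathcal X$ with bounded derivatives of orders 1 to 3, and there $E[q^2(\theta,X(\theta),\nu)]\le C_q$ and $\partial\bar q/\partial\nu\le-\varepsilon_q$, for constants $C_q,\varepsilon_q>0$; (c) each $\bar m_j$ is $C^3$ in $(\theta,\lambda,\nu)\in N\times\Lambda\times\mathbb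 R$ with bounded derivatives of orders 1 to 3; for $(\theta,\lambda)\in N\times\Lambda$, $E[m_j^2(\theta,Y(\theta),\lambda_1,\dots,\lambda_j)]\le C_m$ and $E[m_j^2(\theta,Y(\theta),\lambda_1,\dots,\lambda_j)\mid X(\theta)=\nu]\le C_m'$ for (almost) all $\nu\in\mathcal X$; and $\partial\bar m_j/\partial\lambda_j\le-\varepsilon_m$ on $N\times\mathcal X\times\Lambda$, for constants $C_m,C_m',\varepsilon_m>0$; (d) there is $\kappa_0$ with $E[\kappa_0]<\infty$ and $|X(\theta_1)-X(\theta_2)|\le\kappa_0\|\theta_1-\theta_2\|$ a.s. for all $\theta_1,\theta_2\in N$; (e) $g$ is $C^1$ with bounded derivatives; (f) $f(\cdot,\theta)$ and $\bar m_j(\theta,\lambda_1,\dots,\lambda_j,\cdot)$ are Schwartz functions for all $(\theta,\lambda)\in N\times\Lambda$. **Assumption 2.** The runs used by the algorithm are independent; the $\Delta_n$ are i.i.d. with independent coordinates equal to $\pm1$ with probability $1/2$ each, and independent of the runs. **Assumption 3.** $\alpha_n,\beta_n,c_n,h_n>0$, $\sum\alpha_n=\infty$, $c_n\to0$, $h_n\to0$,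 $\sum\beta_n^2/(c_nh_n)^2<\infty$, $\beta_n=o(c_n^2h_n^2)$, $\alpha_n=o(\beta_n)$. **Assumption 4.** $K$ is a symmetric, bounded, continuous probability density with $uK(u)\to0$ as $|u|\to\infty$ and $\int|u\ln|u||^{1/2}\,|dK(u)|<\infty$; $K$ is Lipschitz; $K\ge\hat\varepsilon>0$ on an open neighborhood of $0$; and $k(u)=\int e^{-iuy}K(y)\,dy$ is integrable with $\lim_{u\to0}[1-k(u)]/u^2$ finite. **Assumption 5.** (a) For $n\ge1$, $\alpha_n=C_\alpha/(n+n_\alpha)^a$, $\beta_n=C_\beta/(n+n_\beta)^b$, $c_n=C_c/(n+n_c)^{\mathfrak c}$, $h_n=C_h/(n+n_h)^{\mathfrak h}$ with $C_\alpha,C_\beta,C_c,C_h>0$, $n_\alpha,n_\beta,n_c,n_h\ge0$, $a,b\in(1/2,1]$, $\mathfrak c,\mathfrak h>0$, $\mathfrak c+\mathfrak h<b/2$, and $1/n\le\alpha_n<1$ for all large $n$. (b) $\nu(\cdot)$ and $\lambda(\cdot)$ are twice continuously differentiable near every point of $\Theta\cup N$, and for some $\varepsilon_\rho>0$ almost surely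 the smallest eigenvalue of $\nabla^2\bar g(\theta)$ is at least $\varepsilon_\rho$ for all $n$ and all $\theta$ on the segment between $\theta_n$ and $\theta^*$. (c) The projected ODE $\dot\theta(t)=-\nabla\bar g(\theta(t))+z(t)$ on $\Theta$, where $z(t)$ is the smallest force in the negative normal cone $-\mathcal C(\theta(t))$ that keeps $\theta(t)$ in $\Theta$, has a unique equilibrium $\theta^*$, which is globally asymptotically stable and lies in the interior of $\Theta$. (d) $g$ is $C^2$ with bounded first and second derivatives. **Proposition.** Under Assumptions 1–5, all expectations below are finite and, as $n\to\infty$, $$\sqrt{E\|G_{\nu,n}-\nabla\nu(\theta_n)\|^2}=O\Big(\frac{\alpha_{n+1}}{\beta_{n+1}}\Big)+O\Big(\frac{\beta_{n+1}^{1/2}}{c_{n+1}}\Big)+O(c_{n+1}^2),$$ and for $j=1,\dots,p$ $$\sqrt{E\|G_{j,n}-\nabla\lambda_j(\theta_n)\|^2}=O\Big(\frac{\alpha_{n+1}}{\beta_{n+1}}\Big)+O\Big(\frac{\beta_{n+1}^{1/2}}{c_{n+1}h_{n+1}}\Big)+O(c_{n+1}^2)+O(h_{n+1}^2).$$ -/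

import Mathlib

open MeasureTheory ProbabilityTheory Filter Topology Asymptotics

namespace KBSA

/-- `ℝ^d` with the Euclidean norm. -/
abbrev Vec (d : ℕ) := EuclideanSpace ℝ (Fin d)

/-- The leading block `(l_1, …, l_j)` of `l = (l_1, …, l_p)`; with the index `j : Fin p` starting
at `0`, it has `j + 1` entries. -/
def head {p : ℕ} (j : Fin p) (l : Fin p → ℝ) : Fin ((j : ℕ) + 1) → ℝ :=
  fun i => l (Fin.castLE j.isLt i)

/-- The data of a contextual optimization problem. One run of the system is driven by a random
element of `Ξ` with law `μ`: the run at the parameter `θ` driven by `ξ` returns the pair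
`(X θ ξ, Y θ ξ)`. The feasible region is given by the constraints `con i θ ≤ 0`. -/
structure Problem (d p : ℕ) (Ξ : Type*) [MeasurableSpace Ξ] where
  μ : Measure Ξ
  X : Vec d → Ξ → ℝ
  Y : Vec d → Ξ → ℝ
  q : Vec d → ℝ → ℝ → ℝ
  m : (j : Fin p) → Vec d → ℝ → (Fin ((j : ℕ) + 1) → ℝ) → ℝ
  g : Vec d × (Fin p → ℝ) → ℝ
  nCon : ℕ
  con : Fin nCon → Vec d → ℝ

section Problem

variable {d p : ℕ} {Ξ : Type*} [MeasurableSpace Ξ]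

/-- The feasible region `Θ`. -/
def Problem.feasible (P : Problem d p Ξ) : Set (Vec d) := {θ | ∀ i, P.con i θ ≤ 0}

/-- `q̄(θ, ν) = E[q(θ, X(θ), ν)]`. -/
noncomputable def Problem.qbar (P : Problem d p Ξ) (θ : Vec d) (ν : ℝ) : ℝ :=
  ∫ ξ, P.q θ (P.X θ ξ) ν ∂P.μ

/-- Standing requirements on the data: measurability, and a convex compact feasible region given
by continuously differentiable constraints whose gradients do not vanish where they are active. -/
structure Problem.Standing (P : Problem d p Ξ) : Prop where
  prob : IsProbabilityMeasure P.μ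
  meas_X : Measurable fun z : Vec d × Ξ => P.X z.1 z.2
  meas_Y : Measurable fun z : Vec d × Ξ => P.Y z.1 z.2
  meas_q : Measurable fun z : Vec d × ℝ × ℝ => P.q z.1 z.2.1 z.2.2
  meas_m : ∀ j : Fin p, Measurable fun z : Vec d × ℝ × (Fin ((j : ℕ) + 1) → ℝ) =>
    P.m j z.1 z.2.1 z.2.2
  convex : Convex ℝ P.feasible
  compact : IsCompact P.feasible
  con_smooth : ∀ i, ContDiff ℝ 1 (P.con i)
  con_grad : ∀ i θ, P.con i θ = 0 → gradient (P.con i) θ ≠ 0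

/-- The objects derived from the distribution of `(X(θ), Y(θ))`: the marginal density `f(x, θ)`
of `X(θ)`, the conditional expectations `m̄_j(θ, l_1, …, l_j, ν)`, the auxiliary measure `ν(θ)`
and the contextual measures `λ(θ)`. They are tied to the data by `Targets.Describes`. -/
structure Targets (d p : ℕ) where
  f : ℝ → Vec d → ℝ
  mbar : (j : Fin p) → Vec d → (Fin ((j : ℕ) + 1) → ℝ) → ℝ → ℝ
  nu : Vec d → ℝ
  lam : Vec d → Fin p → ℝ

/-- The objects in `T` are those of the problem `P`, for the parameters `θ` in `S`:
`(X(θ), Y(θ))` is absolutely continuous, `X(θ)` has the density `f(·, θ)`, the function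
`m̄_j(θ, l, ·)` is a version of the conditional expectation of `m_j(θ, Y(θ), l)` given `X(θ) = ·`,
`ν(θ)` is the unique root of `q̄(θ, ·)` and `λ(θ)` is the unique common root of the functions
`l ↦ m̄_j(θ, l_1, …, l_j, ν(θ))`. The integrability clauses only say where the expectations
involved exist. -/
structure Targets.Describes (T : Targets d p) (P : Problem d p Ξ) (S : Set (Vec d)) : Prop where
  joint_density : ∀ θ ∈ S,
    (P.μ.map fun ξ => (P.X θ ξ, P.Y θ ξ)) ≪ (volume : Measure (ℝ × ℝ))
  f_nonneg : ∀ θ ∈ S, ∀ x, 0 ≤ T.f x θ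
  density : ∀ θ ∈ S,
    P.μ.map (P.X θ) = (volume : Measure ℝ).withDensity fun x => ENNReal.ofReal (T.f x θ)
  cond : ∀ θ ∈ S, ∀ (j : Fin p) (l : Fin ((j : ℕ) + 1) → ℝ),
    Integrable (fun ξ => P.m j θ (P.Y θ ξ) l) P.μ →
      P.μ[fun ξ => P.m j θ (P.Y θ ξ) l | MeasurableSpace.comap (P.X θ) inferInstance]
        =ᵐ[P.μ] fun ξ => T.mbar j θ l (P.X θ ξ)
  nu_integrable : ∀ θ ∈ S, Integrable (fun ξ => P.q θ (P.X θ ξ) (T.nu θ)) P.μ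
  nu_root : ∀ θ ∈ S, P.qbar θ (T.nu θ) = 0
  nu_unique : ∀ θ ∈ S, ∀ ν, Integrable (fun ξ => P.q θ (P.X θ ξ) ν) P.μ →
    P.qbar θ ν = 0 → ν = T.nu θ
  lam_integrable : ∀ θ ∈ S, ∀ j,
    Integrable (fun ξ => P.m j θ (P.Y θ ξ) (head j (T.lam θ))) P.μ
  lam_root : ∀ θ ∈ S, ∀ j, T.mbar j θ (head j (T.lam θ)) (T.nu θ) = 0
  lam_unique : ∀ θ ∈ S, ∀ l : Fin p → ℝ,
    (∀ j, Integrable (fun ξ => P.m j θ (P.Y θ ξ) (head j l)) P.μ) →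
    (∀ j, T.mbar j θ (head j l) (T.nu θ) = 0) → l = T.lam θ

/-- The objective `ḡ(θ) = g(θ, λ(θ))`. -/
def Problem.gbar (P : Problem d p Ξ) (T : Targets d p) (θ : Vec d) : ℝ := P.g (θ, T.lam θ)

end Problem

/-! The algorithm -/

section Algorithm

variable {d p : ℕ} {Ξ : Type*} [MeasurableSpace Ξ]

/-- The iterates `(θ_n, ν_n, λ_n, G_{ν,n}, G_{1,n}, …, G_{p,n})`. -/
structure State (d p : ℕ) where
  θ : Vec d
  ν : ℝ
  lam : Fin p → ℝ
  Gν : Vec d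
  G : Fin p → Vec d

/-- The step sizes `α_n, β_n`, perturbation sizes `c_n` and bandwidths `h_n`, for `n ≥ 1`
(the values at `0` are never used). -/
structure Params where
  α : ℕ → ℝ
  β : ℕ → ℝ
  c : ℕ → ℝ
  h : ℕ → ℝ

/-- The metric projection onto `S` (for `S` nonempty, closed and convex: the nearest point). -/
noncomputable def proj {d : ℕ} (S : Set (Vec d)) (x : Vec d) : Vec d :=
  open Classical in
  if h : ∃ y ∈ S, ∀ z ∈ S, ‖x - y‖ ≤ ‖x - z‖ then h.choose else x

/-- The scaled perturbation size
`c̄ = c / max {1, ‖G_ν‖/√d, ‖G_1‖/√d, …, ‖G_p‖/√d}`. -/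
noncomputable def cbar (c : ℝ) (s : State d p) : ℝ :=
  c / max (max 1 (‖s.Gν‖ / √(d : ℝ))) (⨆ j, ‖s.G j‖ / √(d : ℝ))

/-- The perturbed point `(θ^±, ν^±, λ^±)`, with the sign `σ = ±1`. -/
noncomputable def perturb (σ c : ℝ) (s : State d p) (Δ : Vec d) : Vec d × ℝ × (Fin p → ℝ) :=
  (s.θ + (σ * cbar c s) • Δ,
   s.ν + σ * cbar c s * inner ℝ Δ s.Gν,
   fun j => s.lam j + σ * cbar c s * inner ℝ Δ (s.G j))

/-- The kernel weight `K((ν - x)/h)/h`. -/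
noncomputable def kern (K : ℝ → ℝ) (h ν x : ℝ) : ℝ := 1 / h * K ((ν - x) / h)

/-- The vector `a / (2 c̄ Δ)`, with the division by `Δ` taken coordinatewise. -/
noncomputable def spQuot (a cb : ℝ) (Δ : Vec d) : Vec d :=
  WithLp.toLp 2 fun i => a / (2 * cb * Δ i)

/-- The search direction
`∇_θ g(θ, λ) + ∑_j (∂g/∂λ_j)(θ, λ) G_j` of the parameter recursion. -/
noncomputable def searchDir (P : Problem d p Ξ) (s : State d p) : Vec d :=
  gradient (fun t => P.g (t, s.lam)) s.θ
    + ∑ j, deriv (fun r => P.g (s.θ, Function.update s.lam j r)) (s.lam j) • s.G j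

/-- One iteration with parameters `α, β, c, h`, random direction `Δ` and three runs of the system:
`ξ 0` at `θ`, `ξ 1` at `θ^+` and `ξ 2` at `θ^-`. -/
noncomputable def step (P : Problem d p Ξ) (K : ℝ → ℝ) (α β c h : ℝ) (s : State d p)
    (Δ : Vec d) (ξ : Fin 3 → Ξ) : State d p :=
  let cb := cbar c s
  let zp := perturb 1 c s Δ
  let zm := perturb (-1) c s Δ
  let Kn := kern K h s.ν (P.X s.θ (ξ 0))
  let Kp := kern K h zp.2.1 (P.X zp.1 (ξ 1))
  let Km := kern K h zm.2.1 (P.X zm.1 (ξ 2))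
  { θ := proj P.feasible (s.θ - α • searchDir P s)
    ν := s.ν + β * P.q s.θ (P.X s.θ (ξ 0)) s.ν
    lam := fun j => s.lam j + β * (P.m j s.θ (P.Y s.θ (ξ 0)) (head j s.lam) * Kn)
    Gν := s.Gν + β • spQuot
      (P.q zp.1 (P.X zp.1 (ξ 1)) zp.2.1 - P.q zm.1 (P.X zm.1 (ξ 2)) zm.2.1) cb Δ
    G := fun j => s.G j + β • spQuot
      ((P.m j zp.1 (P.Y zp.1 (ξ 1)) (head j zp.2.2)
        - P.m j zm.1 (P.Y zm.1 (ξ 2)) (head j zm.2.2)) * Kp * Km) cb Δ }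

/-- The iterates of the algorithm started at `s₀`. Iteration `n + 1` uses the parameters with
index `n + 1`, the direction `Δ n` and the runs driven by `ξ n 0, ξ n 1, ξ n 2`. -/
noncomputable def iter {Ω : Type*} (P : Problem d p Ξ) (K : ℝ → ℝ) (A : Params)
    (s₀ : State d p) (Δ : ℕ → Ω → Vec d) (ξ : ℕ → Fin 3 → Ω → Ξ) : ℕ → Ω → State d p
  | 0, _ => s₀
  | n + 1, ω => step P K (A.α (n + 1)) (A.β (n + 1)) (A.c (n + 1)) (A.h (n + 1))
      (iter P K A s₀ Δ ξ n ω) (Δ n ω) (fun k => ξ n k ω)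

/-- The runs of the system are independent with law `μ`, the directions have mutually independent
coordinates that are `1` or `-1` with probability `1/2` each and are independent across
iterations, and the directions are independent of the runs. In particular, the noise of an
iteration is independent of all earlier iterates. -/
structure Sampling {Ω : Type*} [MeasurableSpace Ω] (P : Problem d p Ξ) (Pr : Measure Ω)
    (Δ : ℕ → Ω → Vec d) (ξ : ℕ → Fin 3 → Ω → Ξ) : Prop where
  meas_ξ : ∀ n k, Measurable (ξ n k)
  law_ξ : ∀ n k, Pr.map (ξ n k) = P.μ
  indep_ξ : iIndepFun (fun (a : ℕ × Fin 3) ω => ξ a.1 a.2 ω) Pr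
  meas_Δ : ∀ n, Measurable (Δ n)
  Δ_pos : ∀ n i, Pr {ω | Δ n ω i = 1} = 1 / 2
  Δ_neg : ∀ n i, Pr {ω | Δ n ω i = -1} = 1 / 2
  indep_Δ : iIndepFun (fun (a : ℕ × Fin d) ω => Δ a.1 ω a.2) Pr
  indep : IndepFun (fun ω (a : ℕ × Fin d) => Δ a.1 ω a.2)
    (fun ω (a : ℕ × Fin 3) => ξ a.1 a.2 ω) Pr

end Algorithm

/-! The assumptions -/

section Assumptions

variable {d p : ℕ} {Ξ : Type*} [MeasurableSpace Ξ]

/-- `F` is three times continuously differentiable on the open set `S`, with bounded derivatives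
of orders `1, 2, 3`. -/
def BoundedC3 {V : Type*} [NormedAddCommGroup V] [NormedSpace ℝ V] (F : V → ℝ) (S : Set V) :
    Prop :=
  ContDiffOn ℝ 3 F S ∧
    ∃ C : ℝ, ∀ x ∈ S, ∀ i : ℕ, 1 ≤ i → i ≤ 3 → ‖iteratedFDeriv ℝ i F x‖ ≤ C

/-- `φ : ℝ → ℝ` is a Schwartz function. -/
def IsSchwartz (φ : ℝ → ℝ) : Prop := ∃ Φ : SchwartzMap ℝ ℝ, ∀ x, Φ x = φ x

/-- Regularity of the problem on a fixed neighborhood `N × Xε × Λε` of the iterates. -/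
structure Regularity {Ω : Type*} [MeasurableSpace Ω] (P : Problem d p Ξ) (T : Targets d p)
    (Pr : Measure Ω) (A : Params) (s : ℕ → Ω → State d p) (Δ : ℕ → Ω → Vec d)
    (N : Set (Vec d)) (Xε : Set ℝ) (Λε : Set (Fin p → ℝ)) : Prop where
  open_N : IsOpen N
  open_X : IsOpen Xε
  open_Λ : IsOpen Λε
  convex_N : Convex ℝ N
  convex_X : Convex ℝ Xε
  convex_Λ : Convex ℝ Λε
  nhd : ∃ r > 0, ∀ᵐ ω ∂Pr, ∀ n, Metric.ball (s n ω).θ r ⊆ N ∧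
    Metric.ball (s n ω).ν r ⊆ Xε ∧ Metric.ball (s n ω).lam r ⊆ Λε
  nhd_perturb : ∀ᵐ ω ∂Pr, ∀ n,
    perturb 1 (A.c (n + 1)) (s n ω) (Δ n ω) ∈ N ×ˢ Xε ×ˢ Λε ∧
    perturb (-1) (A.c (n + 1)) (s n ω) (Δ n ω) ∈ N ×ˢ Xε ×ˢ Λε
  nhd_target : ∀ θ ∈ P.feasible ∩ N, T.nu θ ∈ Xε ∧ T.lam θ ∈ Λε
  describes : T.Describes P (P.feasible ∪ N)
  f_smooth : BoundedC3 (fun z : Vec d × ℝ => T.f z.2 z.1) (N ×ˢ Set.univ)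
  f_lower : ∃ ε > 0, ∀ x ∈ Xε, ∀ θ ∈ N, ε ≤ T.f x θ
  q_smooth : BoundedC3 (fun z : Vec d × ℝ => P.qbar z.1 z.2) (N ×ˢ Xε)
  q_moment : ∃ C : ℝ, ∀ θ ∈ N, ∀ ν ∈ Xε,
    Integrable (fun ξ => P.q θ (P.X θ ξ) ν ^ 2) P.μ ∧
    ∫ ξ, P.q θ (P.X θ ξ) ν ^ 2 ∂P.μ ≤ C
  q_deriv : ∃ ε > 0, ∀ θ ∈ N, ∀ ν ∈ Xε, deriv (fun r => P.qbar θ r) ν ≤ -ε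
  m_smooth : ∀ j, BoundedC3
    (fun z : Vec d × (Fin p → ℝ) × ℝ => T.mbar j z.1 (head j z.2.1) z.2.2)
    (N ×ˢ Λε ×ˢ Set.univ)
  m_moment : ∃ C : ℝ, ∀ j, ∀ θ ∈ N, ∀ l ∈ Λε,
    Integrable (fun ξ => P.m j θ (P.Y θ ξ) (head j l) ^ 2) P.μ ∧
    ∫ ξ, P.m j θ (P.Y θ ξ) (head j l) ^ 2 ∂P.μ ≤ C
  m_cond_moment : ∃ C : ℝ, ∀ j, ∀ θ ∈ N, ∀ l ∈ Λε, ∀ᵐ ξ ∂P.μ, P.X θ ξ ∈ Xε →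
    (P.μ[fun ξ' => P.m j θ (P.Y θ ξ') (head j l) ^ 2 |
      MeasurableSpace.comap (P.X θ) inferInstance]) ξ ≤ C
  m_deriv : ∃ ε > 0, ∀ j, ∀ θ ∈ N, ∀ ν ∈ Xε, ∀ l ∈ Λε,
    deriv (fun r => T.mbar j θ (head j (Function.update l j r)) ν) (l j) ≤ -ε
  X_lipschitz : ∃ κ : Ξ → ℝ, Integrable κ P.μ ∧ ∀ θ₁ ∈ N, ∀ θ₂ ∈ N,
    ∀ᵐ ξ ∂P.μ, |P.X θ₁ ξ - P.X θ₂ ξ| ≤ κ ξ * ‖θ₁ - θ₂‖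
  g_smooth : ContDiff ℝ 1 P.g
  g_bounded : ∃ C : ℝ, ∀ z, ‖fderiv ℝ P.g z‖ ≤ C
  f_schwartz : ∀ θ ∈ N, IsSchwartz fun x => T.f x θ
  m_schwartz : ∀ j, ∀ θ ∈ N, ∀ l ∈ Λε, IsSchwartz (T.mbar j θ (head j l))

/-- The conditions on step sizes, perturbation sizes and bandwidths. -/
structure StepSizes (A : Params) : Prop where
  α_pos : ∀ n, 1 ≤ n → 0 < A.α n
  α_sum : ¬ Summable fun n => A.α (n + 1)
  β_pos : ∀ n, 1 ≤ n → 0 < A.β n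
  c_pos : ∀ n, 1 ≤ n → 0 < A.c n
  h_pos : ∀ n, 1 ≤ n → 0 < A.h n
  c_lim : Tendsto A.c atTop (𝓝 0)
  h_lim : Tendsto A.h atTop (𝓝 0)
  β_sum : Summable fun n => A.β (n + 1) ^ 2 / (A.c (n + 1) * A.h (n + 1)) ^ 2
  β_little : A.β =o[atTop] fun n => A.c n ^ 2 * A.h n ^ 2
  α_little : A.α =o[atTop] A.β

/-- The Fourier transform `k(u) = ∫ e^{-iuy} K(y) dy`. -/
noncomputable def kernFourier (K : ℝ → ℝ) (u : ℝ) : ℂ :=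
  ∫ y : ℝ, Complex.exp (-(Complex.I * u * y)) * (K y : ℂ)

/-- The conditions on the kernel. As `K` is Lipschitz, its total variation measure `|dK(u)|` is
`|K'(u)| du`. -/
structure KernelCond (K : ℝ → ℝ) : Prop where
  nonneg : ∀ u, 0 ≤ K u
  integrable : Integrable K
  total : ∫ u, K u = 1
  symm : ∀ u, K (-u) = K u
  bounded : ∃ C : ℝ, ∀ u, K u ≤ C
  continuous : Continuous K
  decay : Tendsto (fun u => u * K u) (cocompact ℝ) (𝓝 0)
  variation : Integrable fun u : ℝ => √(abs (u * Real.log |u|)) * |deriv K u|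
  lipschitz : ∃ k₀ > 0, ∀ u₁ u₂, |K u₁ - K u₂| ≤ k₀ * |u₁ - u₂|
  pos : ∃ ε > 0, ∃ U : Set ℝ, IsOpen U ∧ (0 : ℝ) ∈ U ∧ ∀ u ∈ U, ε ≤ K u
  fourier_integrable : Integrable (kernFourier K)
  fourier_lim : ∃ k : ℝ,
    Tendsto (fun u : ℝ => (1 - kernFourier K u) / (u : ℂ) ^ 2) (𝓝[≠] 0) (𝓝 (k : ℂ))

/-- The normal cone of `S` at `x`. -/
def normalCone (S : Set (Vec d)) (x : Vec d) : Set (Vec d) :=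
  {v | ∀ y ∈ S, inner ℝ v (y - x) ≤ 0}

/-- The tangent cone of a convex set `S` at `x ∈ S`, as the polar of the normal cone. -/
def tangentCone (S : Set (Vec d)) (x : Vec d) : Set (Vec d) :=
  {v | ∀ u ∈ normalCone S x, inner ℝ u v ≤ 0}

/-- `z` is the smallest force in `-normalCone S x` that keeps a motion with velocity `u` at the
position `x` from leaving `S`. -/
def IsMinForce (S : Set (Vec d)) (x u z : Vec d) : Prop :=
  -z ∈ normalCone S x ∧ u + z ∈ tangentCone S x ∧
    ∀ z', u + z' ∈ tangentCone S x → ‖z‖ ≤ ‖z'‖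

/-- `x` solves the projected equation `x' = F(x) + z` on `[0, ∞)`, in integrated form. -/
def IsProjSol (S : Set (Vec d)) (F : Vec d → Vec d) (x : ℝ → Vec d) : Prop :=
  (∀ t, 0 ≤ t → x t ∈ S) ∧ ∃ z : ℝ → Vec d,
    (∀ᵐ t, 0 ≤ t → IsMinForce S (x t) (F (x t)) (z t)) ∧
    ∀ t, 0 ≤ t → IntervalIntegrable (fun r => F (x r) + z r) volume 0 t ∧
      x t = x 0 + ∫ r in (0 : ℝ)..t, (F (x r) + z r)

/-- `x` is an equilibrium of the projected equation. -/
def IsEquilibrium (S : Set (Vec d)) (F : Vec d → Vec d) (x : Vec d) : Prop :=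
  IsProjSol S F fun _ => x

/-- `x` is a globally asymptotically stable equilibrium of the projected equation. -/
def IsGAS (S : Set (Vec d)) (F : Vec d → Vec d) (x : Vec d) : Prop :=
  IsEquilibrium S F x ∧
  (∀ ε > 0, ∃ δ > 0, ∀ y, IsProjSol S F y → ‖y 0 - x‖ < δ → ∀ t, 0 ≤ t → ‖y t - x‖ < ε) ∧
  ∀ y, IsProjSol S F y → Tendsto y atTop (𝓝 x)

/-- The step sizes, perturbation sizes and bandwidths are polynomial. -/
def PolyParams (A : Params) : Prop :=
  ∃ Cα Cβ Cc Ch nα nβ nc nh a b ec eh : ℝ,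
    0 < Cα ∧ 0 < Cβ ∧ 0 < Cc ∧ 0 < Ch ∧ 0 ≤ nα ∧ 0 ≤ nβ ∧ 0 ≤ nc ∧ 0 ≤ nh ∧
    1 / 2 < a ∧ a ≤ 1 ∧ 1 / 2 < b ∧ b ≤ 1 ∧ 0 < ec ∧ 0 < eh ∧ ec + eh < b / 2 ∧
    (∀ n : ℕ, 1 ≤ n →
      A.α n = Cα / ((n : ℝ) + nα) ^ a ∧ A.β n = Cβ / ((n : ℝ) + nβ) ^ b ∧
      A.c n = Cc / ((n : ℝ) + nc) ^ ec ∧ A.h n = Ch / ((n : ℝ) + nh) ^ eh) ∧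
    ∃ n₀ : ℕ, 0 < n₀ ∧ ∀ n : ℕ, n₀ ≤ n → 1 / (n : ℝ) ≤ A.α n ∧ A.α n < 1

/-- The additional conditions for rates of convergence. -/
structure RateCond {Ω : Type*} [MeasurableSpace Ω] (P : Problem d p Ξ) (T : Targets d p)
    (Pr : Measure Ω) (A : Params) (s : ℕ → Ω → State d p) (N : Set (Vec d)) (θs : Vec d) :
    Prop where
  poly : PolyParams A
  nu_smooth : ∀ θ ∈ P.feasible ∪ N, ContDiffAt ℝ 2 T.nu θ
  lam_smooth : ∀ θ ∈ P.feasible ∪ N, ContDiffAt ℝ 2 T.lam θ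
  hessian : ∃ ε > 0, ∀ᵐ ω ∂Pr, ∀ n, ∀ θ ∈ segment ℝ (s n ω).θ θs, ∀ v : Vec d,
    ε * ‖v‖ ^ 2 ≤ fderiv ℝ (fderiv ℝ (P.gbar T)) θ v v
  interior : θs ∈ interior P.feasible
  stable : IsGAS P.feasible (fun θ => -gradient (P.gbar T) θ) θs
  unique : ∀ θ, IsEquilibrium P.feasible (fun θ' => -gradient (P.gbar T) θ') θ → θ = θs
  g_smooth : ContDiff ℝ 2 P.g
  g_bounded : ∃ C : ℝ, ∀ z, ‖fderiv ℝ P.g z‖ ≤ C ∧ ‖iteratedFDeriv ℝ 2 P.g z‖ ≤ C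

end Assumptions

end KBSA

open KBSA

/-!
# Mean square rates of the gradient estimates

The quantities `ν`, `λ_j`, `G_ν`, `G_j` are compared with their targets `ν(θ_n)`, `λ_j(θ_n)`,
`∇ν(θ_n)`, `∇λ_j(θ_n)`. The mean squares `mse` of these `2 p + 2` errors satisfy a triangular system
of recursive inequalities (`exists_mse_recursion`)

  `mse_k (n + 1) ≤ (1 - a β) mse_k n + C β (∑ (rank i < rank k) mse_i n + R_k (1 + ∑ mse_i n))`,

in which `R_k` is, up to a constant factor, the square of the rate claimed for `G_ν` (if `k` is `ν`
or `G_ν`) or for `G_j` (if `k` is `λ_j` or `G_j`), and in which the order is `ν`, `λ_1, …, λ_p`,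
`G_ν`, `G_1, …, G_p`. Its solutions are of the order `R_k`.

**Contraction.** The noise of an iteration is independent of the past, so it can be integrated out
with the current state held fixed (`integral_comp_le_of_indepFun`). Up to bias, the mean increments
of `ν` and `λ_j` are then `q̄` and `m̄_j f`, where `f` is the density of `X(θ)`; they vanish at the
target, so that by the mean value theorem they are linear in the errors. The mean increments of
`G_ν` and `G_j` are the total derivatives of `q̄` and (times `f²`) of `m̄_j` along the current
estimates (`chainGrad`), and they vanish at the target by implicit differentiation
(`RateCond.chainGrad_target_eq_zero`). As `m̄_j` involves only `λ_1, …, λ_j`, all these linear forms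
are triangular. The diagonal coefficients are negative and bounded away from `0`, hence so is the
feedback of an error on itself, up to errors of smaller rank (`inner_triangular_le`).

**Bias.** A symmetric difference has a bias of third order in the step
(`norm_sub_sub_two_smul_fderiv_le`), and a random direction `δ` with `E[δ δᵀ] = 1` turns directional
differences into gradients (`IsRademacher.spQuot_moments`), which leaves `O(c²)`. Smoothing by a
symmetric kernel with finite second moment costs `O(h²)` (`KernelCond.abs_smooth_sub_le`). In the
recursion for `G_j` the product of two kernel weights at symmetric points produces, with
`A = m̄_j f` smoothed and `B = f` smoothed, the antisymmetric expression `A⁺ B⁻ - A⁻ B⁺`. Its even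
and odd parts give `(∇(m̄_j f)) f - m̄_j f ∇f = f² ∇m̄_j` as the leading term, with relative error
`O(c² + h²)` (`LinearGrowthC3.abs_smooth_mul_sub_le`, `Regularity.mDiff_moments`).

**Variance and drift.** The second moments of the increments are `O(1)`, `O(1 / h)`, `O(1 / c²)` and
`O(1 / (c h)²)`, which enters with a factor `β`. The targets move by `O(α)` in one step, which
enters as `(α / β)²`. The scaling of the perturbation keeps it of the size `c`, while the increments
of the gradient estimates pick up a factor that is at most linear in the estimates themselves
(`norm_cbar_smul_pdir_le`, `one_div_cbar_sq_le`); this, and the drift, is why `R_k` is multiplied by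
`1 + ∑ mse_i`. Contraction, bias, variance and drift are combined in `integral_norm_sq_step_le`
and `le_stepBound`.

**Solving the system.** As `R_k → 0`, a weighted sum of all errors contracts, so the mean squares
stay bounded (`exists_forall_le_of_triangular`). Then `mse_k = O(R_k)` by induction on the rank
(`exists_le_mul_of_triangular`), because `R_k` decays more slowly than the contraction: consecutive
values differ by a factor `1 - O(1 / n)`, and `1 / n ≤ α_n = o(β_n)`
(`PolyParams.eventually_rateOf_slow`).
-/

namespace KBSA

/-! ### Symmetric differences -/

section Taylor

variable {E F : Type*} [NormedAddCommGroup E] [NormedSpace ℝ E] [NormedAddCommGroup F]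
  [NormedSpace ℝ F]

lemma add_smul_mem_of_convex {S : Set E} (hS : Convex ℝ S) {x v : E} (hp : x + v ∈ S)
    (hm : x - v ∈ S) {s : ℝ} (hs : s ∈ Set.Icc (-1 : ℝ) 1) : x + s • v ∈ S := by
  have := hS hp hm (a := (1 + s) / 2) (b := (1 - s) / 2) (by linarith [hs.1]) (by linarith [hs.2])
    (by ring)
  convert this using 1
  module

lemma mem_of_convex_sub_add {S : Set E} (hS : Convex ℝ S) {x v : E} (hp : x + v ∈ S)
    (hm : x - v ∈ S) : x ∈ S := by
  simpa using add_smul_mem_of_convex hS hp hm (s := 0) (by simp)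

/-- The second symmetric difference is of second order. Only the two end points `x ± v` are required
to lie in the convex set `S`, not a ball around `x`. -/
lemma norm_add_add_sub_sub_two_smul_le {S : Set E} (hS : Convex ℝ S) {f : E → F} {M : ℝ}
    (hf : ∀ y ∈ S, ContDiffAt ℝ 2 f y) (hM : ∀ y ∈ S, ‖iteratedFDeriv ℝ 2 f y‖ ≤ M) {x v : E}
    (hp : x + v ∈ S) (hm : x - v ∈ S) :
    ‖f (x + v) + f (x - v) - (2 : ℝ) • f x‖ ≤ 2 * M * ‖v‖ ^ 2 := by
  have h1 : ∀ y ∈ S, DifferentiableAt ℝ f y := fun y hy => (hf y hy).differentiableAt two_ne_zero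
  have h2 : ∀ y ∈ S, DifferentiableAt ℝ (fderiv ℝ f) y := fun y hy =>
    ((hf y hy).fderiv_right (m := 1) (by norm_num)).differentiableAt one_ne_zero
  have hM' : ∀ y ∈ S, ‖fderiv ℝ (fderiv ℝ f) y‖ ≤ M := fun y hy => by
    rw [← norm_iteratedFDeriv_one, norm_iteratedFDeriv_fderiv]; exact hM y hy
  have key : ∀ s ∈ Set.Icc (0 : ℝ) 1, x + s • v ∈ S ∧ x - s • v ∈ S := fun s hs =>
    ⟨add_smul_mem_of_convex hS hp hm ⟨by linarith [hs.1], hs.2⟩, by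
      have := add_smul_mem_of_convex hS hp hm (s := -s) ⟨by linarith [hs.2], by linarith [hs.1]⟩
      simpa [sub_eq_add_neg] using this⟩
  have hd : ∀ s ∈ Set.Icc (0 : ℝ) 1, HasDerivWithinAt
      (fun s : ℝ => f (x + s • v) + f (x - s • v))
      (fderiv ℝ f (x + s • v) v - fderiv ℝ f (x - s • v) v) (Set.Icc 0 1) s := by
    intro s hs
    have hl : HasDerivAt (fun s : ℝ => x + s • v) v s := by
      simpa using ((hasDerivAt_id s).smul_const v).const_add x
    have hl' : HasDerivAt (fun s : ℝ => x - s • v) (-v) s := by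
      simpa using ((hasDerivAt_id s).smul_const v).const_sub x
    have a := (h1 _ (key s hs).1).hasFDerivAt.comp_hasDerivAt s hl
    have b := (h1 _ (key s hs).2).hasFDerivAt.comp_hasDerivAt s hl'
    have := a.add b
    rw [map_neg, ← sub_eq_add_neg] at this
    exact this.hasDerivWithinAt
  have hb : ∀ s ∈ Set.Ico (0 : ℝ) 1,
      ‖fderiv ℝ f (x + s • v) v - fderiv ℝ f (x - s • v) v‖ ≤ 2 * M * ‖v‖ ^ 2 := by
    intro s hs
    obtain ⟨ha, hb⟩ := key s ⟨hs.1, hs.2.le⟩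
    have h := hS.norm_image_sub_le_of_norm_fderiv_le (𝕜 := ℝ) h2 hM' hb ha
    have hM0 : 0 ≤ M := le_trans (norm_nonneg _) (hM _ ha)
    have hv : ‖x + s • v - (x - s • v)‖ ≤ 2 * ‖v‖ := by
      have : x + s • v - (x - s • v) = (2 * s) • v := by module
      rw [this, norm_smul, Real.norm_eq_abs, abs_of_nonneg (by linarith [hs.1])]
      nlinarith [norm_nonneg v, hs.2]
    rw [← sub_apply]
    calc _ ≤ ‖fderiv ℝ f (x + s • v) - fderiv ℝ f (x - s • v)‖ * ‖v‖ :=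
          ContinuousLinearMap.le_opNorm _ _
      _ ≤ (M * (2 * ‖v‖)) * ‖v‖ := by gcongr; exact h.trans (by gcongr)
      _ = _ := by ring
  have := norm_image_sub_le_of_norm_deriv_le_segment_01' hd hb
  have e : f (x + v) + f (x - v) - (2 : ℝ) • f x
    = f (x + (1 : ℝ) • v) + f (x - (1 : ℝ) • v) - (f (x + (0 : ℝ) • v) + f (x - (0 : ℝ) • v)) := by
    simp only [one_smul, zero_smul, add_zero, sub_zero, two_smul]
  rw [e]; exact this

/-- The first symmetric difference agrees with twice the derivative up to third order. -/
lemma norm_sub_sub_two_smul_fderiv_le {S : Set E} (hS : Convex ℝ S) {f : E → F} {M : ℝ}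
    (hf : ∀ y ∈ S, ContDiffAt ℝ 3 f y) (hM : ∀ y ∈ S, ‖iteratedFDeriv ℝ 3 f y‖ ≤ M) {x v : E}
    (hp : x + v ∈ S) (hm : x - v ∈ S) :
    ‖f (x + v) - f (x - v) - (2 : ℝ) • fderiv ℝ f x v‖ ≤ 2 * M * ‖v‖ ^ 3 := by
  have h1 : ∀ y ∈ S, DifferentiableAt ℝ f y := fun y hy => (hf y hy).differentiableAt three_ne_zero
  have key : ∀ s ∈ Set.Icc (0 : ℝ) 1, x + s • v ∈ S ∧ x - s • v ∈ S := fun s hs =>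
    ⟨add_smul_mem_of_convex hS hp hm ⟨by linarith [hs.1], hs.2⟩, by
      have := add_smul_mem_of_convex hS hp hm (s := -s) ⟨by linarith [hs.2], by linarith [hs.1]⟩
      simpa [sub_eq_add_neg] using this⟩
  have hd : ∀ s ∈ Set.Icc (0 : ℝ) 1, HasDerivWithinAt
      (fun s : ℝ => f (x + s • v) - f (x - s • v) - s • (2 : ℝ) • fderiv ℝ f x v)
      ((fderiv ℝ f (x + s • v) + fderiv ℝ f (x - s • v) - (2 : ℝ) • fderiv ℝ f x) v)
      (Set.Icc 0 1) s := by
    intro s hs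
    have hl : HasDerivAt (fun s : ℝ => x + s • v) v s := by
      simpa using ((hasDerivAt_id s).smul_const v).const_add x
    have hl' : HasDerivAt (fun s : ℝ => x - s • v) (-v) s := by
      simpa using ((hasDerivAt_id s).smul_const v).const_sub x
    have a := (h1 _ (key s hs).1).hasFDerivAt.comp_hasDerivAt s hl
    have b := (h1 _ (key s hs).2).hasFDerivAt.comp_hasDerivAt s hl'
    have c : HasDerivAt (fun s : ℝ => s • (2 : ℝ) • fderiv ℝ f x v)
        ((2 : ℝ) • fderiv ℝ f x v) s := by
      simpa using (hasDerivAt_id s).smul_const ((2 : ℝ) • fderiv ℝ f x v)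
    have := (a.sub b).sub c
    rw [map_neg, sub_neg_eq_add] at this
    exact this.hasDerivWithinAt
  have hb : ∀ s ∈ Set.Ico (0 : ℝ) 1,
      ‖(fderiv ℝ f (x + s • v) + fderiv ℝ f (x - s • v) - (2 : ℝ) • fderiv ℝ f x) v‖
        ≤ 2 * M * ‖v‖ ^ 3 := by
    intro s hs
    obtain ⟨ha, hb⟩ := key s ⟨hs.1, hs.2.le⟩
    have h := norm_add_add_sub_sub_two_smul_le hS (f := fderiv ℝ f)
      (fun y hy => (hf y hy).fderiv_right (by norm_num))
      (fun y hy => by rw [norm_iteratedFDeriv_fderiv]; exact hM y hy) ha hb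
    have hM0 : 0 ≤ M := le_trans (norm_nonneg _) (hM _ ha)
    have hv : ‖s • v‖ ≤ ‖v‖ := by
      rw [norm_smul, Real.norm_eq_abs, abs_of_nonneg hs.1]
      nlinarith [norm_nonneg v, hs.2]
    calc _ ≤ ‖fderiv ℝ f (x + s • v) + fderiv ℝ f (x - s • v) - (2 : ℝ) • fderiv ℝ f x‖ * ‖v‖ :=
          ContinuousLinearMap.le_opNorm _ _
      _ ≤ (2 * M * ‖v‖ ^ 2) * ‖v‖ := by gcongr; exact h.trans (by gcongr)
      _ = _ := by ring
  have := norm_image_sub_le_of_norm_deriv_le_segment_01' hd hb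
  simpa using this

end Taylor

/-! ### Recursive inequalities -/

section Sequences

/-- If `v` contracts at rate `a β` and is forced by `C β R`, where `R` decays more slowly than the
contraction, then `v = O(R)`. -/
lemma exists_le_mul_of_contraction {v β R : ℕ → ℝ} {a C : ℝ} (ha : 0 < a)
    (hR : ∀ n, 0 < R n) (hβ0 : ∀ᶠ n in atTop, 0 ≤ β n) (hβ : ∀ᶠ n in atTop, a * β n ≤ 1)
    (hslow : ∀ᶠ n in atTop, (1 - a / 2 * β n) * R n ≤ R (n + 1))
    (hv : ∀ᶠ n in atTop, v (n + 1) ≤ (1 - a * β n) * v n + C * β n * R n) :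
    ∃ M, 0 ≤ M ∧ ∀ᶠ n in atTop, v n ≤ M * R n := by
  obtain ⟨n₀, h⟩ := eventually_atTop.1 (hβ0.and (hβ.and (hslow.and hv)))
  set M := max (max (v n₀ / R n₀) (2 * C / a)) 0 with hM
  have h0 : 0 ≤ M := le_max_right _ _
  have h1 : C ≤ a / 2 * M := by
    have : 2 * C / a ≤ M := (le_max_right _ _).trans (le_max_left _ _)
    rw [div_le_iff₀ ha] at this; linarith
  refine ⟨M, h0, eventually_atTop.2 ⟨n₀, fun n hn => ?_⟩⟩
  induction n, hn using Nat.le_induction with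
  | base =>
    have : v n₀ / R n₀ ≤ M := (le_max_left _ _).trans (le_max_left _ _)
    rwa [div_le_iff₀ (hR _)] at this
  | succ n hn ih =>
    obtain ⟨hb0, hb, hs, hv⟩ := h n hn
    have hR0 := (hR n).le
    calc v (n + 1) ≤ (1 - a * β n) * v n + C * β n * R n := hv
      _ ≤ (1 - a * β n) * (M * R n) + (a / 2 * M) * β n * R n := by
        gcongr
      _ = M * ((1 - a / 2 * β n) * R n) := by ring
      _ ≤ M * R (n + 1) := by gcongr

/-- A triangular family of contractions, coupled from below with bounded weights and otherwise
with vanishing weights, stays bounded. Each sequence receives the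
weight `δ ^ r`, where `r` is its rank and `δ` is small: the coupling to lower ranks then costs a
factor `δ`, and the weighted sum is itself a contraction. -/
lemma exists_forall_le_of_triangular {ι : Type*} [Fintype ι] (rk : ι → ℕ) {v : ι → ℕ → ℝ}
    {β η : ℕ → ℝ} {a C : ℝ} (ha : 0 < a) (hC : 0 ≤ C) (hv0 : ∀ i n, 0 ≤ v i n)
    (hβ0 : ∀ᶠ n in atTop, 0 ≤ β n) (hβ : Tendsto β atTop (𝓝 0)) (hη : Tendsto η atTop (𝓝 0))
    (hη0 : ∀ᶠ n in atTop, 0 ≤ η n)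
    (hv : ∀ᶠ n in atTop, ∀ i, v i (n + 1) ≤ (1 - a * β n) * v i n
      + C * β n * (∑ k with rk k < rk i, v k n + η n * (1 + ∑ k, v k n))) :
    ∃ B, 0 ≤ B ∧ ∀ i, ∀ᶠ n in atTop, v i n ≤ B := by
  classical
  set c : ℝ := (Fintype.card ι : ℝ) with hc
  have hc0 : 0 ≤ c := Nat.cast_nonneg _
  set δ : ℝ := min 1 (a / (4 * (C * c + 1))) with hδ
  have hδ0 : 0 < δ := by positivity
  have hδ1 : δ ≤ 1 := min_le_left _ _
  have hδC : C * c * δ ≤ a / 4 := by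
    have h1 : δ ≤ a / (4 * (C * c + 1)) := min_le_right _ _
    rw [le_div_iff₀ (by positivity)] at h1
    nlinarith [mul_nonneg hC hc0]
  set w : ι → ℝ := fun i => δ ^ rk i with hw
  have hw0 : ∀ i, 0 < w i := fun i => by positivity
  have hw1 : ∀ i, w i ≤ 1 := fun i => pow_le_one₀ hδ0.le hδ1
  set q : ℝ := δ ^ (Finset.univ.sup rk) with hq
  have hq0 : 0 < q := by positivity
  have hqw : ∀ i, q ≤ w i := fun i =>
    pow_le_pow_of_le_one hδ0.le hδ1 (Finset.le_sup (f := rk) (Finset.mem_univ i))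
  set V : ℕ → ℝ := fun n => ∑ i, w i * v i n with hV
  have hvV : ∀ n, q * ∑ k, v k n ≤ V n := fun n => by
    rw [Finset.mul_sum]
    exact Finset.sum_le_sum fun i _ => mul_le_mul_of_nonneg_right (hqw i) (hv0 i n)
  -- a lower rank has a weight that is larger by the factor `δ⁻¹` at least
  have hlow : ∀ n, ∑ i, w i * ∑ k with rk k < rk i, v k n ≤ c * δ * V n := by
    intro n
    have : ∀ i, w i * ∑ k with rk k < rk i, v k n ≤ δ * V n := by
      intro i
      rw [Finset.mul_sum, hV, Finset.mul_sum]
      calc _ ≤ ∑ k with rk k < rk i, δ * (w k * v k n) := by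
            refine Finset.sum_le_sum fun k hk => ?_
            rw [← mul_assoc]
            refine mul_le_mul_of_nonneg_right ?_ (hv0 k n)
            rw [hw, ← pow_succ']
            exact pow_le_pow_of_le_one hδ0.le hδ1 (Finset.mem_filter.1 hk).2
        _ ≤ _ := Finset.sum_le_sum_of_subset_of_nonneg (Finset.filter_subset _ _)
            fun k _ _ => mul_nonneg hδ0.le (mul_nonneg (hw0 k).le (hv0 k n))
    calc _ ≤ ∑ _i : ι, δ * V n := Finset.sum_le_sum fun i _ => this i
      _ = c * δ * V n := by simp [hc, mul_assoc]
  have hηs : ∀ᶠ n in atTop, C * c * η n ≤ a / 4 * q := by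
    have : Tendsto (fun n => C * c * η n) atTop (𝓝 0) := by simpa using hη.const_mul (C * c)
    exact (this.eventually_lt_const (by positivity)).mono fun n h => h.le
  have hβs : ∀ᶠ n in atTop, a / 2 * β n ≤ 1 := by
    have : Tendsto (fun n => a / 2 * β n) atTop (𝓝 0) := by simpa using hβ.const_mul (a / 2)
    exact (this.eventually_lt_const zero_lt_one).mono fun n h => h.le
  -- each of the two couplings uses up a quarter of the contraction rate `a`
  have hVrec : ∀ᶠ n in atTop, V (n + 1) ≤ (1 - a / 2 * β n) * V n + (a / 4 * q) * β n * 1 := by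
    filter_upwards [hv, hβ0, hηs, hη0] with n h hb hs h0
    have e0 : 0 ≤ 1 + ∑ k, v k n := by
      have := Finset.sum_nonneg (s := Finset.univ) fun k _ => hv0 k n
      linarith
    calc V (n + 1) ≤ ∑ i, w i * ((1 - a * β n) * v i n
          + C * β n * (∑ k with rk k < rk i, v k n + η n * (1 + ∑ k, v k n))) :=
          Finset.sum_le_sum fun i _ => mul_le_mul_of_nonneg_left (h i) (hw0 i).le
      _ = (1 - a * β n) * V n + C * β n * (∑ i, w i * ∑ k with rk k < rk i, v k n
          + (∑ i, w i) * (η n * (1 + ∑ k, v k n))) := by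
          have e : ∀ i, w i * ((1 - a * β n) * v i n
              + C * β n * (∑ k with rk k < rk i, v k n + η n * (1 + ∑ k, v k n)))
              = (1 - a * β n) * (w i * v i n) + C * β n * (w i * ∑ k with rk k < rk i, v k n)
                + C * β n * (w i * (η n * (1 + ∑ k, v k n))) := fun i => by ring
          simp_rw [e]
          rw [Finset.sum_add_distrib, Finset.sum_add_distrib, ← Finset.mul_sum, ← Finset.mul_sum,
            ← Finset.mul_sum, ← Finset.sum_mul, hV]
          ring
      _ ≤ (1 - a * β n) * V n + C * β n * (c * δ * V n + c * (η n * (1 + ∑ k, v k n))) := by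
          have : ∑ i, w i ≤ c := by
            calc _ ≤ ∑ _i : ι, (1 : ℝ) := Finset.sum_le_sum fun i _ => hw1 i
              _ = c := by simp [hc]
          have := hlow n
          gcongr
      _ = (1 - a * β n) * V n + β n * ((C * c * δ) * V n + (C * c * η n) * (1 + ∑ k, v k n)) := by
          ring
      _ ≤ (1 - a * β n) * V n + β n * (a / 4 * V n + (a / 4 * q) * (1 + ∑ k, v k n)) := by
          have : 0 ≤ V n := Finset.sum_nonneg fun i _ => mul_nonneg (hw0 i).le (hv0 i n)
          gcongr
      _ ≤ (1 - a * β n) * V n + β n * (a / 4 * V n + a / 4 * q + a / 4 * V n) := by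
          have := mul_le_mul_of_nonneg_left (hvV n) (by positivity : 0 ≤ a / 4)
          have e : (a / 4 * q) * (1 + ∑ k, v k n) ≤ a / 4 * q + a / 4 * V n := by linarith
          have := mul_le_mul_of_nonneg_left e hb
          linarith
      _ = _ := by ring
  obtain ⟨M, hM0, hM⟩ := exists_le_mul_of_contraction (R := fun _ => 1) (half_pos ha)
    (fun _ => one_pos) hβ0 hβs
    (by filter_upwards [hβ0] with n hn; nlinarith) hVrec
  refine ⟨M / q, by positivity, fun i => ?_⟩
  filter_upwards [hM] with n hn
  rw [le_div_iff₀ hq0]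
  calc v i n * q ≤ w i * v i n := by
        rw [mul_comm]; exact mul_le_mul_of_nonneg_right (hqw i) (hv0 i n)
    _ ≤ V n := Finset.single_le_sum (f := fun i => w i * v i n)
        (fun i _ => mul_nonneg (hw0 i).le (hv0 i n)) (Finset.mem_univ i)
    _ ≤ M := by simpa using hn

end Sequences

/-! ### One step of a noisy contraction -/

section OneStep

variable {E Y : Type*} [NormedAddCommGroup E] [InnerProductSpace ℝ E] [CompleteSpace E]
  [MeasurableSpace Y]

/-- The mean square error after one step: `x` is the current error, `β U` the noisy correction and
`b` the displacement of the target. -/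
lemma integral_norm_sq_step_le {ρ : Measure Y} [IsProbabilityMeasure ρ] {U : Y → E}
    (hU : AEStronglyMeasurable U ρ) (hU2 : Integrable (fun y => ‖U y‖ ^ 2) ρ) {a β r τ W : ℝ}
    (ha : 0 < a) (hβ : 0 < β) (hβ1 : β ≤ 1) (hW : ∫ y, ‖U y‖ ^ 2 ∂ρ ≤ W) {x b : E}
    (hin : inner ℝ x (∫ y, U y ∂ρ) ≤ -a * ‖x‖ ^ 2 + ‖x‖ * r) (hb : ‖b‖ ≤ τ) :
    Integrable (fun y => ‖x + β • U y - b‖ ^ 2) ρ ∧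
    ∫ y, ‖x + β • U y - b‖ ^ 2 ∂ρ ≤ (1 - a * β) * ‖x‖ ^ 2
      + (2 / a + 2) * β * (τ ^ 2 / β ^ 2 + r ^ 2 + β * W) := by
  have hUm : MemLp U 2 ρ := (memLp_two_iff_integrable_sq_norm hU).2 hU2
  have hUi : Integrable U ρ := hUm.integrable one_le_two
  set m := ∫ y, U y ∂ρ with hm
  have hin1 : Integrable (fun y => inner ℝ (x - b) (U y)) ρ := hUi.const_inner _
  have e : ∀ y, ‖x + β • U y - b‖ ^ 2
      = ‖x - b‖ ^ 2 + 2 * β * inner ℝ (x - b) (U y) + β ^ 2 * ‖U y‖ ^ 2 := by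
    intro y
    have : x + β • U y - b = (x - b) + β • U y := by abel
    rw [this, norm_add_sq_real, inner_smul_right, norm_smul, Real.norm_eq_abs, mul_pow, sq_abs]
    ring
  have hI : ∫ y, ‖x + β • U y - b‖ ^ 2 ∂ρ
      = ‖x - b‖ ^ 2 + 2 * β * inner ℝ (x - b) m + β ^ 2 * ∫ y, ‖U y‖ ^ 2 ∂ρ := by
    simp_rw [e]
    have i1 : Integrable (fun y => 2 * β * inner ℝ (x - b) (U y)) ρ := hin1.const_mul _
    have i2 : Integrable (fun y => β ^ 2 * ‖U y‖ ^ 2) ρ := hU2.const_mul _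
    have i3 : Integrable (fun y => ‖x - b‖ ^ 2 + 2 * β * inner ℝ (x - b) (U y)) ρ :=
      (integrable_const _).add i1
    rw [integral_add i3 i2, integral_add (integrable_const _) i1, integral_const_mul,
      integral_const_mul,
      integral_inner hUi, ← hm]
    simp
  refine ⟨?_, ?_⟩
  · simp_rw [e]
    exact ((integrable_const _).add (hin1.const_mul _)).add (hU2.const_mul _)
  -- the squared mean is at most the mean square
  have hm2 : ‖m‖ ^ 2 ≤ W := by
    have h1 : ‖m‖ ≤ ∫ y, ‖U y‖ ∂ρ := norm_integral_le_integral_norm _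
    have h0 : 0 ≤ ∫ y, (‖U y‖ - ‖m‖) ^ 2 ∂ρ := integral_nonneg fun y => sq_nonneg _
    have h2 : ∫ y, (‖U y‖ - ‖m‖) ^ 2 ∂ρ
        = ∫ y, ‖U y‖ ^ 2 ∂ρ - 2 * ‖m‖ * ∫ y, ‖U y‖ ∂ρ + ‖m‖ ^ 2 := by
      have : ∀ y, (‖U y‖ - ‖m‖) ^ 2 = ‖U y‖ ^ 2 - 2 * ‖m‖ * ‖U y‖ + ‖m‖ ^ 2 := fun y => by ring
      simp_rw [this]
      have i1 : Integrable (fun y => 2 * ‖m‖ * ‖U y‖) ρ := hUi.norm.const_mul _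
      have i2 : Integrable (fun y => ‖U y‖ ^ 2 - 2 * ‖m‖ * ‖U y‖) ρ := hU2.sub i1
      rw [integral_add i2 (integrable_const _), integral_sub hU2 i1, integral_const_mul]
      simp
    nlinarith [norm_nonneg m]
  rw [hI]
  have hτ : 0 ≤ τ := (norm_nonneg _).trans hb
  have hb2 : ‖b‖ ^ 2 ≤ τ ^ 2 := by gcongr
  have hxb : -inner ℝ x b ≤ ‖x‖ * τ := by
    have := abs_real_inner_le_norm x b
    have h2 : ‖x‖ * ‖b‖ ≤ ‖x‖ * τ := by gcongr
    linarith [neg_abs_le (inner ℝ x b)]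
  have hbm : -(2 * β * inner ℝ b m) ≤ τ ^ 2 + β ^ 2 * W := by
    have h1 := norm_add_sq_real b (β • m)
    rw [inner_smul_right, norm_smul, Real.norm_eq_abs, mul_pow, sq_abs] at h1
    have := sq_nonneg ‖b + β • m‖
    nlinarith [mul_le_mul_of_nonneg_left hm2 (sq_nonneg β)]
  have hexp : ‖x - b‖ ^ 2 = ‖x‖ ^ 2 - 2 * inner ℝ x b + ‖b‖ ^ 2 := norm_sub_sq_real x b
  rw [hexp, inner_sub_left]
  -- Young's inequality for the two cross terms
  have y1 : 2 * ‖x‖ * τ ≤ a * β / 2 * ‖x‖ ^ 2 + 2 / a * (τ ^ 2 / β) := by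
    have h1 : 2 / a * (τ ^ 2 / β) = 2 * τ ^ 2 / (a * β) := by field_simp
    rw [h1, ← sub_nonneg]
    have : a * β / 2 * ‖x‖ ^ 2 + 2 * τ ^ 2 / (a * β) - 2 * ‖x‖ * τ
        = (a * β * ‖x‖ - 2 * τ) ^ 2 / (2 * (a * β)) := by field_simp; ring
    rw [this]; positivity
  have y2 : 2 * ‖x‖ * r ≤ a / 2 * ‖x‖ ^ 2 + 2 / a * r ^ 2 := by
    rw [← sub_nonneg]
    have : a / 2 * ‖x‖ ^ 2 + 2 / a * r ^ 2 - 2 * ‖x‖ * r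
        = (a * ‖x‖ - 2 * r) ^ 2 / (2 * a) := by field_simp; ring
    rw [this]; positivity
  have y3 : τ ^ 2 ≤ τ ^ 2 / β := by rw [le_div_iff₀ hβ]; nlinarith [sq_nonneg τ]
  have hrhs : (2 / a + 2) * β * (τ ^ 2 / β ^ 2 + r ^ 2 + β * W)
      = 2 / a * (τ ^ 2 / β) + 2 * (τ ^ 2 / β) + β * (2 / a * r ^ 2) + 2 * β * r ^ 2
        + (2 / a + 2) * β ^ 2 * W := by field_simp; ring
  rw [hrhs]
  have hW0 : 0 ≤ W := (sq_nonneg _).trans hm2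
  have p1 : 0 ≤ 2 / a * β ^ 2 * W := by positivity
  have p2 : 0 ≤ β * r ^ 2 := by positivity
  have i1 := mul_le_mul_of_nonneg_left hin hβ.le
  have i2 := mul_le_mul_of_nonneg_left y2 hβ.le
  have i3 := mul_le_mul_of_nonneg_left hW (sq_nonneg β)
  nlinarith

end OneStep

/-! ### The metric projection -/

section Projection

variable {d : ℕ} {S : Set (Vec d)}

lemma proj_spec (hS : IsCompact S) (hne : S.Nonempty) (x : Vec d) :
    proj S x ∈ S ∧ ∀ z ∈ S, ‖x - proj S x‖ ≤ ‖x - z‖ := by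
  have h : ∃ y ∈ S, ∀ z ∈ S, ‖x - y‖ ≤ ‖x - z‖ := by
    obtain ⟨y, hy, h⟩ := hS.exists_isMinOn hne
      (f := fun y => ‖x - y‖) (by fun_prop)
    exact ⟨y, hy, fun z hz => h hz⟩
  rw [proj, dif_pos h]
  exact h.choose_spec

lemma inner_sub_proj_le_zero (hS : IsCompact S) (hne : S.Nonempty) (hc : Convex ℝ S) (x : Vec d)
    {z : Vec d} (hz : z ∈ S) : inner ℝ (x - proj S x) (z - proj S x) ≤ 0 := by
  obtain ⟨h1, h2⟩ := proj_spec hS hne x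
  refine (norm_eq_iInf_iff_real_inner_le_zero hc h1).1 ?_ z hz
  have : Nonempty S := ⟨⟨_, h1⟩⟩
  refine le_antisymm (le_ciInf fun w => h2 w w.2) ?_
  exact ciInf_le (f := fun w : S => ‖x - w‖)
    ⟨0, by rintro _ ⟨w, rfl⟩; exact norm_nonneg _⟩ ⟨_, h1⟩

lemma lipschitzWith_proj (hS : IsCompact S) (hne : S.Nonempty) (hc : Convex ℝ S) :
    LipschitzWith 1 (proj S) := by
  refine LipschitzWith.of_dist_le_mul fun x y => ?_
  rw [NNReal.coe_one, one_mul, dist_eq_norm, dist_eq_norm]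
  have h1 := inner_sub_proj_le_zero hS hne hc x (proj_spec hS hne y).1
  have h2 := inner_sub_proj_le_zero hS hne hc y (proj_spec hS hne x).1
  set p := proj S x
  set q := proj S y
  have h3 : ‖p - q‖ ^ 2 ≤ inner ℝ (x - y) (p - q) := by
    rw [← real_inner_self_eq_norm_sq]
    have e : inner ℝ (p - q) (p - q) = inner ℝ (x - y) (p - q) + inner ℝ (x - p) (q - p)
        + inner ℝ (y - q) (p - q) := by
      simp only [inner_sub_left, inner_sub_right]; ring
    linarith
  have h4 := real_inner_le_norm (x - y) (p - q)
  by_contra! hlt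
  nlinarith [norm_nonneg (x - y), norm_nonneg (p - q)]

/-- The projection moves a point no farther from a point of the set. -/
lemma norm_proj_sub_le (hS : IsCompact S) (hc : Convex ℝ S) (x : Vec d) {θ : Vec d}
    (hθ : θ ∈ S) : ‖proj S x - θ‖ ≤ ‖x - θ‖ := by
  have hne : S.Nonempty := ⟨θ, hθ⟩
  have h : proj S θ = θ := by
    have := (proj_spec hS hne θ).2 θ hθ
    rw [sub_self, norm_zero] at this
    exact (sub_eq_zero.1 (norm_le_zero_iff.1 this)).symm
  have := (lipschitzWith_proj hS hne hc).dist_le_mul x θ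
  rw [h] at this
  simpa [dist_eq_norm] using this

end Projection

/-! ### The kernel -/

section Kernel

variable {K : ℝ → ℝ}

/-- The second moment is the limit of the truncated ones, which the Fourier transform near `0`
bounds because `1 - cos x ≥ x² / 4` for `|x| ≤ 1`: the frequency `1 / (n + 1)` controls the
interval `[-(n + 1), n + 1]`. -/
lemma KernelCond.integrable_sq_mul (hK : KernelCond K) : Integrable fun u => u ^ 2 * K u := by
  obtain ⟨k, hk⟩ := hK.fourier_lim
  set t : ℕ → ℝ := fun n => 1 / ((n : ℝ) + 1) with ht
  have ht0 : ∀ n, 0 < t n := fun n => by positivity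
  have htl : Tendsto t atTop (𝓝[≠] 0) :=
    tendsto_nhdsWithin_iff.2 ⟨tendsto_one_div_add_atTop_nhds_zero_nat,
      Eventually.of_forall fun n => (ht0 n).ne'⟩
  have hlim := (Complex.continuous_re.tendsto _).comp (hk.comp htl)
  have hcos : ∀ s : ℝ, Integrable fun y => Real.cos (s * y) * K y := fun s =>
    hK.integrable.bdd_mul (c := 1) (by fun_prop)
      (ae_of_all _ fun y => by simpa using Real.abs_cos_le_one _)
  have hre : ∀ s : ℝ, (kernFourier K s).re = ∫ y, Real.cos (s * y) * K y := by
    intro s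
    have hi : Integrable fun y : ℝ => Complex.exp (-(Complex.I * s * y)) * (K y : ℂ) := by
      refine hK.integrable.ofReal.bdd_mul (c := 1) (by fun_prop) (ae_of_all _ fun y => ?_)
      rw [Complex.norm_exp]; simp
    rw [kernFourier, ← RCLike.re_eq_complex_re, ← integral_re hi]
    refine integral_congr_ae (ae_of_all _ fun y => ?_)
    simp [Complex.exp_re]
  have hval : ∀ s : ℝ, s ≠ 0 → ((1 - kernFourier K s) / (s : ℂ) ^ 2).re
      = ∫ y, (1 - Real.cos (s * y)) / s ^ 2 * K y := by
    intro s hs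
    rw [← Complex.ofReal_pow, Complex.div_ofReal_re, Complex.sub_re, hre, Complex.one_re]
    have e : ∀ y, (1 - Real.cos (s * y)) / s ^ 2 * K y
        = (K y - Real.cos (s * y) * K y) / s ^ 2 := fun y => by ring
    simp_rw [e]
    rw [integral_div, integral_sub hK.integrable (hcos s), hK.total]
  have hb : ∀ᶠ n in atTop, ((1 - kernFourier K (t n)) / ((t n : ℝ) : ℂ) ^ 2).re ≤ k + 1 := by
    refine (hlim.eventually_lt_const (u := k + 1) (by simp)).mono fun n h => h.le
  have hcover : AECover volume atTop fun n : ℕ => Set.Icc (-((n : ℝ) + 1)) ((n : ℝ) + 1) :=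
    aecover_Icc (tendsto_neg_atTop_atBot.comp
      (tendsto_atTop_add_const_right _ _ tendsto_natCast_atTop_atTop))
      (tendsto_atTop_add_const_right _ _ tendsto_natCast_atTop_atTop)
  refine hcover.integrable_of_integral_norm_bounded (4 * (k + 1)) (fun n => ?_) ?_
  · exact ((by fun_prop : Continuous fun u : ℝ => u ^ 2).mul hK.continuous).continuousOn
      |>.integrableOn_compact isCompact_Icc
  filter_upwards [hb] with n hn
  rw [hval _ (ht0 n).ne'] at hn
  have hi : Integrable fun y => (1 - Real.cos (t n * y)) / t n ^ 2 * K y := by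
    have e : ∀ y, (1 - Real.cos (t n * y)) / t n ^ 2 * K y
        = (K y - Real.cos (t n * y) * K y) / t n ^ 2 := fun y => by ring
    simp_rw [e]
    exact (hK.integrable.sub (hcos _)).div_const _
  have h0 : ∀ y, 0 ≤ (1 - Real.cos (t n * y)) / t n ^ 2 * K y := fun y =>
    mul_nonneg (div_nonneg (by linarith [Real.cos_le_one (t n * y)]) (sq_nonneg _)) (hK.nonneg y)
  calc ∫ y in Set.Icc (-((n : ℝ) + 1)) ((n : ℝ) + 1), ‖y ^ 2 * K y‖
      ≤ ∫ y in Set.Icc (-((n : ℝ) + 1)) ((n : ℝ) + 1),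
          4 * ((1 - Real.cos (t n * y)) / t n ^ 2 * K y) := by
        refine setIntegral_mono_on ?_ (hi.const_mul 4).integrableOn measurableSet_Icc ?_
        · exact (((by fun_prop : Continuous fun u : ℝ => u ^ 2).mul
            hK.continuous).norm).continuousOn
            |>.integrableOn_compact isCompact_Icc
        intro y hy
        have hx : |t n * y| ≤ 1 := by
          rw [abs_mul, abs_of_pos (ht0 n), ht]
          have := abs_le.2 hy
          rw [div_mul_eq_mul_div, one_mul, div_le_one (by positivity)]
          exact this
        have hc := (abs_le.1 (Real.cos_bound hx)).2
        rw [Real.norm_of_nonneg (mul_nonneg (sq_nonneg _) (hK.nonneg y)), ← mul_assoc]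
        refine mul_le_mul_of_nonneg_right ?_ (hK.nonneg y)
        have h4 : |t n * y| ^ 4 ≤ (t n * y) ^ 2 := by
          rw [show |t n * y| ^ 4 = |t n * y| ^ 2 * |t n * y| ^ 2 by ring, sq_abs]
          have : (t n * y) ^ 2 ≤ 1 := by rw [← sq_abs]; exact pow_le_one₀ (abs_nonneg _) hx
          nlinarith [sq_nonneg (t n * y)]
        rw [← mul_div_assoc, le_div_iff₀ (pow_pos (ht0 n) 2)]
        have e : y ^ 2 * t n ^ 2 = (t n * y) ^ 2 := by ring
        rw [e]; nlinarith [sq_nonneg (t n * y)]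
    _ ≤ ∫ y, 4 * ((1 - Real.cos (t n * y)) / t n ^ 2 * K y) :=
        setIntegral_le_integral (hi.const_mul 4)
          (ae_of_all _ fun y => mul_nonneg (by norm_num) (h0 y))
    _ ≤ 4 * (k + 1) := by rw [integral_const_mul]; gcongr

lemma KernelCond.integrable_one_add_sq_mul (hK : KernelCond K) :
    Integrable fun u => (1 + u ^ 2) * K u := by
  have := hK.integrable.add hK.integrable_sq_mul
  refine this.congr (ae_of_all _ fun u => ?_)
  simp; ring

/-- Large arguments are covered by `u K(u) → 0`, bounded ones by the boundedness of `K`. -/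
lemma KernelCond.exists_abs_mul_le (hK : KernelCond K) : ∃ C, 0 ≤ C ∧ ∀ u, |u| * K u ≤ C := by
  obtain ⟨B, hB⟩ := hK.bounded
  have h := hK.decay.eventually (Metric.ball_mem_nhds 0 one_pos)
  rw [Filter.Eventually, Metric.mem_cocompact_iff_closedBall_compl_subset 0] at h
  obtain ⟨r, hr⟩ := h
  have hB0 : 0 ≤ B := (hK.nonneg 0).trans (hB 0)
  refine ⟨max 1 (|r| * B), le_max_of_le_left zero_le_one, fun u => ?_⟩
  by_cases hu : |u| ≤ r
  · refine le_max_of_le_right ?_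
    have : |u| ≤ |r| := hu.trans (le_abs_self r)
    have := hK.nonneg u
    have := hB u
    gcongr
  · refine le_max_of_le_left ?_
    have := hr (a := u) (by simpa using hu)
    have h2 : dist (u * K u) 0 < 1 := this
    rw [dist_zero_right, norm_mul, Real.norm_eq_abs, Real.norm_eq_abs,
      abs_of_nonneg (hK.nonneg u)] at h2
    exact h2.le

lemma one_add_abs_le_two_mul (u : ℝ) : 1 + |u| ≤ 2 * (1 + u ^ 2) := by
  rw [← sq_abs]; nlinarith [sq_nonneg (|u| - 1)]

lemma one_add_abs_mul_le {h : ℝ} (h0 : 0 ≤ h) (h1 : h ≤ 1) (u : ℝ) :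
    1 + |-(h * u)| ≤ 2 * (1 + u ^ 2) := by
  rw [abs_neg, abs_mul, abs_of_nonneg h0]
  nlinarith [one_add_abs_le_two_mul u, abs_nonneg u]

/-- `∫ (1 + u²) K(u) du`. -/
noncomputable def kmom (K : ℝ → ℝ) : ℝ := ∫ u, (1 + u ^ 2) * K u

lemma KernelCond.kmom_nonneg (hK : KernelCond K) : 0 ≤ kmom K :=
  integral_nonneg fun u => mul_nonneg (by positivity) (hK.nonneg u)

lemma KernelCond.integrable_mul_comp (hK : KernelCond K) {h B : ℝ} (h0 : 0 ≤ h) (h1 : h ≤ 1)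
    {φ : ℝ → ℝ} (hφ : Continuous φ) (hB : ∀ w, |φ w| ≤ B * (1 + |w|)) :
    Integrable fun u => K u * φ (-(h * u)) := by
  refine (hK.integrable_one_add_sq_mul.const_mul (2 * B)).mono'
    (hK.continuous.mul (by fun_prop)).aestronglyMeasurable (ae_of_all _ fun u => ?_)
  have hB0 : 0 ≤ B := by have := (abs_nonneg _).trans (hB 0); simpa using this
  rw [norm_mul, Real.norm_eq_abs, abs_of_nonneg (hK.nonneg u), Real.norm_eq_abs]
  calc K u * |φ (-(h * u))| ≤ K u * (B * (2 * (1 + u ^ 2))) := by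
        have := hK.nonneg u
        gcongr
        exact (hB _).trans (by gcongr; exact one_add_abs_mul_le h0 h1 u)
    _ = _ := by ring

lemma KernelCond.abs_integral_le (hK : KernelCond K) {M : ℝ} {ψ : ℝ → ℝ}
    (hM : ∀ u, |ψ u| ≤ M * (1 + u ^ 2)) : |∫ u, K u * ψ u| ≤ M * kmom K := by
  rw [kmom, ← integral_const_mul, ← Real.norm_eq_abs]
  refine norm_integral_le_of_norm_le (hK.integrable_one_add_sq_mul.const_mul M)
    (ae_of_all _ fun u => ?_)
  rw [norm_mul, Real.norm_eq_abs, abs_of_nonneg (hK.nonneg u), Real.norm_eq_abs]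
  have := mul_le_mul_of_nonneg_left (hM u) (hK.nonneg u)
  linarith

/-- The bias of smoothing by a symmetric kernel is of second order. -/
lemma KernelCond.abs_smooth_sub_le (hK : KernelCond K) {h B M : ℝ} (h0 : 0 ≤ h) (h1 : h ≤ 1)
    {φ : ℝ → ℝ} (hφ : Continuous φ) (hB : ∀ w, |φ w| ≤ B * (1 + |w|))
    (hM : ∀ w, |φ w + φ (-w) - 2 * φ 0| ≤ M * w ^ 2) :
    |(∫ u, K u * φ (-(h * u))) - φ 0| ≤ M * h ^ 2 * kmom K := by
  have hi := hK.integrable_mul_comp h0 h1 hφ hB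
  have hi' : Integrable fun u => K u * φ (h * u) := by
    have := hi.comp_neg
    simpa [hK.symm] using this
  have hM0 : 0 ≤ M := by have := (abs_nonneg _).trans (hM 1); simpa using this
  have e1 : ∫ u, K u * φ (-(h * u)) = ∫ u, K u * φ (h * u) := by
    rw [← integral_neg_eq_self (fun u => K u * φ (h * u))]
    simp [hK.symm]
  have e2 : ∫ u, K u * (φ (h * u) + φ (-(h * u)) - 2 * φ 0)
      = 2 * ((∫ u, K u * φ (-(h * u))) - φ 0) := by
    have : ∀ u, K u * (φ (h * u) + φ (-(h * u)) - 2 * φ 0)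
      = K u * φ (h * u) + K u * φ (-(h * u)) - K u * (2 * φ 0) := fun u => by ring
    simp_rw [this]
    have i2 : Integrable fun u => K u * φ (h * u) + K u * φ (-(h * u)) := hi'.add hi
    rw [integral_sub i2 (hK.integrable.mul_const _), integral_add hi' hi, integral_mul_const,
      hK.total, ← e1]
    ring
  have h3 := hK.abs_integral_le (M := M * h ^ 2)
    (ψ := fun u => φ (h * u) + φ (-(h * u)) - 2 * φ 0) (fun u => by
      calc _ ≤ M * (h * u) ^ 2 := hM _
        _ ≤ _ := by nlinarith [mul_nonneg hM0 (sq_nonneg h)])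
  rw [e2, abs_mul, abs_two] at h3
  nlinarith [abs_nonneg ((∫ u, K u * φ (-(h * u))) - φ 0)]

end Kernel

/-! ### Smoothing a function along a line -/

section Smoothing

variable {V : Type*} [NormedAddCommGroup V] [NormedSpace ℝ V] {K : ℝ → ℝ} {H f : V → ℝ}
  {Z : Set V} {e : V} {C h : ℝ}

/-- On the lines through `Z` in the direction `e`, the function `H` is three times continuously
differentiable and its derivatives of orders `0, 1, 2, 3` grow at most linearly. -/
def LinearGrowthC3 (H : V → ℝ) (Z : Set V) (e : V) (C : ℝ) : Prop :=
  ∀ z ∈ Z, ∀ w : ℝ, ContDiffAt ℝ 3 H (z + w • e) ∧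
    ∀ i ≤ 3, ‖iteratedFDeriv ℝ i H (z + w • e)‖ ≤ C * (1 + |w|)

/-- The convolution of `H` with the kernel of bandwidth `h`, in the direction `e`. -/
noncomputable def smooth (K : ℝ → ℝ) (h : ℝ) (H : V → ℝ) (e z : V) : ℝ :=
  ∫ u, K u * H (z + (-(h * u)) • e)

/-- The elementary estimate behind the antisymmetric product of two smoothed functions: `ao`, `bo`
are odd parts with linear approximations `a1`, `b1`, and `ae`, `be` are even parts close to `a0`,
`b0`. -/
lemma abs_odd_even_product_le {ao ae bo be a0 a1 b0 b1 C k σ n : ℝ} (hC : 0 ≤ C) (hk : 0 ≤ k)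
    (hσ0 : 0 ≤ σ) (hσ2 : σ ≤ 2) (hn : 0 ≤ n) (Ao : |ao - a1| ≤ k * σ * n)
    (Bo : |bo - b1| ≤ k * σ * n) (Ae : |ae - a0| ≤ k * σ) (Be : |be - b0| ≤ k * σ)
    (H0 : |a0| ≤ C) (F0 : |b0| ≤ C) (HD : |a1| ≤ C * n) (FD : |b1| ≤ C * n) :
    |ao * be - ae * bo - (a1 * b0 - a0 * b1)| ≤ 4 * k * (C + k) * σ * n := by
  have e1 : ao * be - ae * bo - (a1 * b0 - a0 * b1)
      = (ao - a1) * b0 + (ao - a1) * (be - b0) + a1 * (be - b0)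
        - (ae - a0) * b1 - (ae - a0) * (bo - b1) - a0 * (bo - b1) := by ring
  have p1 : 0 ≤ k * σ := by positivity
  have p2 : 0 ≤ k * σ * n := by positivity
  have p3 : 0 ≤ C * n := by positivity
  have t1 := mul_le_mul Ao F0 (abs_nonneg _) p2
  have t2 := mul_le_mul Ao Be (abs_nonneg _) p2
  have t3 := mul_le_mul HD Be (abs_nonneg _) p3
  have t4 := mul_le_mul Ae FD (abs_nonneg _) p1
  have t5 := mul_le_mul Ae Bo (abs_nonneg _) p1
  have t6 := mul_le_mul H0 Bo (abs_nonneg _) hC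
  rw [← abs_mul] at t1 t2 t3 t4 t5 t6
  have t8 : (k * σ * n) * (k * σ) ≤ (k * σ * n) * (k * 2) := by gcongr
  rw [e1]
  rw [abs_le] at t1 t2 t3 t4 t5 t6 ⊢
  constructor
  · linarith [t1.1, t2.1, t3.1, t4.2, t5.2, t6.2]
  · linarith [t1.2, t2.2, t3.2, t4.1, t5.1, t6.1]

namespace LinearGrowthC3

lemma nonneg (hH : LinearGrowthC3 H Z e C) (hne : Z.Nonempty) : 0 ≤ C := by
  obtain ⟨z, hz⟩ := hne
  have := le_trans (norm_nonneg _) ((hH z hz 0).2 0 (by norm_num))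
  simpa using this

lemma abs_le (hH : LinearGrowthC3 H Z e C) {z : V} (hz : z ∈ Z) (w : ℝ) :
    |H (z + w • e)| ≤ C * (1 + |w|) := by
  simpa using (hH z hz w).2 0 (by norm_num)

lemma abs_le_self (hH : LinearGrowthC3 H Z e C) {z : V} (hz : z ∈ Z) : |H z| ≤ C := by
  simpa using hH.abs_le hz 0

lemma norm_fderiv_le (hH : LinearGrowthC3 H Z e C) {z : V} (hz : z ∈ Z) (w : ℝ) :
    ‖fderiv ℝ H (z + w • e)‖ ≤ C * (1 + |w|) := by
  rw [← norm_iteratedFDeriv_one]; exact (hH z hz w).2 1 (by norm_num)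

lemma norm_fderiv_le_self (hH : LinearGrowthC3 H Z e C) {z : V} (hz : z ∈ Z) :
    ‖fderiv ℝ H z‖ ≤ C := by
  simpa using hH.norm_fderiv_le hz 0

lemma continuous_line (hH : LinearGrowthC3 H Z e C) {z : V} (hz : z ∈ Z) :
    Continuous fun w : ℝ => H (z + w • e) :=
  continuous_iff_continuousAt.2 fun w =>
    ContinuousAt.comp (f := fun w : ℝ => z + w • e) (hH z hz w).1.continuousAt (by fun_prop)

lemma continuous_fderiv_line (hH : LinearGrowthC3 H Z e C) {z : V} (hz : z ∈ Z) :
    Continuous fun w : ℝ => fderiv ℝ H (z + w • e) :=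
  continuous_iff_continuousAt.2 fun w =>
    ContinuousAt.comp (f := fun w : ℝ => z + w • e)
      ((hH z hz w).1.fderiv_right (m := 0) (by norm_num)).continuousAt (by fun_prop)

lemma integrable (hH : LinearGrowthC3 H Z e C) (hK : KernelCond K) (h0 : 0 ≤ h) (h1 : h ≤ 1)
    {z : V} (hz : z ∈ Z) : Integrable fun u => K u * H (z + (-(h * u)) • e) :=
  hK.integrable_mul_comp h0 h1 (hH.continuous_line hz) (hH.abs_le hz)

/-- For `|w| ≤ 1` this is Taylor's formula; for `|w| ≥ 1` the linear growth suffices. -/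
lemma norm_symm_line_le {F : Type*} [NormedAddCommGroup F] [NormedSpace ℝ F] {f : V → F} {z : V}
    (he : ‖e‖ ≤ 1) (hC : 0 ≤ C) (hf : ∀ w : ℝ, ContDiffAt ℝ 2 f (z + w • e))
    (hf0 : ∀ w : ℝ, ‖f (z + w • e)‖ ≤ C * (1 + |w|))
    (hf2 : ∀ w : ℝ, ‖iteratedFDeriv ℝ 2 f (z + w • e)‖ ≤ C * (1 + |w|)) (w : ℝ) :
    ‖f (z + w • e) + f (z + (-w) • e) - (2 : ℝ) • f z‖ ≤ 6 * C * w ^ 2 := by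
  rcases le_total |w| 1 with hw | hw
  · set S : Set V := (fun s : ℝ => z + s • e) '' Set.Icc (-1) 1 with hS
    have hSc : Convex ℝ S := by
      rintro _ ⟨s, hs, rfl⟩ _ ⟨t, ht, rfl⟩ a b ha hb hab
      refine ⟨a * s + b * t, (convex_Icc (-1 : ℝ) 1) hs ht ha hb hab, ?_⟩
      obtain rfl : b = 1 - a := by linarith
      module
    have hp : z + w • e ∈ S := ⟨w, _root_.abs_le.1 hw, rfl⟩
    have hm : z - w • e ∈ S := ⟨-w, _root_.abs_le.1 (by rwa [abs_neg]), by module⟩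
    have := norm_add_add_sub_sub_two_smul_le hSc (f := f) (M := 2 * C)
      (by rintro _ ⟨s, -, rfl⟩; exact hf s)
      (by
        rintro _ ⟨s, hs, rfl⟩
        refine (hf2 s).trans ?_
        nlinarith [_root_.abs_le.2 hs]) hp hm
    rw [neg_smul, ← sub_eq_add_neg]
    refine this.trans ?_
    rw [norm_smul, mul_pow, Real.norm_eq_abs, sq_abs]
    have h1 : ‖e‖ ^ 2 ≤ 1 := pow_le_one₀ (norm_nonneg _) he
    nlinarith [mul_nonneg hC (sq_nonneg w),
      mul_nonneg (mul_nonneg hC (sq_nonneg w)) (sub_nonneg.2 h1)]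
  · have h1 := hf0 w
    have h2 := hf0 (-w)
    have h3 := hf0 0
    rw [abs_neg] at h2
    simp only [zero_smul, add_zero, abs_zero, mul_one] at h3
    calc _ ≤ ‖f (z + w • e)‖ + ‖f (z + (-w) • e)‖ + ‖(2 : ℝ) • f z‖ :=
          (norm_sub_le _ _).trans (by gcongr; exact norm_add_le _ _)
      _ ≤ C * (1 + |w|) + C * (1 + |w|) + 2 * C := by
          gcongr; rw [norm_smul]; simpa using h3
      _ ≤ 6 * C * w ^ 2 := by
          rw [← sq_abs w]
          nlinarith [mul_nonneg hC (sub_nonneg.2 hw),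
            mul_nonneg hC (mul_nonneg (sub_nonneg.2 hw) (abs_nonneg w))]

/-- Smoothing changes `H` by `O(h²)`. -/
lemma abs_smooth_sub_le (hH : LinearGrowthC3 H Z e C) (hK : KernelCond K) (he : ‖e‖ ≤ 1)
    (h0 : 0 ≤ h) (h1 : h ≤ 1) {z : V} (hz : z ∈ Z) :
    |smooth K h H e z - H z| ≤ 6 * C * kmom K * h ^ 2 := by
  have := hK.abs_smooth_sub_le (M := 6 * C) h0 h1 (hH.continuous_line hz) (hH.abs_le hz)
    (fun w => by
      have := norm_symm_line_le (f := H) he (hH.nonneg ⟨z, hz⟩)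
        (fun w => (hH z hz w).1.of_le (by norm_num)) (hH.abs_le hz)
        (fun w => (hH z hz w).2 2 (by norm_num)) w
      simpa using this)
  simp only [zero_smul, add_zero] at this
  rw [smooth]
  linarith

/-- Smoothing changes the derivative of `H` by `O(h²)`. -/
lemma abs_smooth_fderiv_sub_le (hH : LinearGrowthC3 H Z e C) (hK : KernelCond K) (he : ‖e‖ ≤ 1)
    (h0 : 0 ≤ h) (h1 : h ≤ 1) {z : V} (hz : z ∈ Z) (v : V) :
    |(∫ u, K u * fderiv ℝ H (z + (-(h * u)) • e) v) - fderiv ℝ H z v|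
      ≤ 6 * C * kmom K * h ^ 2 * ‖v‖ := by
  have := hK.abs_smooth_sub_le (M := 6 * C * ‖v‖) (B := C * ‖v‖)
    (φ := fun w => fderiv ℝ H (z + w • e) v) h0 h1
    ((hH.continuous_fderiv_line hz).clm_apply continuous_const)
    (fun w => by
      calc _ ≤ ‖fderiv ℝ H (z + w • e)‖ * ‖v‖ := ContinuousLinearMap.le_opNorm _ _
        _ ≤ (C * (1 + |w|)) * ‖v‖ := by gcongr; exact hH.norm_fderiv_le hz w
        _ = _ := by ring)
    (fun w => by
      have := norm_symm_line_le (f := fderiv ℝ H) he (hH.nonneg ⟨z, hz⟩)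
        (fun w => (hH z hz w).1.fderiv_right (by norm_num)) (hH.norm_fderiv_le hz)
        (fun w => by rw [norm_iteratedFDeriv_fderiv]; exact (hH z hz w).2 3 le_rfl) w
      have h2 := ContinuousLinearMap.le_of_opNorm_le _ this v
      simp only [zero_smul, add_zero]
      simp only [sub_apply, add_apply, smul_apply, smul_eq_mul, Real.norm_eq_abs] at h2
      linarith)
  simp only [zero_smul, add_zero] at this
  linarith

/-- The second symmetric difference of the smoothed function, uniformly in the bandwidth. -/
lemma abs_smooth_symm_le (hH : LinearGrowthC3 H Z e C) (hZ : Convex ℝ Z) (hK : KernelCond K)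
    (h0 : 0 ≤ h) (h1 : h ≤ 1) {x v : V} (hp : x + v ∈ Z) (hm : x - v ∈ Z) :
    |smooth K h H e (x + v) + smooth K h H e (x - v) - 2 * smooth K h H e x|
      ≤ 4 * C * kmom K * ‖v‖ ^ 2 := by
  have hx := mem_of_convex_sub_add hZ hp hm
  have hC := hH.nonneg ⟨x, hx⟩
  have ip := hH.integrable hK h0 h1 hp
  have im := hH.integrable hK h0 h1 hm
  have ix := hH.integrable hK h0 h1 hx
  have e1 : smooth K h H e (x + v) + smooth K h H e (x - v) - 2 * smooth K h H e x
      = ∫ u, K u * (H (x + v + (-(h * u)) • e) + H (x - v + (-(h * u)) • e)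
        - 2 * H (x + (-(h * u)) • e)) := by
    rw [smooth, smooth, smooth, ← integral_add ip im, ← integral_const_mul,
      ← integral_sub (by exact ip.add im) (ix.const_mul 2)]
    exact integral_congr_ae (ae_of_all _ fun u => by simp only; ring)
  rw [e1]
  have := hK.abs_integral_le (M := 4 * C * ‖v‖ ^ 2)
    (ψ := fun u => H (x + v + (-(h * u)) • e) + H (x - v + (-(h * u)) • e)
        - 2 * H (x + (-(h * u)) • e)) (fun u => by
      set b := (-(h * u)) • e with hb
      have h2 := norm_add_add_sub_sub_two_smul_le (f := H) (hZ.translate b)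
        (M := C * (1 + |-(h * u)|)) (x := x + b) (v := v)
        (by
          rintro _ ⟨y, hy, rfl⟩
          simp only [add_comm b y]
          exact (hH y hy _).1.of_le (by norm_num))
        (by rintro _ ⟨y, hy, rfl⟩; simp only [add_comm b y]; exact (hH y hy _).2 2 (by norm_num))
        ⟨_, hp, by simp only; abel⟩ ⟨_, hm, by simp only; abel⟩
      have e2 : x + b + v = x + v + b := by abel
      have e3 : x + b - v = x - v + b := by abel
      rw [e2, e3, smul_eq_mul, Real.norm_eq_abs] at h2
      refine h2.trans ?_
      calc _ ≤ 2 * (C * (2 * (1 + u ^ 2))) * ‖v‖ ^ 2 := by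
            gcongr; exact one_add_abs_mul_le h0 h1 u
        _ = _ := by ring)
  linarith

/-- The symmetric difference of the smoothed function approximates the derivative of `H` itself: the
step contributes `‖v‖²`, the bandwidth `h²`, both relative to `‖v‖`. -/
lemma abs_smooth_sub_symm_le (hH : LinearGrowthC3 H Z e C) (hZ : Convex ℝ Z) (hK : KernelCond K)
    (he : ‖e‖ ≤ 1) (h0 : 0 ≤ h) (h1 : h ≤ 1) {x v : V} (hp : x + v ∈ Z) (hm : x - v ∈ Z) :
    |smooth K h H e (x + v) - smooth K h H e (x - v) - 2 * fderiv ℝ H x v|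
      ≤ 12 * C * kmom K * (‖v‖ ^ 2 + h ^ 2) * ‖v‖ := by
  have hx := mem_of_convex_sub_add hZ hp hm
  have hC := hH.nonneg ⟨x, hx⟩
  have ip := hH.integrable hK h0 h1 hp
  have im := hH.integrable hK h0 h1 hm
  have ix : Integrable fun u => K u * fderiv ℝ H (x + (-(h * u)) • e) v :=
    hK.integrable_mul_comp (B := C * ‖v‖) (φ := fun w => fderiv ℝ H (x + w • e) v) h0 h1
      ((hH.continuous_fderiv_line hx).clm_apply continuous_const)
      (fun w => by
        calc _ ≤ ‖fderiv ℝ H (x + w • e)‖ * ‖v‖ := ContinuousLinearMap.le_opNorm _ _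
          _ ≤ (C * (1 + |w|)) * ‖v‖ := by gcongr; exact hH.norm_fderiv_le hx w
          _ = _ := by ring)
  have e1 : smooth K h H e (x + v) - smooth K h H e (x - v)
        - 2 * ∫ u, K u * fderiv ℝ H (x + (-(h * u)) • e) v
      = ∫ u, K u * (H (x + v + (-(h * u)) • e) - H (x - v + (-(h * u)) • e)
        - 2 * fderiv ℝ H (x + (-(h * u)) • e) v) := by
    rw [smooth, smooth, ← integral_sub ip im, ← integral_const_mul,
      ← integral_sub (by exact ip.sub im) (ix.const_mul 2)]
    exact integral_congr_ae (ae_of_all _ fun u => by simp only; ring)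
  have h3 := hK.abs_integral_le (M := 4 * C * ‖v‖ ^ 3)
    (ψ := fun u => H (x + v + (-(h * u)) • e) - H (x - v + (-(h * u)) • e)
        - 2 * fderiv ℝ H (x + (-(h * u)) • e) v) (fun u => by
      set b := (-(h * u)) • e with hb
      have h2 := norm_sub_sub_two_smul_fderiv_le (f := H) (hZ.translate b)
        (M := C * (1 + |-(h * u)|)) (x := x + b) (v := v)
        (by rintro _ ⟨y, hy, rfl⟩; simp only [add_comm b y]; exact (hH y hy _).1)
        (by rintro _ ⟨y, hy, rfl⟩; simp only [add_comm b y]; exact (hH y hy _).2 3 (by norm_num))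
        ⟨_, hp, by simp only; abel⟩ ⟨_, hm, by simp only; abel⟩
      have e2 : x + b + v = x + v + b := by abel
      have e3 : x + b - v = x - v + b := by abel
      rw [e2, e3, smul_eq_mul, Real.norm_eq_abs] at h2
      refine h2.trans ?_
      calc _ ≤ 2 * (C * (2 * (1 + u ^ 2))) * ‖v‖ ^ 3 := by
            gcongr; exact one_add_abs_mul_le h0 h1 u
        _ = _ := by ring)
  rw [← e1] at h3
  have h4 := hH.abs_smooth_fderiv_sub_le hK he h0 h1 hx v
  have hk := hK.kmom_nonneg
  have p1 : 0 ≤ C * kmom K * ‖v‖ ^ 3 := by positivity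
  set J := ∫ u, K u * fderiv ℝ H (x + (-(h * u)) • e) v
  rw [_root_.abs_le] at h3 h4 ⊢
  constructor <;> nlinarith

/-- The antisymmetric product of two smoothed functions at symmetric points: with even and odd
parts it equals `2 (A_odd B_even - A_even B_odd)`, so that only third-order terms are left. -/
lemma abs_smooth_mul_sub_le (hH : LinearGrowthC3 H Z e C) (hf : LinearGrowthC3 f Z e C)
    (hZ : Convex ℝ Z) (hK : KernelCond K) (he : ‖e‖ ≤ 1) (h0 : 0 ≤ h) (h1 : h ≤ 1) {x v : V}
    (hp : x + v ∈ Z) (hm : x - v ∈ Z) (hv : ‖v‖ ≤ 1) :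
    |smooth K h H e (x + v) * smooth K h f e (x - v)
        - smooth K h H e (x - v) * smooth K h f e (x + v)
        - 2 * (fderiv ℝ H x v * f x - H x * fderiv ℝ f x v)|
      ≤ 48 * (C * kmom K) * (C + 12 * (C * kmom K)) * (‖v‖ ^ 2 + h ^ 2) * ‖v‖ := by
  have hx := mem_of_convex_sub_add hZ hp hm
  have hC := hH.nonneg ⟨x, hx⟩
  have hk := hK.kmom_nonneg
  have H1 := hH.abs_smooth_sub_symm_le hZ hK he h0 h1 hp hm
  have H2 := hH.abs_smooth_symm_le hZ hK h0 h1 hp hm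
  have H3 := hH.abs_smooth_sub_le hK he h0 h1 hx
  have F1 := hf.abs_smooth_sub_symm_le hZ hK he h0 h1 hp hm
  have F2 := hf.abs_smooth_symm_le hZ hK h0 h1 hp hm
  have F3 := hf.abs_smooth_sub_le hK he h0 h1 hx
  have H0 := hH.abs_le_self hx
  have F0 := hf.abs_le_self hx
  have HD : |fderiv ℝ H x v| ≤ C * ‖v‖ :=
    ContinuousLinearMap.le_of_opNorm_le _ (hH.norm_fderiv_le_self hx) v
  have FD : |fderiv ℝ f x v| ≤ C * ‖v‖ :=
    ContinuousLinearMap.le_of_opNorm_le _ (hf.norm_fderiv_le_self hx) v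
  set Ap := smooth K h H e (x + v)
  set Am := smooth K h H e (x - v)
  set Bp := smooth K h f e (x + v)
  set Bm := smooth K h f e (x - v)
  set a0 := H x
  set b0 := f x
  set a1 := fderiv ℝ H x v
  set b1 := fderiv ℝ f x v
  set n := ‖v‖
  set σ := n ^ 2 + h ^ 2 with hσ
  set k := 6 * (C * kmom K) with hkd
  have hn : 0 ≤ n := norm_nonneg v
  have hk0 : 0 ≤ k := by positivity
  have hσ0 : 0 ≤ σ := by positivity
  have hσ2 : σ ≤ 2 := by nlinarith
  have Ao : |(Ap - Am) / 2 - a1| ≤ k * σ * n := by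
    rw [_root_.abs_le] at H1 ⊢; constructor <;> nlinarith
  have Bo : |(Bp - Bm) / 2 - b1| ≤ k * σ * n := by
    rw [_root_.abs_le] at F1 ⊢; constructor <;> nlinarith
  have pn : 0 ≤ C * kmom K * n ^ 2 := by positivity
  have Ae : |(Ap + Am) / 2 - a0| ≤ k * σ := by
    rw [_root_.abs_le] at H2 H3 ⊢; constructor <;> nlinarith
  have Be : |(Bp + Bm) / 2 - b0| ≤ k * σ := by
    rw [_root_.abs_le] at F2 F3 ⊢; constructor <;> nlinarith
  have key := abs_odd_even_product_le hC hk0 hσ0 hσ2 hn Ao Bo Ae Be H0 F0 HD FD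
  have e1 : Ap * Bm - Am * Bp - 2 * (a1 * b0 - a0 * b1)
      = 2 * ((Ap - Am) / 2 * ((Bp + Bm) / 2) - (Ap + Am) / 2 * ((Bp - Bm) / 2)
        - (a1 * b0 - a0 * b1)) := by ring
  rw [e1, abs_mul, abs_two]
  have e9 : 48 * (C * kmom K) * (C + 12 * (C * kmom K)) * σ * n
      = 8 * k * (C + 2 * k) * σ * n := by rw [hkd]; ring
  have : 0 ≤ k * k * σ * n := by positivity
  rw [e9]
  linarith

end LinearGrowthC3

end Smoothing

/-! ### Bounded smooth functions -/

section BoundedC3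

variable {V W : Type*} [NormedAddCommGroup V] [NormedSpace ℝ V] [NormedAddCommGroup W]
  [NormedSpace ℝ W]

namespace BoundedC3

variable {F : V → ℝ} {S : Set V}

lemma contDiffAt (hF : BoundedC3 F S) (hS : IsOpen S) {x : V} (hx : x ∈ S) :
    ContDiffAt ℝ 3 F x := hF.1.contDiffAt (hS.mem_nhds hx)

lemma differentiableAt (hF : BoundedC3 F S) (hS : IsOpen S) {x : V} (hx : x ∈ S) :
    DifferentiableAt ℝ F x := (hF.contDiffAt hS hx).differentiableAt three_ne_zero

lemma exists_bound (hF : BoundedC3 F S) :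
    ∃ C, 0 ≤ C ∧ ∀ x ∈ S, ∀ i : ℕ, 1 ≤ i → i ≤ 3 → ‖iteratedFDeriv ℝ i F x‖ ≤ C := by
  obtain ⟨-, C, hC⟩ := hF
  exact ⟨max C 0, le_max_right _ _, fun x hx i h1 h2 => (hC x hx i h1 h2).trans (le_max_left _ _)⟩

lemma exists_lipschitz (hF : BoundedC3 F S) (hS : IsOpen S) (hc : Convex ℝ S) :
    ∃ C, 0 ≤ C ∧ (∀ x ∈ S, ‖fderiv ℝ F x‖ ≤ C) ∧
      (∀ x ∈ S, ∀ y ∈ S, |F x - F y| ≤ C * ‖x - y‖) ∧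
      ∀ x ∈ S, ∀ y ∈ S, ‖fderiv ℝ F x - fderiv ℝ F y‖ ≤ C * ‖x - y‖ := by
  obtain ⟨C, hC0, hC⟩ := hF.exists_bound
  have h1 : ∀ x ∈ S, ‖fderiv ℝ F x‖ ≤ C := fun x hx => by
    rw [← norm_iteratedFDeriv_one]; exact hC x hx 1 le_rfl (by norm_num)
  refine ⟨C, hC0, h1, fun x hx y hy => ?_, fun x hx y hy => ?_⟩
  · exact hc.norm_image_sub_le_of_norm_fderiv_le (𝕜 := ℝ)
      (fun z hz => hF.differentiableAt hS hz) h1 hy hx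
  · refine hc.norm_image_sub_le_of_norm_fderiv_le (𝕜 := ℝ) (f := fderiv ℝ F)
      (fun z hz => ((hF.contDiffAt hS hz).fderiv_right (m := 2)
        (by norm_num)).differentiableAt two_ne_zero) (fun z hz => ?_) hy hx
    rw [← norm_iteratedFDeriv_one, norm_iteratedFDeriv_fderiv]
    exact hC z hz 2 (by norm_num) (by norm_num)

lemma comp_clm (hF : BoundedC3 F S) (hS : IsOpen S) (g : W →L[ℝ] V) (hg : ‖g‖ ≤ 1) :
    BoundedC3 (F ∘ g) (g ⁻¹' S) := by
  obtain ⟨C, hC0, hC⟩ := hF.exists_bound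
  have ho : IsOpen (g ⁻¹' S) := hS.preimage g.continuous
  refine ⟨hF.1.comp_continuousLinearMap g, C, fun x hx i h1 h3 => ?_⟩
  have hi : ((i : ℕ) : WithTop ℕ∞) ≤ 3 := by exact_mod_cast h3
  rw [← iteratedFDerivWithin_of_isOpen i ho hx, g.iteratedFDerivWithin_comp_right hF.1
    hS.uniqueDiffOn ho.uniqueDiffOn hx hi, iteratedFDerivWithin_of_isOpen i hS hx]
  refine (ContinuousMultilinearMap.norm_compContinuousLinearMap_le _ _).trans ?_
  calc _ ≤ C * 1 := by
        gcongr
        · exact hC _ hx i h1 h3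
        · exact Finset.prod_le_one (fun _ _ => norm_nonneg _) fun _ _ => hg
    _ = C := mul_one C

/-- By the Leibniz rule, the product of a function with linearly growing derivatives and one with
bounded derivatives has linearly growing derivatives. -/
lemma linearGrowthC3_mul {G : V → ℝ} {Z : Set V} {e : V} {C D : ℝ} (hF : LinearGrowthC3 F Z e C)
    (hG : ∀ z ∈ Z, ∀ w : ℝ, ContDiffAt ℝ 3 G (z + w • e) ∧
      ∀ i ≤ 3, ‖iteratedFDeriv ℝ i G (z + w • e)‖ ≤ D) (hS : IsOpen S)
    (hZS : ∀ z ∈ Z, ∀ w : ℝ, z + w • e ∈ S) (hFS : ContDiffOn ℝ 3 F S) (hGS : ContDiffOn ℝ 3 G S) :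
    LinearGrowthC3 (fun z => F z * G z) Z e (8 * (C * D)) := by
  intro z hz w
  have hm := hZS z hz w
  refine ⟨(hF z hz w).1.mul (hG z hz w).1, fun i hi => ?_⟩
  have hi' : ((i : ℕ) : WithTop ℕ∞) ≤ 3 := by exact_mod_cast hi
  have hC := hF.nonneg ⟨z, hz⟩
  have hD : 0 ≤ D := le_trans (norm_nonneg _) ((hG z hz w).2 0 (by norm_num))
  have h := norm_iteratedFDerivWithin_mul_le hFS hGS hS.uniqueDiffOn hm hi'
  simp_rw [iteratedFDerivWithin_of_isOpen _ hS hm] at h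
  calc ‖iteratedFDeriv ℝ i (fun z => F z * G z) (z + w • e)‖
      ≤ ∑ k ∈ Finset.range (i + 1), (i.choose k : ℝ) * (C * (1 + |w|)) * D := by
        refine h.trans (Finset.sum_le_sum fun k hk => ?_)
        have hk' : k ≤ i := Nat.lt_succ_iff.1 (Finset.mem_range.1 hk)
        gcongr
        · exact (hF z hz w).2 k (hk'.trans hi)
        · exact (hG z hz w).2 (i - k) ((Nat.sub_le _ _).trans hi)
    _ = (2 : ℝ) ^ i * (C * (1 + |w|) * D) := by
        simp_rw [mul_assoc]
        rw [← Finset.sum_mul]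
        congr 1
        exact_mod_cast Nat.sum_range_choose i
    _ ≤ (2 : ℝ) ^ 3 * (C * (1 + |w|) * D) := by gcongr; norm_num
    _ = _ := by ring

end BoundedC3

end BoundedC3

/-! ### Densities and conditional moments -/

section Model

variable {d p : ℕ} {Ξ Ω : Type*} [MeasurableSpace Ξ] [MeasurableSpace Ω]
  {P : Problem d p Ξ} {T : Targets d p} {K : ℝ → ℝ} {A : Params} {Pr : Measure Ω}
  {s : ℕ → Ω → State d p} {Δ : ℕ → Ω → Vec d}
  {N : Set (Vec d)} {Xε : Set ℝ} {Λε : Set (Fin p → ℝ)}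

/-- The density `f` as a function of `(θ, l, x)`. -/
def fz (T : Targets d p) (z : Vec d × (Fin p → ℝ) × ℝ) : ℝ := T.f z.2.2 z.1

/-- The conditional expectation `m̄_j` as a function of `(θ, l, x)` with `l ∈ ℝ^p`. -/
def mz (T : Targets d p) (j : Fin p) (z : Vec d × (Fin p → ℝ) × ℝ) : ℝ :=
  T.mbar j z.1 (head j z.2.1) z.2.2

/-- The direction of the last coordinate in `(θ, l, x)`. -/
def ez (d p : ℕ) : Vec d × (Fin p → ℝ) × ℝ := (0, 0, 1)

lemma norm_ez_le : ‖ez d p‖ ≤ 1 := by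
  simp [ez, Prod.norm_def]

lemma add_smul_ez (z : Vec d × (Fin p → ℝ) × ℝ) (w : ℝ) :
    z + w • ez d p = (z.1, z.2.1, z.2.2 + w) := by
  ext <;> simp [ez]

lemma Problem.Standing.meas_Xθ (hP : P.Standing) (θ : Vec d) : Measurable (P.X θ) :=
  hP.meas_X.comp (measurable_const.prodMk measurable_id)

lemma Problem.Standing.meas_Yθ (hP : P.Standing) (θ : Vec d) : Measurable (P.Y θ) :=
  hP.meas_Y.comp (measurable_const.prodMk measurable_id)

lemma Problem.Standing.meas_mθ (hP : P.Standing) (j : Fin p) (θ : Vec d) (l) :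
    Measurable fun ξ => P.m j θ (P.Y θ ξ) l :=
  (hP.meas_m j).comp (measurable_const.prodMk ((hP.meas_Yθ θ).prodMk measurable_const))

lemma Problem.Standing.meas_qθ (hP : P.Standing) (θ : Vec d) (ν : ℝ) :
    Measurable fun ξ => P.q θ (P.X θ ξ) ν :=
  hP.meas_q.comp (measurable_const.prodMk ((hP.meas_Xθ θ).prodMk measurable_const))

namespace Regularity

lemma nonempty [IsProbabilityMeasure Pr] (h1 : Regularity P T Pr A s Δ N Xε Λε) :
    N.Nonempty ∧ Xε.Nonempty ∧ Λε.Nonempty := by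
  obtain ⟨r, hr, h⟩ := h1.nhd
  obtain ⟨ω, hω⟩ := h.exists
  obtain ⟨a, b, c⟩ := hω 0
  exact ⟨⟨_, a (Metric.mem_ball_self hr)⟩, ⟨_, b (Metric.mem_ball_self hr)⟩,
    ⟨_, c (Metric.mem_ball_self hr)⟩⟩

lemma continuous_f (h1 : Regularity P T Pr A s Δ N Xε Λε) {θ : Vec d} (hθ : θ ∈ N) :
    Continuous fun x => T.f x θ := by
  refine continuous_iff_continuousAt.2 fun x => ?_
  exact (h1.f_smooth.contDiffAt (h1.open_N.prod isOpen_univ) (x := (θ, x))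
    ⟨hθ, trivial⟩).continuousAt.comp (f := fun x => (θ, x)) (by fun_prop)

lemma integral_comp_X (h1 : Regularity P T Pr A s Δ N Xε Λε) (hP : P.Standing) {θ : Vec d}
    (hθ : θ ∈ N) {φ : ℝ → ℝ} (hφ : Measurable φ) :
    ∫ ξ, φ (P.X θ ξ) ∂P.μ = ∫ x, φ x * T.f x θ := by
  rw [← integral_map (hP.meas_Xθ θ).aemeasurable hφ.aestronglyMeasurable,
    h1.describes.density θ (Or.inr hθ), integral_withDensity_eq_integral_toReal_smul
    (h1.continuous_f hθ).measurable.ennreal_ofReal (ae_of_all _ fun x => ENNReal.ofReal_lt_top)]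
  refine integral_congr_ae (ae_of_all _ fun x => ?_)
  simp only [smul_eq_mul]
  rw [ENNReal.toReal_ofReal (h1.describes.f_nonneg θ (Or.inr hθ) x), mul_comm]

lemma lintegral_f (h1 : Regularity P T Pr A s Δ N Xε Λε) (hP : P.Standing) {θ : Vec d}
    (hθ : θ ∈ N) : ∫⁻ x, ENNReal.ofReal (T.f x θ) = 1 := by
  have := hP.prob
  have h := Measure.isProbabilityMeasure_map (μ := P.μ) (hP.meas_Xθ θ).aemeasurable
  rw [h1.describes.density θ (Or.inr hθ)] at h
  have h2 := h.measure_univ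
  rwa [withDensity_apply _ MeasurableSet.univ, setLIntegral_univ] at h2

/-- A probability density that is Lipschitz with constant `C` is at most `C + 1`. -/
lemma exists_f_le (h1 : Regularity P T Pr A s Δ N Xε Λε) (hP : P.Standing) :
    ∃ C, 0 ≤ C ∧ ∀ θ ∈ N, ∀ x, |T.f x θ| ≤ C := by
  obtain ⟨C, hC0, -, hC, -⟩ := h1.f_smooth.exists_lipschitz (h1.open_N.prod isOpen_univ)
    (h1.convex_N.prod convex_univ)
  refine ⟨C + 1, by positivity, fun θ hθ x => ?_⟩
  have hn := h1.describes.f_nonneg θ (Or.inr hθ)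
  rw [abs_of_nonneg (hn x)]
  by_contra! hlt
  have hle : ∫⁻ y in Set.Icc x (x + 1), ENNReal.ofReal (T.f x θ - C) ≤ 1 := by
    rw [← h1.lintegral_f hP hθ]
    refine (setLIntegral_mono' measurableSet_Icc fun y hy => ?_).trans
      (setLIntegral_le_lintegral _ _)
    apply ENNReal.ofReal_le_ofReal
    have h2 := (abs_le.1 (hC (θ, x) ⟨hθ, trivial⟩ (θ, y) ⟨hθ, trivial⟩)).2
    have h3 : ‖((θ, x) : Vec d × ℝ) - (θ, y)‖ ≤ 1 := by
      simp only [Prod.mk_sub_mk, sub_self, Prod.norm_mk, norm_zero, Real.norm_eq_abs]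
      refine max_le zero_le_one ?_
      rw [abs_sub_comm, abs_of_nonneg (by linarith [hy.1])]; linarith [hy.2]
    simp only at h2
    nlinarith
  simp only [lintegral_const, Measure.restrict_apply MeasurableSet.univ, Set.univ_inter,
    Real.volume_Icc, add_sub_cancel_left, ENNReal.ofReal_one, mul_one] at hle
  rw [ENNReal.ofReal_le_one] at hle
  linarith

lemma continuous_mbar (h1 : Regularity P T Pr A s Δ N Xε Λε) (j : Fin p) {θ : Vec d} (hθ : θ ∈ N)
    {l : Fin p → ℝ} (hl : l ∈ Λε) : Continuous (T.mbar j θ (head j l)) := by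
  refine continuous_iff_continuousAt.2 fun x => ?_
  exact ((h1.m_smooth j).contDiffAt (h1.open_N.prod (h1.open_Λ.prod isOpen_univ)) (x := (θ, l, x))
    ⟨hθ, hl, trivial⟩).continuousAt.comp (f := fun x => (θ, l, x)) (by fun_prop)

lemma integrable_m (h1 : Regularity P T Pr A s Δ N Xε Λε) (hP : P.Standing) (j : Fin p)
    {θ : Vec d} (hθ : θ ∈ N) {l : Fin p → ℝ} (hl : l ∈ Λε) :
    Integrable (fun ξ => P.m j θ (P.Y θ ξ) (head j l)) P.μ := by
  have := hP.prob
  obtain ⟨C, hC⟩ := h1.m_moment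
  exact ((memLp_two_iff_integrable_sq (hP.meas_mθ j θ _).aestronglyMeasurable).2
    (hC j θ hθ l hl).1).integrable one_le_two

lemma integrable_q (h1 : Regularity P T Pr A s Δ N Xε Λε) (hP : P.Standing)
    {θ : Vec d} (hθ : θ ∈ N) {ν : ℝ} (hν : ν ∈ Xε) :
    Integrable (fun ξ => P.q θ (P.X θ ξ) ν) P.μ := by
  have := hP.prob
  obtain ⟨C, hC⟩ := h1.q_moment
  exact ((memLp_two_iff_integrable_sq (hP.meas_qθ θ _).aestronglyMeasurable).2
    (hC θ hθ ν hν).1).integrable one_le_two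

/-- Since `±m ≤ 1 + m²`, the conditional second moment bounds `m̄_j` at almost every point of `Xε`;
the density is positive there, and `m̄_j` is continuous. -/
lemma exists_mbar_le (h1 : Regularity P T Pr A s Δ N Xε Λε) (hP : P.Standing) :
    ∃ C, 0 ≤ C ∧ ∀ j, ∀ θ ∈ N, ∀ l ∈ Λε, ∀ x ∈ Xε, |T.mbar j θ (head j l) x| ≤ C := by
  have := hP.prob
  obtain ⟨C, hC⟩ := h1.m_cond_moment
  obtain ⟨C₂, hC₂⟩ := h1.m_moment
  obtain ⟨ε, hε, hf⟩ := h1.f_lower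
  refine ⟨max (1 + C) 0, le_max_right _ _, fun j θ hθ l hl => ?_⟩
  have hm := h1.integrable_m hP j hθ hl
  have hm2 := (hC₂ j θ hθ l hl).1
  have hle : MeasurableSpace.comap (P.X θ) inferInstance ≤ (inferInstance : MeasurableSpace Ξ) :=
    (hP.meas_Xθ θ).comap_le
  have hae : ∀ᵐ ξ ∂P.μ, P.X θ ξ ∈ Xε → |T.mbar j θ (head j l) (P.X θ ξ)| ≤ 1 + C := by
    have c1 := condExp_mono (m := MeasurableSpace.comap (P.X θ) inferInstance) hm
      ((integrable_const (1 : ℝ)).add hm2)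
      (ae_of_all _ fun ξ => by
        simp only [Pi.add_apply]
        nlinarith [sq_nonneg (P.m j θ (P.Y θ ξ) (head j l) - 1 / 2)])
    have c2 := condExp_mono (m := MeasurableSpace.comap (P.X θ) inferInstance) hm.neg
      ((integrable_const (1 : ℝ)).add hm2)
      (ae_of_all _ fun ξ => by
        simp only [Pi.add_apply, Pi.neg_apply]
        nlinarith [sq_nonneg (P.m j θ (P.Y θ ξ) (head j l) + 1 / 2)])
    have c3 := condExp_add (integrable_const (1 : ℝ)) hm2
      (MeasurableSpace.comap (P.X θ) inferInstance)
    have c4 := condExp_neg (μ := P.μ) (fun ξ => P.m j θ (P.Y θ ξ) (head j l))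
      (MeasurableSpace.comap (P.X θ) inferInstance)
    filter_upwards [c1, c2, c3, c4, hC j θ hθ l hl, h1.describes.cond θ (Or.inr hθ) j _ hm]
      with ξ a1 a2 a3 a4 a5 a6 hX
    have a7 := a5 hX
    rw [condExp_const hle] at a3
    simp only [Pi.add_apply, Pi.neg_apply] at a3 a4
    rw [abs_le]
    constructor
    · linarith
    · linarith
  have hcont := h1.continuous_mbar j hθ hl
  set B : Set ℝ := Xε ∩ {x | 1 + C < |T.mbar j θ (head j l) x|} with hB
  have hBo : IsOpen B := h1.open_X.inter (isOpen_lt continuous_const hcont.abs)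
  have hB0 : (P.μ.map (P.X θ)) B = 0 := by
    rw [Measure.map_apply (hP.meas_Xθ θ) hBo.measurableSet]
    refine measure_mono_null ?_ hae
    intro ξ hξ h
    exact absurd (h hξ.1) (not_le.2 hξ.2)
  rw [h1.describes.density θ (Or.inr hθ), withDensity_apply _ hBo.measurableSet] at hB0
  have hvol : volume B = 0 := by
    have : ∫⁻ x in B, ENNReal.ofReal ε ≤ 0 := by
      rw [← hB0]
      exact setLIntegral_mono' hBo.measurableSet fun x hx =>
        ENNReal.ofReal_le_ofReal (hf x hx.1 θ hθ)
    simp only [lintegral_const, Measure.restrict_apply MeasurableSet.univ, Set.univ_inter,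
      nonpos_iff_eq_zero, mul_eq_zero, ENNReal.ofReal_eq_zero, not_le.2 hε, false_or] at this
    exact this
  -- an open set of measure zero is empty
  have hBe : B = ∅ := (hBo.measure_eq_zero_iff (μ := volume)).1 hvol
  intro x hx
  refine le_max_of_le_left ?_
  by_contra! hlt
  exact (hBe ▸ (⟨hx, hlt⟩ : x ∈ B) : x ∈ (∅ : Set ℝ))

end Regularity

end Model

section Model2

variable {d p : ℕ} {Ξ Ω : Type*} [MeasurableSpace Ξ] [MeasurableSpace Ω]
  {P : Problem d p Ξ} {T : Targets d p} {K : ℝ → ℝ} {A : Params} {Pr : Measure Ω}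
  {s : ℕ → Ω → State d p} {Δ : ℕ → Ω → Vec d}
  {N : Set (Vec d)} {Xε : Set ℝ} {Λε : Set (Fin p → ℝ)}

lemma LinearGrowthC3.mono {V : Type*} [NormedAddCommGroup V] [NormedSpace ℝ V] {H : V → ℝ}
    {Z : Set V} {e : V} {C D : ℝ} (hH : LinearGrowthC3 H Z e C) (hCD : C ≤ D) :
    LinearGrowthC3 H Z e D := fun z hz w =>
  ⟨(hH z hz w).1, fun i hi => ((hH z hz w).2 i hi).trans (by gcongr)⟩

namespace Regularity

lemma fz_smooth (h1 : Regularity P T Pr A s Δ N Xε Λε) :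
    BoundedC3 (fz T : Vec d × (Fin p → ℝ) × ℝ → ℝ) (N ×ˢ Set.univ ×ˢ Set.univ) := by
  have := h1.f_smooth.comp_clm (h1.open_N.prod isOpen_univ)
    ((ContinuousLinearMap.fst ℝ (Vec d) ((Fin p → ℝ) × ℝ)).prod
      ((ContinuousLinearMap.snd ℝ (Fin p → ℝ) ℝ).comp (ContinuousLinearMap.snd ℝ (Vec d) _)))
    (ContinuousLinearMap.opNorm_le_bound _ zero_le_one fun z => by
      rw [one_mul]
      exact max_le (norm_fst_le z) ((norm_snd_le z.2).trans (norm_snd_le z)))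
  convert this using 1
  · rfl
  · ext z
    simp

/-- The density is bounded with its derivatives. `m̄_j` is Lipschitz, and bounded on `N × Λε × Xε`,
hence grows at most linearly along the lines that leave this set, and so does `m̄_j f`. -/
lemma exists_linearGrowthC3 [IsProbabilityMeasure Pr] (h1 : Regularity P T Pr A s Δ N Xε Λε)
    (hP : P.Standing) : ∃ C, 0 ≤ C ∧
      LinearGrowthC3 (fz T) (N ×ˢ Λε ×ˢ Xε) (ez d p) C ∧
      ∀ j, LinearGrowthC3 (fun z => mz T j z * fz T z) (N ×ˢ Λε ×ˢ Xε) (ez d p) C := by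
  obtain ⟨Cf, hCf0, hCf⟩ := h1.exists_f_le hP
  obtain ⟨Cm, hCm0, hCm⟩ := h1.exists_mbar_le hP
  obtain ⟨Df, hDf0, hDf⟩ := h1.fz_smooth.exists_bound
  have hof : IsOpen (N ×ˢ (Set.univ : Set (Fin p → ℝ)) ×ˢ (Set.univ : Set ℝ)) :=
    h1.open_N.prod (isOpen_univ.prod isOpen_univ)
  have hom : IsOpen (N ×ˢ Λε ×ˢ (Set.univ : Set ℝ)) := h1.open_N.prod (h1.open_Λ.prod isOpen_univ)
  have hcm : Convex ℝ (N ×ˢ Λε ×ˢ (Set.univ : Set ℝ)) :=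
    h1.convex_N.prod (h1.convex_Λ.prod convex_univ)
  have hZS : ∀ z ∈ N ×ˢ Λε ×ˢ Xε, ∀ w : ℝ, z + w • ez d p ∈ N ×ˢ Λε ×ˢ (Set.univ : Set ℝ) :=
    fun z hz w => by rw [add_smul_ez]; exact ⟨hz.1, hz.2.1, trivial⟩
  have hZf : ∀ z ∈ N ×ˢ Λε ×ˢ Xε, ∀ w : ℝ,
      z + w • ez d p ∈ N ×ˢ (Set.univ : Set (Fin p → ℝ)) ×ˢ (Set.univ : Set ℝ) :=
    fun z hz w => by rw [add_smul_ez]; exact ⟨hz.1, trivial, trivial⟩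
  have hf : ∀ z ∈ N ×ˢ Λε ×ˢ Xε, ∀ w : ℝ, ContDiffAt ℝ 3 (fz T) (z + w • ez d p) ∧
      ∀ i ≤ 3, ‖iteratedFDeriv ℝ i (fz T) (z + w • ez d p)‖ ≤ max Cf Df := fun z hz w => by
    refine ⟨h1.fz_smooth.contDiffAt hof (hZf z hz w), fun i hi => ?_⟩
    rcases Nat.eq_zero_or_pos i with rfl | h0
    · rw [norm_iteratedFDeriv_zero, add_smul_ez]
      exact (hCf _ hz.1 _).trans (le_max_left _ _)
    · exact (hDf _ (hZf z hz w) i h0 hi).trans (le_max_right _ _)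
  have hm : ∀ j, ∃ C, LinearGrowthC3 (fun z => mz T j z * fz T z) (N ×ˢ Λε ×ˢ Xε) (ez d p) C := by
    intro j
    obtain ⟨D, hD0, hD⟩ := (h1.m_smooth j).exists_bound
    obtain ⟨L, hL0, -, hL, -⟩ := (h1.m_smooth j).exists_lipschitz hom hcm
    have hg : LinearGrowthC3 (mz T j) (N ×ˢ Λε ×ˢ Xε) (ez d p) (max D (max L Cm)) := by
      intro z hz w
      refine ⟨(h1.m_smooth j).contDiffAt hom (hZS z hz w), fun i hi => ?_⟩
      have hw : 1 ≤ 1 + |w| := by linarith [abs_nonneg w]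
      have hM : 0 ≤ max D (max L Cm) := hD0.trans (le_max_left _ _)
      rcases Nat.eq_zero_or_pos i with rfl | h0
      · rw [norm_iteratedFDeriv_zero, Real.norm_eq_abs]
        have a1 := hL _ (hZS z hz w) _ (hZS z hz 0)
        have a2 := hCm j z.1 hz.1 z.2.1 hz.2.1 z.2.2 hz.2.2
        have a3 : ‖z + w • ez d p - (z + (0 : ℝ) • ez d p)‖ ≤ |w| := by
          rw [zero_smul, add_zero, add_sub_cancel_left, norm_smul, Real.norm_eq_abs]
          have := norm_ez_le (d := d) (p := p)
          nlinarith [abs_nonneg w]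
        rw [zero_smul, add_zero] at a1 a3
        have a4 : |mz T j (z + w • ez d p)| ≤ |mz T j z| + L * |w| := by
          have := abs_sub_abs_le_abs_sub (mz T j (z + w • ez d p)) (mz T j z)
          have a5 : |mz T j (z + w • ez d p) - mz T j z| ≤ L * |w| :=
            a1.trans (by gcongr)
          linarith
        have a6 : L ≤ max D (max L Cm) := (le_max_left _ _).trans (le_max_right _ _)
        have a7 : Cm ≤ max D (max L Cm) := (le_max_right _ _).trans (le_max_right _ _)
        have a8 : |mz T j z| ≤ Cm := a2
        nlinarith [abs_nonneg w, mul_le_mul_of_nonneg_right a6 (abs_nonneg w)]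
      · refine (hD _ (hZS z hz w) i h0 hi).trans ((le_max_left D (max L Cm)).trans ?_)
        nlinarith
    exact ⟨_, BoundedC3.linearGrowthC3_mul hg hf hom hZS (h1.m_smooth j).1
      (h1.fz_smooth.1.mono (Set.prod_mono_right (Set.prod_mono_left (Set.subset_univ _))))⟩
  choose C hC using hm
  have hs : ∀ j, C j ≤ ∑ i, |C i| := fun j => (le_abs_self _).trans
    (Finset.single_le_sum (f := fun i => |C i|) (fun i _ => abs_nonneg _) (Finset.mem_univ j))
  refine ⟨max (max Cf Df) (∑ i, |C i|), ?_, ?_, fun j =>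
    (hC j).mono ((hs j).trans (le_max_right _ _))⟩
  · exact le_max_of_le_left (hCf0.trans (le_max_left _ _))
  · refine LinearGrowthC3.mono (C := max Cf Df) (fun z hz w => ?_) (le_max_left _ _)
    refine ⟨(hf z hz w).1, fun i hi => ((hf z hz w).2 i hi).trans ?_⟩
    have : 0 ≤ max Cf Df := hCf0.trans (le_max_left _ _)
    nlinarith [abs_nonneg w]

end Regularity

/-! ### Kernel-weighted expectations -/

lemma integral_kern_mul {h : ℝ} (hh : 0 < h) (ν : ℝ) (φ : ℝ → ℝ) :
    ∫ x, kern K h ν x * φ x = ∫ u, K u * φ (ν + -(h * u)) := by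
  have e1 : ∫ x, kern K h ν x * φ x = ∫ x, kern K h ν (ν - x) * φ (ν - x) :=
    (integral_sub_left_eq_self (fun x => kern K h ν x * φ x) volume ν).symm
  have e2 := Measure.integral_comp_mul_left (fun x => kern K h ν (ν - x) * φ (ν - x)) h
  rw [abs_of_pos (inv_pos.2 hh), smul_eq_mul] at e2
  rw [e1, ← mul_right_inj' (inv_pos.2 hh).ne', ← e2, ← integral_const_mul]
  refine integral_congr_ae (ae_of_all _ fun u => ?_)
  simp only [kern, sub_sub_cancel, mul_div_cancel_left₀ _ hh.ne', ← sub_eq_add_neg]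
  field_simp

lemma KernelCond.measurable_kern (hK : KernelCond K) (h ν : ℝ) : Measurable (kern K h ν) := by
  have := hK.continuous
  unfold kern
  exact Continuous.measurable (by fun_prop)

lemma KernelCond.kern_nonneg (hK : KernelCond K) {h : ℝ} (hh : 0 < h) (ν x : ℝ) :
    0 ≤ kern K h ν x := mul_nonneg (by positivity) (hK.nonneg _)

lemma kern_le {B : ℝ} (hB : ∀ u, K u ≤ B) {h : ℝ} (hh : 0 < h) (ν x : ℝ) :
    kern K h ν x ≤ B / h := by
  rw [kern, one_div, inv_mul_eq_div]; gcongr; exact hB _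

lemma KernelCond.kern_le_div (hK : KernelCond K) {D : ℝ} (hD : ∀ u, |u| * K u ≤ D) {h : ℝ}
    (hh : 0 < h) {ν x r : ℝ} (hr : 0 < r) (hx : r ≤ |ν - x|) : kern K h ν x ≤ D / r := by
  have h1 := hD ((ν - x) / h)
  rw [abs_div, abs_of_pos hh] at h1
  have h2 : r * kern K h ν x ≤ |ν - x| / h * K ((ν - x) / h) := by
    rw [kern, ← mul_assoc, mul_one_div]
    have := hK.nonneg ((ν - x) / h)
    gcongr
  rw [le_div_iff₀ hr]; linarith

namespace Regularity

lemma integral_kern (h1 : Regularity P T Pr A s Δ N Xε Λε) (hP : P.Standing) (hK : KernelCond K)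
    {h : ℝ} (hh : 0 < h) {θ : Vec d} (hθ : θ ∈ N) (l : Fin p → ℝ) (ν : ℝ) :
    ∫ ξ, kern K h ν (P.X θ ξ) ∂P.μ = smooth K h (fz T) (ez d p) (θ, l, ν) := by
  rw [h1.integral_comp_X hP hθ (hK.measurable_kern h ν), integral_kern_mul hh, smooth]
  simp only [add_smul_ez, fz]

/-- The kernel weight is a function of `X(θ)`; conditioning on `X(θ)` replaces `m_j` by `m̄_j`. -/
lemma integral_m_mul_kern (h1 : Regularity P T Pr A s Δ N Xε Λε) (hP : P.Standing)
    (hK : KernelCond K) {h : ℝ} (hh : 0 < h) {θ : Vec d} (hθ : θ ∈ N) {l : Fin p → ℝ}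
    (hl : l ∈ Λε) (j : Fin p) (ν : ℝ) :
    ∫ ξ, P.m j θ (P.Y θ ξ) (head j l) * kern K h ν (P.X θ ξ) ∂P.μ
      = smooth K h (fun z => mz T j z * fz T z) (ez d p) (θ, l, ν) := by
  have := hP.prob
  obtain ⟨B, hB⟩ := hK.bounded
  have hm := h1.integrable_m hP j hθ hl
  have hle : MeasurableSpace.comap (P.X θ) inferInstance ≤ (inferInstance : MeasurableSpace Ξ) :=
    (hP.meas_Xθ θ).comap_le
  have hκm : StronglyMeasurable[MeasurableSpace.comap (P.X θ) inferInstance]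
      fun ξ => kern K h ν (P.X θ ξ) :=
    Measurable.stronglyMeasurable fun t ht => ⟨_, hK.measurable_kern h ν ht, rfl⟩
  have hpull := condExp_stronglyMeasurable_mul_of_bound hle hκm hm (B / h) (ae_of_all _ fun ξ => by
    rw [Real.norm_of_nonneg (hK.kern_nonneg hh _ _)]; exact kern_le hB hh _ _)
  calc ∫ ξ, P.m j θ (P.Y θ ξ) (head j l) * kern K h ν (P.X θ ξ) ∂P.μ
      = ∫ ξ, ((fun ξ => kern K h ν (P.X θ ξ)) * fun ξ => P.m j θ (P.Y θ ξ) (head j l)) ξ ∂P.μ :=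
        integral_congr_ae (ae_of_all _ fun ξ => by simp [mul_comm])
    _ = ∫ ξ, kern K h ν (P.X θ ξ) * T.mbar j θ (head j l) (P.X θ ξ) ∂P.μ := by
        rw [← integral_condExp hle]
        refine integral_congr_ae ?_
        filter_upwards [hpull, h1.describes.cond θ (Or.inr hθ) j _ hm] with ξ a1 a2
        rw [a1, Pi.mul_apply, a2]
    _ = ∫ x, kern K h ν x * (T.mbar j θ (head j l) x * T.f x θ) := by
        rw [h1.integral_comp_X hP hθ (φ := fun x => kern K h ν x * T.mbar j θ (head j l) x)
          ((hK.measurable_kern h ν).mul (h1.continuous_mbar j hθ hl).measurable)]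
        exact integral_congr_ae (ae_of_all _ fun x => by simp only; ring)
    _ = _ := by
        rw [integral_kern_mul hh, smooth]
        simp only [add_smul_ez, fz, mz]

lemma integrable_kern_sq (hP : P.Standing)
    (hK : KernelCond K) {h : ℝ} (hh : 0 < h) (θ : Vec d) (ν : ℝ) :
    Integrable (fun ξ => kern K h ν (P.X θ ξ) ^ 2) P.μ := by
  have := hP.prob
  obtain ⟨B, hB⟩ := hK.bounded
  refine Integrable.of_bound (((hK.measurable_kern h ν).comp (hP.meas_Xθ θ)).pow_const
    2).aestronglyMeasurable ((B / h) ^ 2) (ae_of_all _ fun ξ => ?_)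
  have h0 := hK.kern_nonneg hh ν (P.X θ ξ)
  rw [Real.norm_of_nonneg (sq_nonneg _)]
  exact pow_le_pow_left₀ h0 (kern_le hB hh _ _) 2

lemma integrable_m_sq_mul_kern_sq (h1 : Regularity P T Pr A s Δ N Xε Λε) (hP : P.Standing)
    (hK : KernelCond K) {h : ℝ} (hh : 0 < h) {θ : Vec d} (hθ : θ ∈ N) {l : Fin p → ℝ}
    (hl : l ∈ Λε) (j : Fin p) (ν : ℝ) :
    Integrable (fun ξ => P.m j θ (P.Y θ ξ) (head j l) ^ 2 * kern K h ν (P.X θ ξ) ^ 2) P.μ := by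
  obtain ⟨C, hC⟩ := h1.m_moment
  obtain ⟨B, hB⟩ := hK.bounded
  refine (hC j θ hθ l hl).1.mul_bdd (c := (B / h) ^ 2) (((hK.measurable_kern h ν).comp
    (hP.meas_Xθ θ)).pow_const 2).aestronglyMeasurable (ae_of_all _ fun ξ => ?_)
  rw [Real.norm_of_nonneg (sq_nonneg _)]
  exact pow_le_pow_left₀ (hK.kern_nonneg hh ν (P.X θ ξ)) (kern_le hB hh _ _) 2

/-- As `K² ≤ (sup K) K`, the second moment of the kernel weight is at most `sup K / h` times its
mean. -/
lemma exists_integral_kern_sq_le [IsProbabilityMeasure Pr]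
    (h1 : Regularity P T Pr A s Δ N Xε Λε) (hP : P.Standing)
    (hK : KernelCond K) : ∃ C, 0 ≤ C ∧ ∀ h, 0 < h → h ≤ 1 → ∀ θ ∈ N, ∀ ν ∈ Xε,
      ∫ ξ, kern K h ν (P.X θ ξ) ^ 2 ∂P.μ ≤ C / h := by
  obtain ⟨B, hB⟩ := hK.bounded
  obtain ⟨C, hC0, hf, -⟩ := h1.exists_linearGrowthC3 hP
  have hB0 : 0 ≤ B := (hK.nonneg 0).trans (hB 0)
  have hk := hK.kmom_nonneg
  refine ⟨B * (2 * C * kmom K), by positivity, fun h hh hh1 θ hθ ν hν => ?_⟩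
  have := hP.prob
  obtain ⟨-, -, ⟨l, hl⟩⟩ := h1.nonempty
  have hi : Integrable (fun ξ => kern K h ν (P.X θ ξ)) P.μ :=
    Integrable.of_bound ((hK.measurable_kern h ν).comp (hP.meas_Xθ θ)).aestronglyMeasurable (B / h)
      (ae_of_all _ fun ξ => by
        rw [Real.norm_of_nonneg (hK.kern_nonneg hh _ _)]; exact kern_le hB hh _ _)
  calc ∫ ξ, kern K h ν (P.X θ ξ) ^ 2 ∂P.μ ≤ ∫ ξ, B / h * kern K h ν (P.X θ ξ) ∂P.μ := by
        refine integral_mono (integrable_kern_sq hP hK hh θ ν) (hi.const_mul _) fun ξ => ?_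
        simp only [sq]
        exact mul_le_mul_of_nonneg_right (kern_le hB hh _ _) (hK.kern_nonneg hh _ _)
    _ = B / h * smooth K h (fz T) (ez d p) (θ, l, ν) := by
        rw [integral_const_mul, h1.integral_kern hP hK hh hθ l ν]
    _ ≤ B / h * (2 * C * kmom K) := by
        gcongr
        refine (le_abs_self _).trans (hK.abs_integral_le fun u => ?_)
        refine (hf.abs_le ⟨hθ, hl, hν⟩ _).trans ?_
        calc _ ≤ C * (2 * (1 + u ^ 2)) := by gcongr; exact one_add_abs_mul_le hh.le hh1 u
          _ = _ := by ring
    _ = _ := by ring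

/-- On `{X ∈ Xε}` the conditional second moment of `m_j` is bounded; outside, the distance to `ν`
is at least `r` and the kernel weight itself is bounded. -/
lemma exists_integral_m_sq_mul_kern_sq_le [IsProbabilityMeasure Pr]
    (h1 : Regularity P T Pr A s Δ N Xε Λε) (hP : P.Standing)
    (hK : KernelCond K) {r : ℝ} (hr : 0 < r) : ∃ C, 0 ≤ C ∧ ∀ h, 0 < h → h ≤ 1 → ∀ θ ∈ N, ∀ l ∈ Λε,
      ∀ j, ∀ ν, Metric.ball ν r ⊆ Xε →
      ∫ ξ, P.m j θ (P.Y θ ξ) (head j l) ^ 2 * kern K h ν (P.X θ ξ) ^ 2 ∂P.μ ≤ C / h := by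
  have := hP.prob
  obtain ⟨B, hB⟩ := hK.bounded
  obtain ⟨D, hD0, hD⟩ := hK.exists_abs_mul_le
  obtain ⟨C₁, hC₁0, hC₁⟩ := h1.exists_integral_kern_sq_le hP hK
  obtain ⟨C₂', hC₂'⟩ := h1.m_cond_moment
  obtain ⟨C₃', hC₃'⟩ := h1.m_moment
  set C₂ := max C₂' 0
  set C₃ := max C₃' 0
  have hC₂0 : 0 ≤ C₂ := le_max_right _ _
  have hC₃0 : 0 ≤ C₃ := le_max_right _ _
  refine ⟨C₂ * C₁ + (D / r) ^ 2 * C₃, by positivity, fun h hh hh1 θ hθ l hl j ν hν => ?_⟩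
  have hle : MeasurableSpace.comap (P.X θ) inferInstance ≤ (inferInstance : MeasurableSpace Ξ) :=
    (hP.meas_Xθ θ).comap_le
  set S : Set Ξ := P.X θ ⁻¹' Xε with hS
  have hSm : MeasurableSet[MeasurableSpace.comap (P.X θ) inferInstance] S :=
    ⟨_, h1.open_X.measurableSet, rfl⟩
  set M : Ξ → ℝ := fun ξ => P.m j θ (P.Y θ ξ) (head j l) ^ 2 with hM
  have hMi : Integrable M P.μ := (hC₃' j θ hθ l hl).1
  -- the squared kernel weight on the event `X(θ) ∈ Xε`
  set κ : Ξ → ℝ := S.indicator fun ξ => kern K h ν (P.X θ ξ) ^ 2 with hκ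
  have hκm : StronglyMeasurable[MeasurableSpace.comap (P.X θ) inferInstance] κ := by
    have : Measurable[MeasurableSpace.comap (P.X θ) inferInstance]
        fun ξ => kern K h ν (P.X θ ξ) ^ 2 := fun t ht =>
      ⟨_, (hK.measurable_kern h ν).pow_const 2 ht, rfl⟩
    exact this.stronglyMeasurable.indicator hSm
  have hκ0 : ∀ ξ, 0 ≤ κ ξ := fun ξ => Set.indicator_nonneg (fun _ _ => sq_nonneg _) ξ
  have hκle : ∀ ξ, κ ξ ≤ kern K h ν (P.X θ ξ) ^ 2 := fun ξ =>
    Set.indicator_le_self' (fun _ _ => sq_nonneg _) ξ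
  have hκb : ∀ ξ, ‖κ ξ‖ ≤ (B / h) ^ 2 := fun ξ => by
    rw [Real.norm_of_nonneg (hκ0 ξ)]
    exact (hκle ξ).trans (pow_le_pow_left₀ (hK.kern_nonneg hh ν (P.X θ ξ)) (kern_le hB hh _ _) 2)
  have hpull := condExp_stronglyMeasurable_mul_of_bound hle hκm hMi _ (ae_of_all _ hκb)
  have hκi : Integrable κ P.μ := Integrable.of_bound (hκm.mono hle).aestronglyMeasurable _
    (ae_of_all _ hκb)
  have hκM : Integrable (κ * M) P.μ := hMi.bdd_mul (hκm.mono hle).aestronglyMeasurable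
    (ae_of_all _ hκb)
  have hin : ∫ ξ, (κ * M) ξ ∂P.μ ≤ C₂ * (C₁ / h) := by
    have hcM : Integrable (P.μ[κ * M | MeasurableSpace.comap (P.X θ) inferInstance]) P.μ :=
      integrable_condExp
    rw [← integral_condExp hle]
    calc ∫ ξ, (P.μ[κ * M | MeasurableSpace.comap (P.X θ) inferInstance]) ξ ∂P.μ
        ≤ ∫ ξ, C₂ * κ ξ ∂P.μ := by
          refine integral_mono_ae hcM (hκi.const_mul _) ?_
          filter_upwards [hpull, hC₂' j θ hθ l hl] with ξ a1 a2
          rw [a1, Pi.mul_apply, mul_comm]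
          by_cases hX : P.X θ ξ ∈ Xε
          · exact mul_le_mul_of_nonneg_right ((a2 hX).trans (le_max_left _ _)) (hκ0 ξ)
          · have : κ ξ = 0 := Set.indicator_of_notMem (s := S) hX _
            simp [this]
      _ = C₂ * ∫ ξ, κ ξ ∂P.μ := integral_const_mul _ _
      _ ≤ C₂ * (C₁ / h) := by
          gcongr
          exact (integral_mono hκi (integrable_kern_sq hP hK hh θ ν) hκle).trans
            (hC₁ h hh hh1 θ hθ ν (hν (Metric.mem_ball_self hr)))
  calc ∫ ξ, P.m j θ (P.Y θ ξ) (head j l) ^ 2 * kern K h ν (P.X θ ξ) ^ 2 ∂P.μ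
      ≤ ∫ ξ, ((κ * M) ξ + (D / r) ^ 2 * M ξ) ∂P.μ := by
        refine integral_mono (h1.integrable_m_sq_mul_kern_sq hP hK hh hθ hl j ν)
          (hκM.add (hMi.const_mul _)) fun ξ => ?_
        simp only [Pi.mul_apply]
        have hM0 : 0 ≤ M ξ := sq_nonneg _
        by_cases hX : P.X θ ξ ∈ Xε
        · have : κ ξ = kern K h ν (P.X θ ξ) ^ 2 := Set.indicator_of_mem (s := S) hX _
          rw [this]
          have : 0 ≤ (D / r) ^ 2 * M ξ := by positivity
          linarith [mul_comm (M ξ) (kern K h ν (P.X θ ξ) ^ 2)]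
        · have e0 : κ ξ = 0 := Set.indicator_of_notMem (s := S) hX _
          rw [e0, zero_mul, zero_add, mul_comm]
          refine mul_le_mul_of_nonneg_right (pow_le_pow_left₀ (hK.kern_nonneg hh ν _) ?_ 2) hM0
          refine hK.kern_le_div hD hh hr ?_
          by_contra! hlt
          refine hX (hν ?_)
          rwa [Metric.mem_ball, Real.dist_eq, abs_sub_comm]
    _ = ∫ ξ, (κ * M) ξ ∂P.μ + (D / r) ^ 2 * ∫ ξ, M ξ ∂P.μ := by
        rw [integral_add hκM (hMi.const_mul _), integral_const_mul]
    _ ≤ C₂ * (C₁ / h) + (D / r) ^ 2 * (C₃ / h) := by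
        have : ∫ ξ, M ξ ∂P.μ ≤ C₃ / h := by
          refine ((hC₃' j θ hθ l hl).2.trans (le_max_left _ 0)).trans ?_
          change C₃ ≤ C₃ / h
          rw [le_div_iff₀ hh]; nlinarith
        gcongr
    _ = _ := by ring

end Regularity

end Model2

/-! ### Simultaneous perturbation -/

section Perturbation

variable {d p : ℕ}

/-- The law `D` of a random direction: coordinates `±1`, centered and uncorrelated. -/
structure IsRademacher (D : Measure (Vec d)) : Prop where
  prob : IsProbabilityMeasure D
  sign : ∀ᵐ δ ∂D, ∀ i, δ i = 1 ∨ δ i = -1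
  cov : ∀ i j, ∫ δ, δ i * δ j ∂D = if i = j then 1 else 0

lemma spQuot_eq_smul (a cb : ℝ) (δ : Vec d) : spQuot a cb δ = a • spQuot 1 cb δ := by
  ext i; simp [spQuot]; ring

lemma spQuot_of_sign {cb : ℝ} {δ : Vec d} (hδ : ∀ i, δ i = 1 ∨ δ i = -1) (a : ℝ) :
    spQuot a cb δ = (a / (2 * cb)) • δ := by
  ext i
  simp only [spQuot, PiLp.smul_apply, smul_eq_mul]
  rcases hδ i with h | h <;> simp [h, div_neg]

lemma norm_of_sign {δ : Vec d} (hδ : ∀ i, δ i = 1 ∨ δ i = -1) : ‖δ‖ = √(d : ℝ) := by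
  rw [EuclideanSpace.norm_eq]
  congr 1
  have : ∀ i, ‖δ i‖ ^ 2 = 1 := fun i => by rcases hδ i with h | h <;> simp [h]
  simp_rw [this]
  simp

lemma norm_spQuot_of_sign {cb : ℝ} (hcb : 0 < cb) {δ : Vec d} (hδ : ∀ i, δ i = 1 ∨ δ i = -1)
    (a : ℝ) : ‖spQuot a cb δ‖ = |a| / (2 * cb) * √(d : ℝ) := by
  rw [spQuot_of_sign hδ, norm_smul, norm_of_sign hδ, Real.norm_eq_abs, abs_div,
    abs_of_pos (by positivity : 0 < 2 * cb)]

lemma measurable_spQuot : Measurable fun z : ℝ × ℝ × Vec d => spQuot z.1 z.2.1 z.2.2 := by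
  unfold spQuot
  refine (WithLp.measurable_toLp 2 _).comp (measurable_pi_lambda _ fun i => ?_)
  fun_prop

/-- `E[δ δᵀ]` is the identity. -/
lemma IsRademacher.integral_inner_smul {D : Measure (Vec d)} (hD : IsRademacher D) (w : Vec d) :
    Integrable (fun δ => inner ℝ δ w • δ) D ∧ ∫ δ, inner ℝ δ w • δ ∂D = w := by
  have := hD.prob
  have hi : Integrable (fun δ : Vec d => inner ℝ δ w • δ) D := by
    refine Integrable.of_bound (by fun_prop) (√(d : ℝ) * ‖w‖ * √(d : ℝ)) ?_
    filter_upwards [hD.sign] with δ hδ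
    rw [norm_smul, norm_of_sign hδ, ← norm_of_sign hδ]
    gcongr
    exact norm_inner_le_norm _ _
  have hij : ∀ i j, Integrable (fun δ : Vec d => δ i * δ j) D := fun i j => by
    refine Integrable.of_bound (Measurable.aestronglyMeasurable (by fun_prop)) 1 ?_
    filter_upwards [hD.sign] with δ hδ
    rcases hδ i with h | h <;> rcases hδ j with h' | h' <;> simp [h, h']
  refine ⟨hi, ext_inner_left ℝ fun v => ?_⟩
  rw [← integral_inner hi]
  have e : ∀ δ : Vec d, inner ℝ v (inner ℝ δ w • δ)
      = ∑ i, ∑ j, (w i * v j) * (δ i * δ j) := fun δ => by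
    rw [inner_smul_right, PiLp.inner_apply, PiLp.inner_apply, Finset.sum_mul_sum]
    refine Finset.sum_congr rfl fun i _ => Finset.sum_congr rfl fun j _ => ?_
    simp; ring
  simp_rw [e]
  rw [integral_finsetSum _ fun i _ => integrable_finsetSum _ fun j _ => (hij i j).const_mul _]
  simp_rw [integral_finsetSum _ fun j _ => (hij _ j).const_mul _, integral_const_mul, hD.cov]
  rw [PiLp.inner_apply]
  simp

/-- Every coordinate of `δ` has modulus `1`, so `‖spQuot a c̄ δ‖² = d a² / (4 c̄²)`. -/
lemma IsRademacher.spQuot_second_moment {Y : Type*} [MeasurableSpace Y] {m : Measure Y}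
    [IsProbabilityMeasure m] {D : Measure (Vec d)} (hD : IsRademacher D) {a : Vec d → Y → ℝ}
    (ha : Measurable fun z : Vec d × Y => a z.1 z.2) {cb B : ℝ} (hcb : 0 < cb)
    (hB : ∀ᵐ δ ∂D, Integrable (fun y => a δ y ^ 2) m ∧ ∫ y, a δ y ^ 2 ∂m ≤ B) :
    Measurable (fun z : Vec d × Y => spQuot (a z.1 z.2) cb z.1) ∧
    Integrable (fun z : Vec d × Y => ‖spQuot (a z.1 z.2) cb z.1‖ ^ 2) (D.prod m) ∧
    ∫ z, ‖spQuot (a z.1 z.2) cb z.1‖ ^ 2 ∂D.prod m ≤ d * B / (4 * cb ^ 2) := by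
  have := hD.prob
  have hUm : Measurable (fun z : Vec d × Y => spQuot (a z.1 z.2) cb z.1) :=
    measurable_spQuot.comp (ha.prodMk (measurable_const.prodMk measurable_fst))
  have hn : ∀ᵐ δ ∂D, ∀ y, ‖spQuot (a δ y) cb δ‖ ^ 2 = d / (4 * cb ^ 2) * a δ y ^ 2 := by
    filter_upwards [hD.sign] with δ hδ y
    rw [norm_spQuot_of_sign hcb hδ, mul_pow, Real.sq_sqrt (Nat.cast_nonneg _), div_pow, sq_abs]
    field_simp; ring
  have hslice : ∀ᵐ δ ∂D, Integrable (fun y => ‖spQuot (a δ y) cb δ‖ ^ 2) m ∧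
      ∫ y, ‖spQuot (a δ y) cb δ‖ ^ 2 ∂m ≤ d * B / (4 * cb ^ 2) := by
    filter_upwards [hn, hB] with δ h1 h2
    simp_rw [h1]
    refine ⟨h2.1.const_mul _, ?_⟩
    rw [integral_const_mul, mul_div_right_comm]
    exact mul_le_mul_of_nonneg_left h2.2 (by positivity)
  have hI : Integrable (fun z : Vec d × Y => ‖spQuot (a z.1 z.2) cb z.1‖ ^ 2) (D.prod m) := by
    rw [integrable_prod_iff (hUm.norm.pow_const 2).aestronglyMeasurable]
    refine ⟨hslice.mono fun δ h => h.1, Integrable.of_bound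
      ((hUm.norm.pow_const 2).norm.stronglyMeasurable.integral_prod_right).aestronglyMeasurable
      (d * B / (4 * cb ^ 2)) (hslice.mono fun δ h => ?_)⟩
    rw [Real.norm_of_nonneg (integral_nonneg fun y => norm_nonneg _)]
    simpa using h.2
  refine ⟨hUm, hI, ?_⟩
  rw [integral_prod _ hI]
  calc _ ≤ ∫ _δ, d * B / (4 * cb ^ 2) ∂D :=
        integral_mono_ae hI.integral_prod_left (integrable_const _) (hslice.mono fun δ h => h.2)
    _ = _ := by simp

/-- Mean and second moment of a simultaneous perturbation estimate: if the two-sided difference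
`a` has conditional mean `2 c̄ ⟨δ, w⟩` up to an error `2 c̄ ε`, then dividing coordinatewise by
`2 c̄ δ` and averaging over the directions recovers `w`. -/
lemma IsRademacher.spQuot_moments {Y : Type*} [MeasurableSpace Y] {m : Measure Y}
    [IsProbabilityMeasure m] {D : Measure (Vec d)} (hD : IsRademacher D) {a : Vec d → Y → ℝ}
    (ha : Measurable fun z : Vec d × Y => a z.1 z.2) {cb B ε : ℝ} (hcb : 0 < cb) {w : Vec d}
    (hB : ∀ᵐ δ ∂D, Integrable (fun y => a δ y ^ 2) m ∧ ∫ y, a δ y ^ 2 ∂m ≤ B)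
    (hε : ∀ᵐ δ ∂D, |∫ y, a δ y ∂m - 2 * cb * inner ℝ δ w| ≤ 2 * cb * ε) :
    Measurable (fun z : Vec d × Y => spQuot (a z.1 z.2) cb z.1) ∧
    Integrable (fun z : Vec d × Y => ‖spQuot (a z.1 z.2) cb z.1‖ ^ 2) (D.prod m) ∧
    ∫ z, ‖spQuot (a z.1 z.2) cb z.1‖ ^ 2 ∂D.prod m ≤ d * B / (4 * cb ^ 2) ∧
    ‖∫ z, spQuot (a z.1 z.2) cb z.1 ∂D.prod m - w‖ ≤ √(d : ℝ) * ε := by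
  have := hD.prob
  obtain ⟨hUm, hI, hI2⟩ := hD.spQuot_second_moment ha hcb hB
  have hUi : Integrable (fun z : Vec d × Y => spQuot (a z.1 z.2) cb z.1) (D.prod m) :=
    ((memLp_two_iff_integrable_sq_norm hUm.aestronglyMeasurable).2 hI).integrable one_le_two
  refine ⟨hUm, hI, hI2, ?_⟩
  obtain ⟨hw, hw'⟩ := hD.integral_inner_smul w
  rw [integral_prod _ hUi]
  rw [← hw']
  rw [← integral_sub hUi.integral_prod_left hw]
  calc _ ≤ ∫ _δ, √(d : ℝ) * ε ∂D := by
        refine norm_integral_le_of_norm_le (integrable_const _) ?_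
        filter_upwards [hD.sign, hε] with δ h1 h2
        have e : ∀ y, spQuot (a δ y) cb δ = a δ y • spQuot 1 cb δ := fun y => spQuot_eq_smul _ _ _
        simp only [e]
        rw [integral_smul_const, ← spQuot_eq_smul, spQuot_of_sign h1, ← sub_smul, norm_smul,
          norm_of_sign h1, mul_comm]
        gcongr
        rw [Real.norm_eq_abs, ← mul_le_mul_iff_of_pos_left (by positivity : 0 < 2 * cb)]
        refine le_trans (le_of_eq ?_) h2
        nth_rw 1 [← abs_of_pos (by positivity : 0 < 2 * cb)]
        rw [← abs_mul]
        congr 1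
        field_simp
    _ = _ := by simp

/-! ### The scaled perturbation size -/

/-- One plus the squared norms of all gradient estimates in the state `s`. -/
noncomputable def gsize (s : State d p) : ℝ := 1 + ‖s.Gν‖ ^ 2 + ∑ j, ‖s.G j‖ ^ 2

lemma one_le_gsize (s : State d p) : 1 ≤ gsize s := by
  have : 0 ≤ ∑ j, ‖s.G j‖ ^ 2 := Finset.sum_nonneg fun j _ => sq_nonneg _
  have := sq_nonneg ‖s.Gν‖
  rw [gsize]; linarith

lemma norm_Gν_le (s : State d p) : ‖s.Gν‖ ≤ √(gsize s) := by
  refine Real.le_sqrt_of_sq_le ?_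
  have : 0 ≤ ∑ j, ‖s.G j‖ ^ 2 := Finset.sum_nonneg fun j _ => sq_nonneg _
  rw [gsize]; linarith

lemma norm_G_le (s : State d p) (j : Fin p) : ‖s.G j‖ ≤ √(gsize s) := by
  refine Real.le_sqrt_of_sq_le ?_
  have := Finset.single_le_sum (f := fun j => ‖s.G j‖ ^ 2) (fun j _ => sq_nonneg _)
    (Finset.mem_univ j)
  have := sq_nonneg ‖s.Gν‖
  rw [gsize]; linarith

lemma one_le_sqrt_gsize (s : State d p) : 1 ≤ √(gsize s) :=
  Real.one_le_sqrt.2 (one_le_gsize s)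

lemma div_sqrt_nat_le {x : ℝ} (hx : 0 ≤ x) : x / √(d : ℝ) ≤ x := by
  rcases Nat.eq_zero_or_pos d with rfl | hd
  · simpa using hx
  · exact div_le_self hx (Real.one_le_sqrt.2 (by exact_mod_cast hd))

lemma le_ciSup_G (s : State d p) (j : Fin p) :
    ‖s.G j‖ / √(d : ℝ) ≤ ⨆ j, ‖s.G j‖ / √(d : ℝ) :=
  le_ciSup (f := fun j => ‖s.G j‖ / √(d : ℝ)) (Set.finite_range _).bddAbove j

lemma cbar_denom_bounds (s : State d p) :
    1 ≤ max (max 1 (‖s.Gν‖ / √(d : ℝ))) (⨆ j, ‖s.G j‖ / √(d : ℝ)) ∧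
    max (max 1 (‖s.Gν‖ / √(d : ℝ))) (⨆ j, ‖s.G j‖ / √(d : ℝ)) ≤ √(gsize s) := by
  refine ⟨le_max_of_le_left (le_max_left _ _), max_le (max_le (one_le_sqrt_gsize s) ?_) ?_⟩
  · exact (div_sqrt_nat_le (norm_nonneg _)).trans (norm_Gν_le s)
  · rcases isEmpty_or_nonempty (Fin p) with h | h
    · rw [Real.iSup_of_isEmpty]; exact Real.sqrt_nonneg _
    · exact ciSup_le fun j => (div_sqrt_nat_le (norm_nonneg _)).trans (norm_G_le s j)

lemma cbar_pos {c : ℝ} (hc : 0 < c) (s : State d p) : 0 < cbar c s :=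
  div_pos hc (zero_lt_one.trans_le (cbar_denom_bounds s).1)

lemma cbar_le {c : ℝ} (hc : 0 < c) (s : State d p) : cbar c s ≤ c :=
  div_le_self hc.le (cbar_denom_bounds s).1

/-- The price of the scaling: the variance grows with the gradient estimates, but only linearly in
`gsize`. -/
lemma one_div_cbar_sq_le {c : ℝ} (hc : 0 < c) (s : State d p) :
    1 / cbar c s ^ 2 ≤ gsize s / c ^ 2 := by
  have h := cbar_denom_bounds s
  rw [cbar, div_pow, one_div_div]
  gcongr
  calc _ ≤ √(gsize s) ^ 2 := pow_le_pow_left₀ (by linarith [h.1]) h.2 2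
    _ = _ := Real.sq_sqrt (by linarith [one_le_gsize s])

lemma cbar_mul_le {c : ℝ} (hc : 0 < c) (s : State d p) {x : ℝ}
    (hx : x ≤ max (max 1 (‖s.Gν‖ / √(d : ℝ))) (⨆ j, ‖s.G j‖ / √(d : ℝ))) :
    cbar c s * x ≤ c := by
  have h := cbar_denom_bounds s
  rw [cbar, div_mul_eq_mul_div, div_le_iff₀ (by linarith [h.1])]
  gcongr

/-- The direction in which a perturbation by `δ` moves `(θ, λ, ν)`. -/
noncomputable def pdir (s : State d p) (δ : Vec d) : Vec d × (Fin p → ℝ) × ℝ :=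
  (δ, fun j => inner ℝ δ (s.G j), inner ℝ δ s.Gν)

lemma sqrt_nat_le : √(d : ℝ) ≤ 1 + d := by
  rw [Real.sqrt_le_left (by positivity)]
  nlinarith [(Nat.cast_nonneg d : (0 : ℝ) ≤ d)]

lemma norm_pdir_le (s : State d p) {δ : Vec d} (hδ : ∀ i, δ i = 1 ∨ δ i = -1) :
    ‖pdir s δ‖ ≤ (1 + d) * √(gsize s) := by
  have h1 := one_le_sqrt_gsize s
  have hd : (0 : ℝ) ≤ d := Nat.cast_nonneg d
  have h2 : ∀ G : Vec d, ‖G‖ ≤ √(gsize s) → |inner ℝ δ G| ≤ (1 + d) * √(gsize s) := fun G hG => by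
    refine (abs_real_inner_le_norm _ _).trans ?_
    rw [norm_of_sign hδ]
    have := sqrt_nat_le (d := d)
    gcongr
  refine max_le ?_ (max_le ?_ ?_)
  · change ‖δ‖ ≤ _
    rw [norm_of_sign hδ]
    have := sqrt_nat_le (d := d)
    nlinarith
  · exact (pi_norm_le_iff_of_nonneg (by positivity)).2 fun j => h2 _ (norm_G_le s j)
  · exact h2 _ (norm_Gν_le s)

/-- The gain of the scaling: perturbations are of the order `c`, however large the gradient
estimates are. -/
lemma norm_cbar_smul_pdir_le {c : ℝ} (hc : 0 < c) (s : State d p) {δ : Vec d}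
    (hδ : ∀ i, δ i = 1 ∨ δ i = -1) : ‖cbar c s • pdir s δ‖ ≤ (1 + d) * c := by
  have hd : (0 : ℝ) ≤ d := Nat.cast_nonneg d
  have hcb := cbar_pos hc s
  have h2 : ∀ G : Vec d, cbar c s * (‖G‖ / √(d : ℝ)) ≤ c →
      |cbar c s * inner ℝ δ G| ≤ (1 + d) * c := fun G hG => by
    rw [abs_mul, abs_of_pos hcb]
    have h3 := abs_real_inner_le_norm δ G
    rw [norm_of_sign hδ] at h3
    have h4 : √(d : ℝ) * ‖G‖ = d * (‖G‖ / √(d : ℝ)) := by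
      rcases Nat.eq_zero_or_pos d with rfl | hd
      · simp
      · have : 0 < √(d : ℝ) := Real.sqrt_pos.2 (by exact_mod_cast hd)
        field_simp
        rw [Real.sq_sqrt (Nat.cast_nonneg _), mul_comm]
    rw [h4] at h3
    nlinarith [mul_le_mul_of_nonneg_left h3 hcb.le, mul_le_mul_of_nonneg_left hG hd]
  refine max_le ?_ (max_le ?_ ?_)
  · change ‖cbar c s • δ‖ ≤ _
    rw [norm_smul, norm_of_sign hδ, Real.norm_of_nonneg hcb.le]
    have := sqrt_nat_le (d := d)
    have := cbar_le hc s
    rw [mul_comm]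
    gcongr
  · refine (pi_norm_le_iff_of_nonneg (by positivity)).2 fun j => h2 _ (cbar_mul_le hc s ?_)
    exact le_max_of_le_right (le_ciSup_G s j)
  · exact h2 _ (cbar_mul_le hc s (le_max_of_le_left (le_max_right _ _)))

/-! ### Derivatives along the state -/

/-- The gradient in `θ` of a function of `(θ, λ, ν)` with derivative `L`, when the gradients of
`λ_i` and `ν` are `G i` and `Gν`. -/
noncomputable def chainGrad (L : (Vec d × (Fin p → ℝ) × ℝ) →L[ℝ] ℝ) (G : Fin p → Vec d)
    (Gν : Vec d) : Vec d :=
  (InnerProductSpace.toDual ℝ (Vec d)).symm (L.comp (ContinuousLinearMap.inl ℝ (Vec d) _))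
    + ∑ i, L (0, Pi.single i 1, 0) • G i + L (0, 0, 1) • Gν

lemma clm_apply_eq (L : (Vec d × (Fin p → ℝ) × ℝ) →L[ℝ] ℝ) (x : Vec d) (y : Fin p → ℝ) (t : ℝ) :
    L (x, y, t) = L (x, 0, 0) + ∑ i, y i * L (0, Pi.single i 1, 0) + t * L (0, 0, 1) := by
  have e : ((x, y, t) : Vec d × (Fin p → ℝ) × ℝ)
      = (x, 0, 0) + ∑ i, y i • ((0, Pi.single i 1, 0) : Vec d × (Fin p → ℝ) × ℝ)
        + t • ((0, 0, 1) : Vec d × (Fin p → ℝ) × ℝ) := by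
    refine Prod.ext ?_ (Prod.ext ?_ ?_)
    · simp [Prod.fst_sum]
    · ext k; simp [Prod.snd_sum, Prod.fst_sum, Finset.sum_apply, Pi.single_apply]
    · simp [Prod.snd_sum]
  rw [e, map_add, map_add, map_sum, map_smul, smul_eq_mul]
  simp_rw [map_smul, smul_eq_mul]

lemma inner_chainGrad (L : (Vec d × (Fin p → ℝ) × ℝ) →L[ℝ] ℝ) (G : Fin p → Vec d) (Gν δ : Vec d) :
    inner ℝ δ (chainGrad L G Gν) = L (δ, fun i => inner ℝ δ (G i), inner ℝ δ Gν) := by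
  rw [clm_apply_eq, chainGrad, inner_add_right, inner_add_right, inner_sum, inner_smul_right,
    real_inner_comm, InnerProductSpace.toDual_symm_apply]
  simp only [inner_smul_right, ContinuousLinearMap.comp_apply, ContinuousLinearMap.inl_apply]
  congr 1
  · congr 1
    exact Finset.sum_congr rfl fun i _ => mul_comm _ _
  · exact mul_comm _ _

end Perturbation

/-! ### Measurability of the iterates -/

section Measurability

variable {d p : ℕ} {Ξ : Type*} [MeasurableSpace Ξ] {P : Problem d p Ξ} {K : ℝ → ℝ}

/-- The coarsest `σ`-algebra that makes all components measurable. -/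
instance : MeasurableSpace (State d p) :=
  MeasurableSpace.comap (fun s => (s.θ, s.ν, s.lam, s.Gν, s.G)) inferInstance

lemma State.measurable_toProd :
    Measurable fun s : State d p => (s.θ, s.ν, s.lam, s.Gν, s.G) :=
  comap_measurable _

lemma State.measurable_θ : Measurable (State.θ : State d p → _) := State.measurable_toProd.fst
lemma State.measurable_ν : Measurable (State.ν : State d p → _) := State.measurable_toProd.snd.fst
lemma State.measurable_lam : Measurable (State.lam : State d p → _) :=
  State.measurable_toProd.snd.snd.fst
lemma State.measurable_Gν : Measurable (State.Gν : State d p → _) :=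
  State.measurable_toProd.snd.snd.snd.fst
lemma State.measurable_G : Measurable (State.G : State d p → _) :=
  State.measurable_toProd.snd.snd.snd.snd

lemma State.measurable_of_components {Ω' : Type*} [MeasurableSpace Ω'] {a : Ω' → State d p}
    (h1 : Measurable fun ω => (a ω).θ) (h2 : Measurable fun ω => (a ω).ν)
    (h3 : Measurable fun ω => (a ω).lam) (h4 : Measurable fun ω => (a ω).Gν)
    (h5 : Measurable fun ω => (a ω).G) : Measurable a :=
  measurable_comap_iff.2 (h1.prodMk (h2.prodMk (h3.prodMk (h4.prodMk h5))))

lemma measurable_head (j : Fin p) : Measurable (head j : (Fin p → ℝ) → _) :=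
  measurable_pi_lambda _ fun _ => measurable_pi_apply _

lemma measurable_cbar (c : ℝ) : Measurable (cbar c : State d p → ℝ) := by
  have h1 := State.measurable_Gν (d := d) (p := p)
  have h2 : ∀ j, Measurable fun s : State d p => s.G j := fun j =>
    (measurable_pi_apply j).comp State.measurable_G
  unfold cbar
  refine measurable_const.div (Measurable.max (measurable_const.max (h1.norm.div_const _)) ?_)
  exact Measurable.iSup fun j => (h2 j).norm.div_const _

lemma measurable_perturb (σ c : ℝ) :
    Measurable fun z : State d p × Vec d => perturb σ c z.1 z.2 := by
  have hc : Measurable fun z : State d p × Vec d => σ * cbar c z.1 :=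
    ((measurable_cbar c).comp measurable_fst).const_mul σ
  have h2 : ∀ j, Measurable fun z : State d p × Vec d => z.1.G j := fun j =>
    (measurable_pi_apply j).comp (State.measurable_G.comp measurable_fst)
  unfold perturb
  refine Measurable.prodMk ?_ (Measurable.prodMk ?_ (measurable_pi_lambda _ fun j => ?_))
  · exact (State.measurable_θ.comp measurable_fst).add (hc.smul measurable_snd)
  · exact (State.measurable_ν.comp measurable_fst).add
      (hc.mul (measurable_snd.inner (State.measurable_Gν.comp measurable_fst)))
  · exact ((measurable_pi_apply j).comp (State.measurable_lam.comp measurable_fst)).add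
      (hc.mul (measurable_snd.inner (h2 j)))

lemma KernelCond.measurable_kern_uncurry (hK : KernelCond K) (h : ℝ) :
    Measurable fun z : ℝ × ℝ => kern K h z.1 z.2 := by
  have := hK.continuous
  unfold kern
  exact Continuous.measurable (by fun_prop)

lemma gradient_fst_eq {g : Vec d × (Fin p → ℝ) → ℝ} (hg : ContDiff ℝ 1 g) (θ : Vec d)
    (l : Fin p → ℝ) : gradient (fun t => g (t, l)) θ
      = (InnerProductSpace.toDual ℝ (Vec d)).symm
        ((fderiv ℝ g (θ, l)).comp (ContinuousLinearMap.inl ℝ (Vec d) (Fin p → ℝ))) := by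
  have h := HasFDerivAt.comp (f := fun t : Vec d => (t, l)) θ
    (hg.differentiable one_ne_zero (θ, l)).hasFDerivAt (hasFDerivAt_prodMk_left (𝕜 := ℝ) θ l)
  rw [gradient, ← h.fderiv]
  rfl

lemma deriv_update_eq {g : Vec d × (Fin p → ℝ) → ℝ} (hg : ContDiff ℝ 1 g) (θ : Vec d)
    (l : Fin p → ℝ) (j : Fin p) : deriv (fun r => g (θ, Function.update l j r)) (l j)
      = fderiv ℝ g (θ, l) (0, Pi.single j 1) := by
  have hu : HasDerivAt (fun r => ((θ, Function.update l j r) : Vec d × (Fin p → ℝ)))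
      (0, Pi.single j 1) (l j) := (hasDerivAt_const _ θ).prodMk (hasDerivAt_update l j (l j))
  have h := (hg.differentiable one_ne_zero (θ, l)).hasFDerivAt
  rw [← Function.update_eq_self j l] at h
  have := (h.comp_hasDerivAt (l j) hu).deriv
  rw [Function.update_eq_self] at this
  exact this

lemma measurable_searchDir (hg : ContDiff ℝ 1 P.g) :
    Measurable fun s : State d p => searchDir P s := by
  have hD : Continuous (fderiv ℝ P.g) := hg.continuous_fderiv one_ne_zero
  have hp : Measurable fun s : State d p => (s.θ, s.lam) :=
    State.measurable_θ.prodMk State.measurable_lam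
  unfold searchDir
  simp_rw [gradient_fst_eq hg, deriv_update_eq hg]
  refine Measurable.add ?_ (Finset.measurable_fun_sum _ fun j _ => ?_)
  · exact (Continuous.measurable (f := fun z => (InnerProductSpace.toDual ℝ (Vec d)).symm
      ((fderiv ℝ P.g z).comp (ContinuousLinearMap.inl ℝ (Vec d) (Fin p → ℝ))))
      ((InnerProductSpace.toDual ℝ (Vec d)).symm.continuous.comp
        (hD.clm_comp continuous_const))).comp hp
  · have h1 : Measurable fun s : State d p => fderiv ℝ P.g (s.θ, s.lam) (0, Pi.single j 1) :=
      (Continuous.measurable (f := fun z => fderiv ℝ P.g z (0, Pi.single j 1))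
        (hD.clm_apply continuous_const)).comp hp
    have h2 : Measurable fun s : State d p => s.G j :=
      (measurable_pi_apply j).comp State.measurable_G
    exact h1.smul h2

/-- The two-sided difference in the recursion for `G_ν`; the first argument holds the state and
the direction, the second one the two runs. -/
noncomputable def qDiff (P : Problem d p Ξ) (c : ℝ) (z : State d p × Vec d) (x : Ξ × Ξ) : ℝ :=
  P.q (perturb 1 c z.1 z.2).1 (P.X (perturb 1 c z.1 z.2).1 x.1) (perturb 1 c z.1 z.2).2.1
    - P.q (perturb (-1) c z.1 z.2).1 (P.X (perturb (-1) c z.1 z.2).1 x.2)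
      (perturb (-1) c z.1 z.2).2.1

/-- The kernel-weighted two-sided difference in the recursion for `G_j`. -/
noncomputable def mDiff (P : Problem d p Ξ) (K : ℝ → ℝ) (c h : ℝ) (j : Fin p)
    (z : State d p × Vec d) (x : Ξ × Ξ) : ℝ :=
  (P.m j (perturb 1 c z.1 z.2).1 (P.Y (perturb 1 c z.1 z.2).1 x.1)
      (head j (perturb 1 c z.1 z.2).2.2)
    - P.m j (perturb (-1) c z.1 z.2).1 (P.Y (perturb (-1) c z.1 z.2).1 x.2)
      (head j (perturb (-1) c z.1 z.2).2.2))
    * kern K h (perturb 1 c z.1 z.2).2.1 (P.X (perturb 1 c z.1 z.2).1 x.1)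
    * kern K h (perturb (-1) c z.1 z.2).2.1 (P.X (perturb (-1) c z.1 z.2).1 x.2)

lemma measurable_qDiff (hP : P.Standing) (c : ℝ) :
    Measurable fun z : (State d p × Vec d) × Ξ × Ξ => qDiff P c z.1 z.2 := by
  have hp : ∀ σ, Measurable fun z : (State d p × Vec d) × Ξ × Ξ => perturb σ c z.1.1 z.1.2 :=
    fun σ => (measurable_perturb σ c).comp measurable_fst
  have e1 : Measurable fun z : (State d p × Vec d) × Ξ × Ξ => z.2.1 := measurable_snd.fst
  have e2 : Measurable fun z : (State d p × Vec d) × Ξ × Ξ => z.2.2 := measurable_snd.snd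
  unfold qDiff
  exact (hP.meas_q.comp ((hp 1).fst.prodMk ((hP.meas_X.comp ((hp 1).fst.prodMk e1)).prodMk
    (hp 1).snd.fst))).sub (hP.meas_q.comp ((hp (-1)).fst.prodMk
      ((hP.meas_X.comp ((hp (-1)).fst.prodMk e2)).prodMk (hp (-1)).snd.fst)))

lemma measurable_mDiff (hP : P.Standing) (hK : KernelCond K) (c h : ℝ) (j : Fin p) :
    Measurable fun z : (State d p × Vec d) × Ξ × Ξ => mDiff P K c h j z.1 z.2 := by
  have hp : ∀ σ, Measurable fun z : (State d p × Vec d) × Ξ × Ξ => perturb σ c z.1.1 z.1.2 :=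
    fun σ => (measurable_perturb σ c).comp measurable_fst
  have e1 : Measurable fun z : (State d p × Vec d) × Ξ × Ξ => z.2.1 := measurable_snd.fst
  have e2 : Measurable fun z : (State d p × Vec d) × Ξ × Ξ => z.2.2 := measurable_snd.snd
  have hk := hK.measurable_kern_uncurry h
  unfold mDiff
  refine Measurable.mul (Measurable.mul (Measurable.sub ?_ ?_) ?_) ?_
  · exact (hP.meas_m j).comp ((hp 1).fst.prodMk ((hP.meas_Y.comp ((hp 1).fst.prodMk e1)).prodMk
      ((measurable_head j).comp (hp 1).snd.snd)))
  · exact (hP.meas_m j).comp ((hp (-1)).fst.prodMk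
      ((hP.meas_Y.comp ((hp (-1)).fst.prodMk e2)).prodMk
        ((measurable_head j).comp (hp (-1)).snd.snd)))
  · exact hk.comp ((hp 1).snd.fst.prodMk (hP.meas_X.comp ((hp 1).fst.prodMk e1)))
  · exact hk.comp ((hp (-1)).snd.fst.prodMk (hP.meas_X.comp ((hp (-1)).fst.prodMk e2)))

/-- The position `θ` after one step from the state `s`. -/
noncomputable def nextθ (P : Problem d p Ξ) (α : ℝ) (s : State d p) : Vec d :=
  proj P.feasible (s.θ - α • searchDir P s)

lemma measurable_nextθ (hP : P.Standing) (hne : P.feasible.Nonempty) (hg : ContDiff ℝ 1 P.g)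
    (α : ℝ) : Measurable fun s : State d p => nextθ P α s :=
  (lipschitzWith_proj hP.compact hne hP.convex).continuous.measurable.comp
    (State.measurable_θ.sub ((measurable_searchDir hg).const_smul α))

/-- The next value of `ν`. -/
noncomputable def qUpd (P : Problem d p Ξ) (s : State d p) (x : Ξ) : ℝ := P.q s.θ (P.X s.θ x) s.ν

/-- The increment of `λ_j`, before scaling by the step size. -/
noncomputable def mUpd (P : Problem d p Ξ) (K : ℝ → ℝ) (h : ℝ) (j : Fin p) (s : State d p)
    (x : Ξ) : ℝ := P.m j s.θ (P.Y s.θ x) (head j s.lam) * kern K h s.ν (P.X s.θ x)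

lemma measurable_qUpd (hP : P.Standing) :
    Measurable fun z : State d p × Ξ => qUpd P z.1 z.2 := by
  have hθ : Measurable fun z : State d p × Ξ => z.1.θ := State.measurable_θ.comp measurable_fst
  exact hP.meas_q.comp (hθ.prodMk ((hP.meas_X.comp (hθ.prodMk measurable_snd)).prodMk
    (State.measurable_ν.comp measurable_fst)))

lemma measurable_mUpd (hP : P.Standing) (hK : KernelCond K) (h : ℝ) (j : Fin p) :
    Measurable fun z : State d p × Ξ => mUpd P K h j z.1 z.2 := by
  have hθ : Measurable fun z : State d p × Ξ => z.1.θ := State.measurable_θ.comp measurable_fst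
  unfold mUpd
  exact ((hP.meas_m j).comp (hθ.prodMk ((hP.meas_Y.comp (hθ.prodMk measurable_snd)).prodMk
    ((measurable_head j).comp (State.measurable_lam.comp measurable_fst))))).mul
    ((hK.measurable_kern_uncurry h).comp ((State.measurable_ν.comp measurable_fst).prodMk
      (hP.meas_X.comp (hθ.prodMk measurable_snd))))

lemma step_eq (α β c h : ℝ) (s : State d p) (δ : Vec d) (x : Fin 3 → Ξ) :
    step P K α β c h s δ x =
      { θ := nextθ P α s
        ν := s.ν + β * qUpd P s (x 0)
        lam := fun j => s.lam j + β * mUpd P K h j s (x 0)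
        Gν := s.Gν + β • spQuot (qDiff P c (s, δ) (x 1, x 2)) (cbar c s) δ
        G := fun j => s.G j + β • spQuot (mDiff P K c h j (s, δ) (x 1, x 2)) (cbar c s) δ } :=
  rfl

lemma measurable_step (hP : P.Standing) (hK : KernelCond K) (hne : P.feasible.Nonempty)
    (hg : ContDiff ℝ 1 P.g) (α β c h : ℝ) :
    Measurable fun z : State d p × Vec d × (Fin 3 → Ξ) =>
      step P K α β c h z.1 z.2.1 z.2.2 := by
  have hs : Measurable fun z : State d p × Vec d × (Fin 3 → Ξ) => z.1 := measurable_fst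
  have hδ : Measurable fun z : State d p × Vec d × (Fin 3 → Ξ) => z.2.1 := measurable_snd.fst
  have hx : ∀ k, Measurable fun z : State d p × Vec d × (Fin 3 → Ξ) => z.2.2 k := fun k =>
    (measurable_pi_apply k).comp measurable_snd.snd
  have hc := (measurable_cbar c).comp hs
  simp_rw [step_eq]
  refine State.measurable_of_components ?_ ?_ ?_ ?_ ?_
  · exact (measurable_nextθ hP hne hg α).comp hs
  · exact (State.measurable_ν.comp hs).add
      (((measurable_qUpd hP).comp (hs.prodMk (hx 0))).const_mul β)
  · exact measurable_pi_lambda _ fun j =>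
      ((measurable_pi_apply j).comp (State.measurable_lam.comp hs)).add
        (((measurable_mUpd hP hK h j).comp (hs.prodMk (hx 0))).const_mul β)
  · exact (State.measurable_Gν.comp hs).add ((measurable_spQuot.comp
      (((measurable_qDiff hP c).comp ((hs.prodMk hδ).prodMk ((hx 1).prodMk (hx 2)))).prodMk
        (hc.prodMk hδ))).const_smul β)
  · exact measurable_pi_lambda _ fun j =>
      ((measurable_pi_apply j).comp (State.measurable_G.comp hs)).add ((measurable_spQuot.comp
      (((measurable_mDiff hP hK c h j).comp ((hs.prodMk hδ).prodMk ((hx 1).prodMk (hx 2)))).prodMk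
        (hc.prodMk hδ))).const_smul β)

lemma measurable_iter {Ω' : Type*} [MeasurableSpace Ω'] (hP : P.Standing) (hK : KernelCond K)
    (hne : P.feasible.Nonempty) (hg : ContDiff ℝ 1 P.g) (A : Params) (s₀ : State d p)
    {Δ : ℕ → Ω' → Vec d} {ξ : ℕ → Fin 3 → Ω' → Ξ} (n : ℕ)
    (h : ∀ k < n, Measurable (Δ k) ∧ ∀ i, Measurable (ξ k i)) :
    Measurable (iter P K A s₀ Δ ξ n) := by
  induction n with
  | zero => exact measurable_const
  | succ n ih =>
    have h1 := ih fun k hk => h k (hk.trans (Nat.lt_succ_self n))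
    obtain ⟨h2, h3⟩ := h n (Nat.lt_succ_self n)
    have h4 : Measurable fun ω => (iter P K A s₀ Δ ξ n ω, Δ n ω, fun k => ξ n k ω) :=
      h1.prodMk (h2.prodMk (measurable_pi_lambda _ h3))
    have h5 := (measurable_step hP hK hne hg (A.α (n + 1)) (A.β (n + 1)) (A.c (n + 1))
      (A.h (n + 1))).comp h4
    have e : iter P K A s₀ Δ ξ (n + 1) = fun ω => step P K (A.α (n + 1)) (A.β (n + 1)) (A.c (n + 1))
        (A.h (n + 1)) (iter P K A s₀ Δ ξ n ω) (Δ n ω) (fun k => ξ n k ω) := rfl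
    rw [e]
    exact h5

end Measurability

/-! ### Independence of the noise from the past -/

section Independence

variable {d p : ℕ} {Ξ Ω : Type*} [MeasurableSpace Ξ] {P : Problem d p Ξ}
  {K : ℝ → ℝ} {Δ : ℕ → Ω → Vec d} {ξ : ℕ → Fin 3 → Ω → Ξ}

/-- The `σ`-algebras generated by the single coordinates of directions and by the single runs. -/
@[reducible] def noiseSigma (Δ : ℕ → Ω → Vec d) (ξ : ℕ → Fin 3 → Ω → Ξ) :
    (ℕ × Fin d) ⊕ (ℕ × Fin 3) → MeasurableSpace Ω :=
  Sum.elim (fun a => MeasurableSpace.comap (fun ω => Δ a.1 ω a.2) inferInstance)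
    (fun a => MeasurableSpace.comap (ξ a.1 a.2) inferInstance)

/-- The iteration to which a source of noise belongs. -/
def noiseIdx {d : ℕ} : (ℕ × Fin d) ⊕ (ℕ × Fin 3) → ℕ := Sum.elim Prod.fst Prod.fst

lemma measurable_Δ_of_le {m : MeasurableSpace Ω} {n : ℕ}
    (h : ∀ i, noiseSigma Δ ξ (Sum.inl (n, i)) ≤ m) : Measurable[m] (Δ n) := by
  have : Measurable[m] fun ω => WithLp.ofLp (Δ n ω) :=
    measurable_pi_lambda _ fun i => measurable_iff_comap_le.2 (h i)
  exact (WithLp.measurable_toLp 2 _).comp this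

lemma measurable_ξ_of_le {m : MeasurableSpace Ω} {n : ℕ} {k : Fin 3}
    (h : noiseSigma Δ ξ (Sum.inr (n, k)) ≤ m) : Measurable[m] (ξ n k) :=
  measurable_iff_comap_le.2 h

/-- The `n`-th iterate is a function of the noise of the iterations before `n`. -/
lemma measurable_iter_past (hP : P.Standing) (hK : KernelCond K) (hne : P.feasible.Nonempty)
    (hg : ContDiff ℝ 1 P.g) (A : Params) (s₀ : State d p) (n : ℕ) :
    Measurable[⨆ i ∈ {i | noiseIdx i < n}, noiseSigma Δ ξ i] (iter P K A s₀ Δ ξ n) := by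
  refine @measurable_iter d p Ξ _ P K Ω (⨆ i ∈ {i | noiseIdx i < n}, noiseSigma Δ ξ i) hP hK hne hg
    A s₀ Δ ξ n fun k hk => ⟨measurable_Δ_of_le (ξ := ξ) fun i => ?_, fun i =>
      measurable_ξ_of_le (Δ := Δ) ?_⟩
  · exact le_iSup₂_of_le (Sum.inl (k, i)) hk le_rfl
  · exact le_iSup₂_of_le (Sum.inr (k, i)) hk le_rfl

variable [MeasurableSpace Ω] {Pr : Measure Ω}

namespace Sampling

lemma noiseSigma_le (hS : Sampling P Pr Δ ξ) (i) : noiseSigma Δ ξ i ≤ ‹MeasurableSpace Ω› := by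
  rcases i with a | a
  · exact ((by fun_prop : Measurable fun v : Vec d => v a.2).comp (hS.meas_Δ a.1)).comap_le
  · exact (hS.meas_ξ a.1 a.2).comap_le

/-- All sources of noise are jointly independent: the directions and the runs are independent
families, and independent of each other. -/
lemma iIndep_noiseSigma (hS : Sampling P Pr Δ ξ) : iIndep (noiseSigma Δ ξ) Pr := by
  classical
  rw [iIndep_iff]
  intro S f hf
  have hΔ : ∀ a ∈ S.toLeft, MeasurableSet[MeasurableSpace.comap (fun ω => Δ a.1 ω a.2)
      inferInstance] (f (Sum.inl a)) := fun a ha => hf _ (Finset.mem_toLeft.1 ha)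
  have hξ : ∀ a ∈ S.toRight, MeasurableSet[MeasurableSpace.comap (ξ a.1 a.2) inferInstance]
      (f (Sum.inr a)) := fun a ha => hf _ (Finset.mem_toRight.1 ha)
  have e : ⋂ i ∈ S, f i = (⋂ a ∈ S.toLeft, f (Sum.inl a)) ∩ ⋂ a ∈ S.toRight, f (Sum.inr a) := by
    ext ω; simp [Sum.forall]
  have i1 := hS.indep_Δ.meas_biInter (S := S.toLeft) (s := fun a => f (Sum.inl a)) hΔ
  have i2 := hS.indep_ξ.meas_biInter (S := S.toRight) (s := fun a => f (Sum.inr a)) hξ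
  rw [e, IndepFun.meas_inter hS.indep ?_ ?_, i1, i2]
  · conv_rhs => rw [← Finset.toLeft_disjSum_toRight (u := S)]
    exact (Finset.prod_disjSum S.toLeft S.toRight fun i => Pr (f i)).symm
  · refine Finset.measurableSet_biInter _ fun a ha => ?_
    obtain ⟨t, ht, h⟩ := hΔ a ha
    exact ⟨(fun v => v a) ⁻¹' t, measurable_pi_apply a ht, h⟩
  · refine Finset.measurableSet_biInter _ fun a ha => ?_
    obtain ⟨t, ht, h⟩ := hξ a ha
    exact ⟨(fun v => v a) ⁻¹' t, measurable_pi_apply a ht, h⟩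

/-- Functions of disjoint sets of noise sources are independent. -/
lemma indepFun_of_disjoint {α β : Type*} [MeasurableSpace α] [MeasurableSpace β]
    (hS : Sampling P Pr Δ ξ) {I J : Set ((ℕ × Fin d) ⊕ (ℕ × Fin 3))} (hIJ : Disjoint I J)
    {a : Ω → α} {b : Ω → β} (ha : Measurable[⨆ i ∈ I, noiseSigma Δ ξ i] a)
    (hb : Measurable[⨆ i ∈ J, noiseSigma Δ ξ i] b) : IndepFun a b Pr :=
  (IndepFun_iff_Indep _ _ _).2 (indep_of_indep_of_le
    (indep_iSup_of_disjoint hS.noiseSigma_le hS.iIndep_noiseSigma hIJ) ha.comap_le hb.comap_le)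

lemma indepFun_iter_run (hS : Sampling P Pr Δ ξ) (hP : P.Standing) (hK : KernelCond K)
    (hne : P.feasible.Nonempty) (hg : ContDiff ℝ 1 P.g) (A : Params) (s₀ : State d p) (n : ℕ) :
    IndepFun (iter P K A s₀ Δ ξ n) (ξ n 0) Pr :=
  hS.indepFun_of_disjoint (I := {i | noiseIdx i < n}) (J := {i | noiseIdx i = n})
    (Set.disjoint_left.2 fun i (h1 : _ < n) (h2 : _ = n) => h1.ne h2)
    (measurable_iter_past hP hK hne hg A s₀ n)
    (measurable_ξ_of_le (Δ := Δ) (le_iSup₂_of_le (Sum.inr (n, 0)) (by rfl) le_rfl))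

lemma indepFun_iter_noise (hS : Sampling P Pr Δ ξ) (hP : P.Standing) (hK : KernelCond K)
    (hne : P.feasible.Nonempty) (hg : ContDiff ℝ 1 P.g) (A : Params) (s₀ : State d p) (n : ℕ) :
    IndepFun (iter P K A s₀ Δ ξ n) (fun ω => (Δ n ω, ξ n 1 ω, ξ n 2 ω)) Pr :=
  hS.indepFun_of_disjoint (I := {i | noiseIdx i < n}) (J := {i | noiseIdx i = n})
    (Set.disjoint_left.2 fun i (h1 : _ < n) (h2 : _ = n) => h1.ne h2)
    (measurable_iter_past hP hK hne hg A s₀ n)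
    (Measurable.prodMk (measurable_Δ_of_le (ξ := ξ) fun i =>
        le_iSup₂_of_le (Sum.inl (n, i)) (by rfl) le_rfl)
      (Measurable.prodMk
        (measurable_ξ_of_le (Δ := Δ) (le_iSup₂_of_le (Sum.inr (n, 1)) (by rfl) le_rfl))
        (measurable_ξ_of_le (Δ := Δ) (le_iSup₂_of_le (Sum.inr (n, 2)) (by rfl) le_rfl))))

lemma map_noise [IsProbabilityMeasure Pr] (hS : Sampling P Pr Δ ξ) (n : ℕ) :
    Pr.map (fun ω => (Δ n ω, ξ n 1 ω, ξ n 2 ω)) = (Pr.map (Δ n)).prod (P.μ.prod P.μ) := by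
  have i1 : IndepFun (ξ n 1) (ξ n 2) Pr :=
    hS.indep_ξ.indepFun (i := (n, 1)) (j := (n, 2)) (by simp)
  have i2 : IndepFun (Δ n) (fun ω => (ξ n 1 ω, ξ n 2 ω)) Pr :=
    hS.indepFun_of_disjoint (I := Set.range Sum.inl) (J := Set.range Sum.inr)
      (Set.disjoint_left.2 (by rintro _ ⟨a, rfl⟩ ⟨b, h⟩; cases h))
      (measurable_Δ_of_le (ξ := ξ) fun i => le_iSup₂_of_le (Sum.inl (n, i)) ⟨_, rfl⟩ le_rfl)
      (Measurable.prodMk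
        (measurable_ξ_of_le (Δ := Δ) (le_iSup₂_of_le (Sum.inr (n, 1)) ⟨_, rfl⟩ le_rfl))
        (measurable_ξ_of_le (Δ := Δ) (le_iSup₂_of_le (Sum.inr (n, 2)) ⟨_, rfl⟩ le_rfl)))
  rw [(indepFun_iff_map_prod_eq_prod_map_map (hS.meas_Δ n).aemeasurable
    ((hS.meas_ξ n 1).prodMk (hS.meas_ξ n 2)).aemeasurable).1 i2,
    (indepFun_iff_map_prod_eq_prod_map_map (hS.meas_ξ n 1).aemeasurable
    (hS.meas_ξ n 2).aemeasurable).1 i1, hS.law_ξ, hS.law_ξ]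

lemma ae_sign [IsProbabilityMeasure Pr] (hS : Sampling P Pr Δ ξ) (n : ℕ) :
    ∀ᵐ ω ∂Pr, ∀ i, Δ n ω i = 1 ∨ Δ n ω i = -1 := by
  rw [ae_all_iff]
  intro i
  have hm : Measurable fun ω => Δ n ω i :=
    (by fun_prop : Measurable fun v : Vec d => v i).comp (hS.meas_Δ n)
  have hd : Disjoint {ω | Δ n ω i = 1} {ω | Δ n ω i = -1} :=
    Set.disjoint_left.2 fun ω (h1 : _ = (1 : ℝ)) (h2 : _ = (-1 : ℝ)) => by
      rw [h1] at h2; norm_num at h2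
  have h := measure_union (μ := Pr) hd (hm (measurableSet_singleton (-1 : ℝ)))
  rw [hS.Δ_pos, hS.Δ_neg, ENNReal.add_halves] at h
  exact (prob_compl_eq_zero_iff ((hm (measurableSet_singleton (1 : ℝ))).union
    (hm (measurableSet_singleton (-1 : ℝ))))).2 h

lemma integral_Δ [IsProbabilityMeasure Pr] (hS : Sampling P Pr Δ ξ) (n : ℕ) (i : Fin d) :
    ∫ ω, Δ n ω i ∂Pr = 0 := by
  have hm : Measurable fun ω => Δ n ω i :=
    (by fun_prop : Measurable fun v : Vec d => v i).comp (hS.meas_Δ n)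
  have m1 : MeasurableSet {ω | Δ n ω i = 1} := hm (measurableSet_singleton (1 : ℝ))
  have m2 : MeasurableSet {ω | Δ n ω i = -1} := hm (measurableSet_singleton (-1 : ℝ))
  have e : (fun ω => Δ n ω i) =ᵐ[Pr] fun ω => Set.indicator {ω | Δ n ω i = 1} (fun _ => (1 : ℝ)) ω
      - Set.indicator {ω | Δ n ω i = -1} (fun _ => (1 : ℝ)) ω := by
    filter_upwards [hS.ae_sign n] with ω hω
    rcases hω i with h | h
    · simp [Set.indicator, h]; norm_num
    · simp [Set.indicator, h]; norm_num
  rw [integral_congr_ae e, integral_sub ((integrable_const _).indicator m1)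
    ((integrable_const _).indicator m2), integral_indicator_const _ m1,
    integral_indicator_const _ m2,
    measureReal_def, measureReal_def, hS.Δ_pos, hS.Δ_neg, sub_self]

lemma isRademacher [IsProbabilityMeasure Pr] (hS : Sampling P Pr Δ ξ) (n : ℕ) :
    IsRademacher (Pr.map (Δ n)) := by
  refine ⟨Measure.isProbabilityMeasure_map (hS.meas_Δ n).aemeasurable, ?_, fun i j => ?_⟩
  · have hm : MeasurableSet {δ : Vec d | ∀ i, δ i = 1 ∨ δ i = -1} := by
      have : ∀ i, Measurable fun v : Vec d => v i := fun i => by fun_prop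
      rw [Set.ofPred_forall]
      exact MeasurableSet.iInter fun i => (this i (measurableSet_singleton (1 : ℝ))).union
        (this i (measurableSet_singleton (-1 : ℝ)))
    exact (ae_map_iff (hS.meas_Δ n).aemeasurable hm).2 (hS.ae_sign n)
  · have hm : ∀ i, Measurable fun ω => Δ n ω i := fun i =>
      (by fun_prop : Measurable fun v : Vec d => v i).comp (hS.meas_Δ n)
    rw [integral_map (hS.meas_Δ n).aemeasurable
      (Measurable.aestronglyMeasurable (by fun_prop))]
    split_ifs with hij
    · subst hij
      rw [integral_congr_ae (g := fun _ => (1 : ℝ))]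
      · simp
      · filter_upwards [hS.ae_sign n] with ω hω
        rcases hω i with h | h <;> simp [h]
    · have hi : IndepFun (fun ω => Δ n ω i) (fun ω => Δ n ω j) Pr :=
        hS.indep_Δ.indepFun (i := (n, i)) (j := (n, j)) (by simpa using hij)
      have := hi.integral_mul_eq_mul_integral (hm i).aestronglyMeasurable
        (hm j).aestronglyMeasurable
      simp only [Pi.mul_apply, hS.integral_Δ, mul_zero] at this
      exact this

end Sampling

/-- Integrating out noise that is independent of the current state. -/
lemma integral_comp_le_of_indepFun {α Y : Type*} [MeasurableSpace α] [MeasurableSpace Y]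
    [IsProbabilityMeasure Pr] {a : Ω → α} {b : Ω → Y} (ha : Measurable a) (hb : Measurable b)
    (hab : IndepFun a b Pr) {ρ : Measure Y} (hρ : Pr.map b = ρ) {Φ : α × Y → ℝ}
    (hΦ : Measurable Φ) (hΦ0 : ∀ z, 0 ≤ Φ z) {B : α → ℝ} (hB : Integrable (fun ω => B (a ω)) Pr)
    (h : ∀ᵐ ω ∂Pr, Integrable (fun y => Φ (a ω, y)) ρ ∧ ∫ y, Φ (a ω, y) ∂ρ ≤ B (a ω)) :
    Integrable (fun ω => Φ (a ω, b ω)) Pr ∧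
      ∫ ω, Φ (a ω, b ω) ∂Pr ≤ ∫ ω, B (a ω) ∂Pr := by
  have hρp : IsProbabilityMeasure ρ := hρ ▸ Measure.isProbabilityMeasure_map hb.aemeasurable
  have hmap : Pr.map (fun ω => (a ω, b ω)) = (Pr.map a).prod ρ := by
    rw [(indepFun_iff_map_prod_eq_prod_map_map ha.aemeasurable hb.aemeasurable).1 hab, hρ]
  have hB0 : 0 ≤ᵐ[Pr] fun ω => B (a ω) := by
    filter_upwards [h] with ω hω
    exact (integral_nonneg fun y => hΦ0 _).trans hω.2
  have hle : ∫⁻ ω, ENNReal.ofReal (Φ (a ω, b ω)) ∂Pr ≤ ENNReal.ofReal (∫ ω, B (a ω) ∂Pr) := by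
    have e1 : ∫⁻ ω, ENNReal.ofReal (Φ (a ω, b ω)) ∂Pr
        = ∫⁻ z, ENNReal.ofReal (Φ z) ∂(Pr.map fun ω => (a ω, b ω)) :=
      (lintegral_map hΦ.ennreal_ofReal (ha.prodMk hb)).symm
    rw [e1, hmap, lintegral_prod _ hΦ.ennreal_ofReal.aemeasurable,
      lintegral_map (Measurable.lintegral_prod_right hΦ.ennreal_ofReal) ha,
      ofReal_integral_eq_lintegral_ofReal hB hB0]
    refine lintegral_mono_ae ?_
    filter_upwards [h] with ω hω
    rw [← ofReal_integral_eq_lintegral_ofReal hω.1 (ae_of_all _ fun y => hΦ0 _)]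
    exact ENNReal.ofReal_le_ofReal hω.2
  have hm : AEStronglyMeasurable (fun ω => Φ (a ω, b ω)) Pr :=
    (hΦ.comp (ha.prodMk hb)).aestronglyMeasurable
  refine ⟨⟨hm, ?_⟩, ?_⟩
  · rw [hasFiniteIntegral_iff_ofReal (ae_of_all _ fun ω => hΦ0 _)]
    exact hle.trans_lt ENNReal.ofReal_lt_top
  · rw [integral_eq_lintegral_of_nonneg_ae (ae_of_all _ fun ω => hΦ0 _) hm]
    exact ENNReal.toReal_le_of_le_ofReal (integral_nonneg_of_ae hB0) hle

end Independence

/-! ### Conditional moments of the increments -/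

section Moments

variable {d p : ℕ} {Ξ Ω : Type*} [MeasurableSpace Ξ] [MeasurableSpace Ω]
  {P : Problem d p Ξ} {T : Targets d p} {K : ℝ → ℝ} {A : Params} {Pr : Measure Ω}
  {s : ℕ → Ω → State d p} {Δ : ℕ → Ω → Vec d}
  {N : Set (Vec d)} {Xε : Set ℝ} {Λε : Set (Fin p → ℝ)}

/-- The function `q̄` in the variables `(θ, l, ν)`. -/
noncomputable def qz (P : Problem d p Ξ) (z : Vec d × (Fin p → ℝ) × ℝ) : ℝ := P.qbar z.1 z.2.2

/-- The point `(θ, λ, ν)` of a state. -/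
def State.pt (s : State d p) : Vec d × (Fin p → ℝ) × ℝ := (s.θ, s.lam, s.ν)

/-- The state lies in `N × Xε × Λε`, and so do almost all perturbed points, when the direction has
the law `D`. -/
structure IsGood (N : Set (Vec d)) (Xε : Set ℝ) (Λε : Set (Fin p → ℝ)) (D : Measure (Vec d))
    (c : ℝ) (s : State d p) : Prop where
  mem_pt : s.pt ∈ N ×ˢ Λε ×ˢ Xε
  mem_perturb : ∀ᵐ δ ∂D, perturb 1 c s δ ∈ N ×ˢ Xε ×ˢ Λε ∧ perturb (-1) c s δ ∈ N ×ˢ Xε ×ˢ Λε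

lemma pt_add (c : ℝ) (s : State d p) (δ : Vec d) :
    s.pt + cbar c s • pdir s δ
      = ((perturb 1 c s δ).1, (perturb 1 c s δ).2.2, (perturb 1 c s δ).2.1) := by
  simp only [State.pt, pdir, perturb, one_mul]
  rfl

lemma pt_sub (c : ℝ) (s : State d p) (δ : Vec d) :
    s.pt - cbar c s • pdir s δ
      = ((perturb (-1) c s δ).1, (perturb (-1) c s δ).2.2, (perturb (-1) c s δ).2.1) := by
  rw [sub_eq_add_neg, ← neg_smul]
  simp only [State.pt, pdir, perturb, neg_mul, one_mul]
  refine Prod.ext rfl (Prod.ext ?_ ?_)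
  · ext j; simp
  · simp

lemma fderiv_smul_pdir (L : (Vec d × (Fin p → ℝ) × ℝ) →L[ℝ] ℝ) (cb : ℝ) (s : State d p)
    (δ : Vec d) : L (cb • pdir s δ) = cb * inner ℝ δ (chainGrad L s.G s.Gν) := by
  rw [map_smul, smul_eq_mul, inner_chainGrad, pdir]

lemma norm_smul_pdir_pow_le {c : ℝ} (hc : 0 < c) (s : State d p) {δ : Vec d}
    (hδ : ∀ i, δ i = 1 ∨ δ i = -1) : ‖cbar c s • pdir s δ‖
      ≤ cbar c s * ((1 + d) * √(gsize s)) := by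
  rw [norm_smul, Real.norm_of_nonneg (cbar_pos hc s).le]
  exact mul_le_mul_of_nonneg_left (norm_pdir_le s hδ) (cbar_pos hc s).le

lemma measurable_mDiff_right (hP : P.Standing) (hK : KernelCond K) (c h : ℝ) (j : Fin p)
    (s : State d p) : Measurable fun z : Vec d × Ξ × Ξ => mDiff P K c h j (s, z.1) z.2 := by
  have hf : Measurable fun z : Vec d × Ξ × Ξ => ((s, z.1), z.2) :=
    (measurable_const.prodMk measurable_fst).prodMk measurable_snd
  have := Measurable.comp (g := fun z : (State d p × Vec d) × Ξ × Ξ => mDiff P K c h j z.1 z.2)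
    (measurable_mDiff hP hK c h j) hf
  simpa only [Function.comp_def] using this

namespace Regularity

lemma qz_smooth (h1 : Regularity P T Pr A s Δ N Xε Λε) :
    BoundedC3 (qz P : Vec d × (Fin p → ℝ) × ℝ → ℝ) (N ×ˢ Set.univ ×ˢ Xε) := by
  have := h1.q_smooth.comp_clm (h1.open_N.prod h1.open_X)
    ((ContinuousLinearMap.fst ℝ (Vec d) ((Fin p → ℝ) × ℝ)).prod
      ((ContinuousLinearMap.snd ℝ (Fin p → ℝ) ℝ).comp (ContinuousLinearMap.snd ℝ (Vec d) _)))
    (ContinuousLinearMap.opNorm_le_bound _ zero_le_one fun z => by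
      rw [one_mul]
      exact max_le (norm_fst_le z) ((norm_snd_le z.2).trans (norm_snd_le z)))
  convert this using 1
  · rfl
  · ext z
    simp

/-- Conditional mean and second moment of the increment of `G_ν`. -/
lemma qDiff_moments (h1 : Regularity P T Pr A s Δ N Xε Λε) (hP : P.Standing) :
    ∃ C, 0 ≤ C ∧ ∀ D : Measure (Vec d), IsRademacher D → ∀ c : ℝ, 0 < c → ∀ s : State d p,
      IsGood N Xε Λε D c s →
      Measurable (fun z : Vec d × Ξ × Ξ => spQuot (qDiff P c (s, z.1) z.2) (cbar c s) z.1) ∧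
      Integrable (fun z : Vec d × Ξ × Ξ =>
        ‖spQuot (qDiff P c (s, z.1) z.2) (cbar c s) z.1‖ ^ 2) (D.prod (P.μ.prod P.μ)) ∧
      ∫ z, ‖spQuot (qDiff P c (s, z.1) z.2) (cbar c s) z.1‖ ^ 2 ∂(D.prod (P.μ.prod P.μ))
        ≤ C * (gsize s / c ^ 2) ∧
      ‖∫ z, spQuot (qDiff P c (s, z.1) z.2) (cbar c s) z.1 ∂(D.prod (P.μ.prod P.μ))
        - chainGrad (fderiv ℝ (qz P) s.pt) s.G s.Gν‖ ≤ C * (c ^ 2 * √(gsize s)) := by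
  have := hP.prob
  obtain ⟨Cq, hCq⟩ := h1.q_moment
  obtain ⟨M, hM0, hM⟩ := h1.qz_smooth.exists_bound
  have hopen : IsOpen (N ×ˢ (Set.univ : Set (Fin p → ℝ)) ×ˢ Xε) :=
    h1.open_N.prod (isOpen_univ.prod h1.open_X)
  have hconv : Convex ℝ (N ×ˢ (Set.univ : Set (Fin p → ℝ)) ×ˢ Xε) :=
    h1.convex_N.prod (convex_univ.prod h1.convex_X)
  have hd : (0 : ℝ) ≤ d := Nat.cast_nonneg d
  refine ⟨max (d * |Cq|) (√(d : ℝ) * (M * (1 + d) ^ 3)), by positivity, fun D hD c hc s hs => ?_⟩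
  have hcb := cbar_pos hc s
  have hslice : ∀ᵐ δ ∂D, Integrable (fun y => qDiff P c (s, δ) y ^ 2) (P.μ.prod P.μ) ∧
      ∫ y, qDiff P c (s, δ) y ^ 2 ∂(P.μ.prod P.μ) ≤ 4 * |Cq| := by
    filter_upwards [hs.mem_perturb] with δ hδ
    obtain ⟨⟨a1, a2, -⟩, b1, b2, -⟩ := hδ
    obtain ⟨i1, j1⟩ := hCq _ a1 _ a2
    obtain ⟨i2, j2⟩ := hCq _ b1 _ b2
    have I1 := (i1.comp_fst P.μ).const_mul 2
    have I2 := (i2.comp_snd P.μ).const_mul 2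
    have hle : ∀ y, qDiff P c (s, δ) y ^ 2 ≤
        2 * P.q (perturb 1 c s δ).1 (P.X (perturb 1 c s δ).1 y.1) (perturb 1 c s δ).2.1 ^ 2
        + 2 * P.q (perturb (-1) c s δ).1 (P.X (perturb (-1) c s δ).1 y.2)
          (perturb (-1) c s δ).2.1 ^ 2 := fun y => by
      rw [qDiff]
      nlinarith [sq_nonneg (P.q (perturb 1 c s δ).1 (P.X (perturb 1 c s δ).1 y.1)
        (perturb 1 c s δ).2.1 + P.q (perturb (-1) c s δ).1 (P.X (perturb (-1) c s δ).1 y.2)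
          (perturb (-1) c s δ).2.1)]
    have hI : Integrable (fun y => qDiff P c (s, δ) y ^ 2) (P.μ.prod P.μ) := by
      refine (I1.add I2).mono' (((measurable_qDiff hP c).comp
        (measurable_const.prodMk measurable_id)).pow_const 2).aestronglyMeasurable
        (ae_of_all _ fun y => ?_)
      rw [Real.norm_of_nonneg (sq_nonneg _)]
      exact hle y
    refine ⟨hI, (integral_mono hI (I1.add I2) hle).trans ?_⟩
    rw [integral_add' I1 I2, integral_const_mul, integral_const_mul,
      integral_fun_fst (fun x => P.q (perturb 1 c s δ).1 (P.X (perturb 1 c s δ).1 x)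
        (perturb 1 c s δ).2.1 ^ 2),
      integral_fun_snd (fun x => P.q (perturb (-1) c s δ).1 (P.X (perturb (-1) c s δ).1 x)
        (perturb (-1) c s δ).2.1 ^ 2)]
    simp only [probReal_univ, one_smul]
    linarith [le_abs_self Cq]
  have hmean : ∀ᵐ δ ∂D, |∫ y, qDiff P c (s, δ) y ∂(P.μ.prod P.μ)
      - 2 * cbar c s * inner ℝ δ (chainGrad (fderiv ℝ (qz P) s.pt) s.G s.Gν)|
      ≤ 2 * cbar c s * (M * (1 + d) ^ 3 * (c ^ 2 * √(gsize s))) := by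
    filter_upwards [hs.mem_perturb, hD.sign] with δ hδ hsign
    obtain ⟨⟨a1, a2, a3⟩, b1, b2, b3⟩ := hδ
    have e : ∫ y, qDiff P c (s, δ) y ∂(P.μ.prod P.μ)
        = qz P (s.pt + cbar c s • pdir s δ) - qz P (s.pt - cbar c s • pdir s δ) := by
      rw [pt_add, pt_sub]
      have I1 := (h1.integrable_q hP a1 a2).comp_fst P.μ
      have I2 := (h1.integrable_q hP b1 b2).comp_snd P.μ
      unfold qDiff
      rw [integral_sub I1 I2,
        integral_fun_fst (fun x => P.q (perturb 1 c s δ).1 (P.X (perturb 1 c s δ).1 x)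
          (perturb 1 c s δ).2.1),
        integral_fun_snd (fun x => P.q (perturb (-1) c s δ).1 (P.X (perturb (-1) c s δ).1 x)
          (perturb (-1) c s δ).2.1)]
      simp only [probReal_univ, one_smul]
      rfl
    have h2 := norm_sub_sub_two_smul_fderiv_le hconv
      (fun y hy => h1.qz_smooth.contDiffAt hopen hy)
      (fun y hy => hM y hy 3 (by norm_num) le_rfl) (x := s.pt) (v := cbar c s • pdir s δ)
      (by rw [pt_add]; exact ⟨a1, trivial, a2⟩) (by rw [pt_sub]; exact ⟨b1, trivial, b2⟩)
    rw [← e, fderiv_smul_pdir, smul_eq_mul, ← mul_assoc, Real.norm_eq_abs] at h2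
    refine h2.trans ?_
    have n1 := norm_smul_pdir_pow_le hc s hsign
    have n2 := norm_cbar_smul_pdir_le hc s hsign
    calc 2 * M * ‖cbar c s • pdir s δ‖ ^ 3
        = 2 * M * (‖cbar c s • pdir s δ‖ * ‖cbar c s • pdir s δ‖ ^ 2) := by ring
      _ ≤ 2 * M * (cbar c s * ((1 + d) * √(gsize s)) * ((1 + d) * c) ^ 2) := by gcongr
      _ = _ := by ring
  obtain ⟨r1, r2, r3, r4⟩ := hD.spQuot_moments (m := P.μ.prod P.μ)
    (a := fun δ y => qDiff P c (s, δ) y) ((measurable_qDiff hP c).comp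
      ((measurable_const.prodMk measurable_fst).prodMk measurable_snd)) hcb hslice hmean
  refine ⟨r1, r2, r3.trans ?_, r4.trans ?_⟩
  · have := one_div_cbar_sq_le hc s
    calc (d : ℝ) * (4 * |Cq|) / (4 * cbar c s ^ 2) = d * |Cq| * (1 / cbar c s ^ 2) := by
          field_simp
      _ ≤ d * |Cq| * (gsize s / c ^ 2) := by gcongr
      _ ≤ _ := by
        have := one_le_gsize s
        gcongr
        exact le_max_left _ _
  · rw [← mul_assoc]
    gcongr
    exact le_max_right _ _

/-- Second moments of the increment of `G_j`, given bounds on the moments at perturbed points. -/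
lemma mDiff_sq_le (h1 : Regularity P T Pr A s Δ N Xε Λε) (hP : P.Standing) (hK : KernelCond K)
    {c h : ℝ} (hh : 0 < h) {t : State d p} {δ : Vec d} (j : Fin p) {Bk Bm : ℝ} (hBm : 0 ≤ Bm)
    (hp : perturb 1 c t δ ∈ N ×ˢ Xε ×ˢ Λε) (hm : perturb (-1) c t δ ∈ N ×ˢ Xε ×ˢ Λε)
    (hk : ∀ σ : ℝ, σ = 1 ∨ σ = -1 →
      ∫ ξ, kern K h (perturb σ c t δ).2.1 (P.X (perturb σ c t δ).1 ξ) ^ 2 ∂P.μ ≤ Bk)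
    (hmk : ∀ σ : ℝ, σ = 1 ∨ σ = -1 →
      ∫ ξ, P.m j (perturb σ c t δ).1 (P.Y (perturb σ c t δ).1 ξ) (head j (perturb σ c t δ).2.2) ^ 2
        * kern K h (perturb σ c t δ).2.1 (P.X (perturb σ c t δ).1 ξ) ^ 2 ∂P.μ ≤ Bm) :
    Integrable (fun y => mDiff P K c h j (t, δ) y ^ 2) (P.μ.prod P.μ) ∧
      ∫ y, mDiff P K c h j (t, δ) y ^ 2 ∂(P.μ.prod P.μ) ≤ 4 * (Bm * Bk) := by
  have := hP.prob
  have k1 := integrable_kern_sq hP hK hh (perturb 1 c t δ).1 (perturb 1 c t δ).2.1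
  have k2 := integrable_kern_sq hP hK hh (perturb (-1) c t δ).1 (perturb (-1) c t δ).2.1
  have m1 := h1.integrable_m_sq_mul_kern_sq hP hK hh hp.1 hp.2.2 j (perturb 1 c t δ).2.1
  have m2 := h1.integrable_m_sq_mul_kern_sq hP hK hh hm.1 hm.2.2 j (perturb (-1) c t δ).2.1
  have I1 := (m1.mul_prod k2).const_mul 2
  have I2 := (k1.mul_prod m2).const_mul 2
  have hle : ∀ y, mDiff P K c h j (t, δ) y ^ 2 ≤ _ + _ := fun y =>
    show mDiff P K c h j (t, δ) y ^ 2 ≤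
      2 * (P.m j (perturb 1 c t δ).1 (P.Y (perturb 1 c t δ).1 y.1)
          (head j (perturb 1 c t δ).2.2) ^ 2
        * kern K h (perturb 1 c t δ).2.1 (P.X (perturb 1 c t δ).1 y.1) ^ 2
        * kern K h (perturb (-1) c t δ).2.1 (P.X (perturb (-1) c t δ).1 y.2) ^ 2)
      + 2 * (kern K h (perturb 1 c t δ).2.1 (P.X (perturb 1 c t δ).1 y.1) ^ 2
        * (P.m j (perturb (-1) c t δ).1 (P.Y (perturb (-1) c t δ).1 y.2)
          (head j (perturb (-1) c t δ).2.2) ^ 2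
        * kern K h (perturb (-1) c t δ).2.1 (P.X (perturb (-1) c t δ).1 y.2) ^ 2)) by
    simp only [mDiff]
    generalize P.m j (perturb 1 c t δ).1 (P.Y (perturb 1 c t δ).1 y.1) _ = a
    generalize P.m j (perturb (-1) c t δ).1 (P.Y (perturb (-1) c t δ).1 y.2) _ = b
    generalize kern K h (perturb 1 c t δ).2.1 _ = u
    generalize kern K h (perturb (-1) c t δ).2.1 _ = v
    nlinarith [sq_nonneg ((a + b) * (u * v))]
  have hI : Integrable (fun y => mDiff P K c h j (t, δ) y ^ 2) (P.μ.prod P.μ) := by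
    refine (I1.add I2).mono' (((measurable_mDiff hP hK c h j).comp
      (measurable_const.prodMk measurable_id)).pow_const 2).aestronglyMeasurable
      (ae_of_all _ fun y => ?_)
    rw [Real.norm_of_nonneg (sq_nonneg _)]
    exact hle y
  refine ⟨hI, (integral_mono hI (I1.add I2) hle).trans ?_⟩
  rw [integral_add' I1 I2, integral_const_mul, integral_const_mul]
  rw [integral_prod_mul (fun x => P.m j (perturb 1 c t δ).1 (P.Y (perturb 1 c t δ).1 x)
          (head j (perturb 1 c t δ).2.2) ^ 2
        * kern K h (perturb 1 c t δ).2.1 (P.X (perturb 1 c t δ).1 x) ^ 2)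
      (fun x => kern K h (perturb (-1) c t δ).2.1 (P.X (perturb (-1) c t δ).1 x) ^ 2),
    integral_prod_mul (fun x => kern K h (perturb 1 c t δ).2.1 (P.X (perturb 1 c t δ).1 x) ^ 2)
      (fun x => P.m j (perturb (-1) c t δ).1 (P.Y (perturb (-1) c t δ).1 x)
          (head j (perturb (-1) c t δ).2.2) ^ 2
        * kern K h (perturb (-1) c t δ).2.1 (P.X (perturb (-1) c t δ).1 x) ^ 2)]
  have q1 := mul_le_mul (hmk 1 (Or.inl rfl)) (hk (-1) (Or.inr rfl))
    (integral_nonneg fun _ => sq_nonneg _) hBm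
  have q2 := mul_le_mul (hmk (-1) (Or.inr rfl)) (hk 1 (Or.inl rfl))
    (integral_nonneg fun _ => sq_nonneg _) hBm
  linarith

lemma integrable_kern (hP : P.Standing) (hK : KernelCond K) {h : ℝ} (hh : 0 < h) (θ : Vec d)
    (ν : ℝ) : Integrable (fun ξ => kern K h ν (P.X θ ξ)) P.μ := by
  have := hP.prob
  obtain ⟨B, hB⟩ := hK.bounded
  refine Integrable.of_bound ((hK.measurable_kern h ν).comp (hP.meas_Xθ θ)).aestronglyMeasurable
    (B / h) (ae_of_all _ fun ξ => ?_)
  rw [Real.norm_of_nonneg (hK.kern_nonneg hh _ _)]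
  exact kern_le hB hh _ _

lemma integrable_m_mul_kern (h1 : Regularity P T Pr A s Δ N Xε Λε) (hP : P.Standing)
    (hK : KernelCond K) {h : ℝ} (hh : 0 < h) (j : Fin p) {θ : Vec d} (hθ : θ ∈ N)
    {l : Fin p → ℝ} (hl : l ∈ Λε) (ν : ℝ) :
    Integrable (fun ξ => P.m j θ (P.Y θ ξ) (head j l) * kern K h ν (P.X θ ξ)) P.μ := by
  obtain ⟨B, hB⟩ := hK.bounded
  refine (h1.integrable_m hP j hθ hl).mul_bdd (c := B / h)
    ((hK.measurable_kern h ν).comp (hP.meas_Xθ θ)).aestronglyMeasurable (ae_of_all _ fun ξ => ?_)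
  rw [Real.norm_of_nonneg (hK.kern_nonneg hh _ _)]
  exact kern_le hB hh _ _

/-- The conditional mean of the increment of `G_j`, for a fixed direction: by independence of the
two runs it is an antisymmetric product of smoothed functions. -/
lemma integral_sub_mul_kern_mul_kern (h1 : Regularity P T Pr A s Δ N Xε Λε) (hP : P.Standing)
    (hK : KernelCond K) {h : ℝ} (hh : 0 < h) (j : Fin p) {θ θ' : Vec d} (hθ : θ ∈ N)
    (hθ' : θ' ∈ N) {l l' : Fin p → ℝ} (hl : l ∈ Λε) (hl' : l' ∈ Λε) (ν ν' : ℝ) :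
    ∫ y, (P.m j θ (P.Y θ y.1) (head j l) - P.m j θ' (P.Y θ' y.2) (head j l'))
        * kern K h ν (P.X θ y.1) * kern K h ν' (P.X θ' y.2) ∂(P.μ.prod P.μ)
      = smooth K h (fun z => mz T j z * fz T z) (ez d p) (θ, l, ν)
          * smooth K h (fz T) (ez d p) (θ', l', ν')
        - smooth K h (fun z => mz T j z * fz T z) (ez d p) (θ', l', ν')
          * smooth K h (fz T) (ez d p) (θ, l, ν) := by
  have := hP.prob
  rw [← h1.integral_m_mul_kern hP hK hh hθ hl, ← h1.integral_m_mul_kern hP hK hh hθ' hl',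
    ← h1.integral_kern hP hK hh hθ l, ← h1.integral_kern hP hK hh hθ' l']
  have k := integrable_kern hP hK hh θ ν
  have k' := integrable_kern hP hK hh θ' ν'
  have m := h1.integrable_m_mul_kern hP hK hh j hθ hl ν
  have m' := h1.integrable_m_mul_kern hP hK hh j hθ' hl' ν'
  rw [← integral_prod_mul, mul_comm (∫ ξ, _ * _ ∂P.μ) (∫ ξ, kern _ _ _ _ ∂P.μ),
    ← integral_prod_mul, ← integral_sub (m.mul_prod k') (k.mul_prod m')]
  refine integral_congr_ae (ae_of_all _ fun y => ?_)
  simp only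
  ring

/-- For every bandwidth the increment of `G_j` has a finite second moment. -/
lemma mDiff_integrable (h1 : Regularity P T Pr A s Δ N Xε Λε) (hP : P.Standing)
    (hK : KernelCond K) {h : ℝ} (hh : 0 < h) :
    ∃ C, 0 ≤ C ∧ ∀ j, ∀ D : Measure (Vec d), IsRademacher D → ∀ c : ℝ, 0 < c → ∀ s : State d p,
      IsGood N Xε Λε D c s →
      Integrable (fun z : Vec d × Ξ × Ξ =>
        ‖spQuot (mDiff P K c h j (s, z.1) z.2) (cbar c s) z.1‖ ^ 2) (D.prod (P.μ.prod P.μ)) ∧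
      ∫ z, ‖spQuot (mDiff P K c h j (s, z.1) z.2) (cbar c s) z.1‖ ^ 2 ∂(D.prod (P.μ.prod P.μ))
        ≤ C * (gsize s / c ^ 2) := by
  have := hP.prob
  obtain ⟨B, hB⟩ := hK.bounded
  obtain ⟨C, hC⟩ := h1.m_moment
  have hk : ∀ θ ν, ∫ ξ, kern K h ν (P.X θ ξ) ^ 2 ∂P.μ ≤ (B / h) ^ 2 := fun θ ν => by
    calc _ ≤ ∫ _, (B / h) ^ 2 ∂P.μ := integral_mono (integrable_kern_sq hP hK hh θ ν)
          (integrable_const _) fun ξ =>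
            pow_le_pow_left₀ (hK.kern_nonneg hh ν (P.X θ ξ)) (kern_le hB hh _ _) 2
      _ = _ := by simp
  have hmk : ∀ j, ∀ θ ∈ N, ∀ l ∈ Λε, ∀ ν, ∫ ξ, P.m j θ (P.Y θ ξ) (head j l) ^ 2
      * kern K h ν (P.X θ ξ) ^ 2 ∂P.μ ≤ |C| * (B / h) ^ 2 := fun j θ hθ l hl ν => by
    calc _ ≤ ∫ ξ, P.m j θ (P.Y θ ξ) (head j l) ^ 2 * (B / h) ^ 2 ∂P.μ :=
          integral_mono (h1.integrable_m_sq_mul_kern_sq hP hK hh hθ hl j ν)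
            ((hC j θ hθ l hl).1.mul_const _) fun ξ => mul_le_mul_of_nonneg_left
            (pow_le_pow_left₀ (hK.kern_nonneg hh ν (P.X θ ξ)) (kern_le hB hh _ _) 2) (sq_nonneg _)
      _ ≤ _ := by
        rw [integral_mul_const]
        gcongr
        exact (hC j θ hθ l hl).2.trans (le_abs_self _)
  refine ⟨d * (|C| * (B / h) ^ 2 * (B / h) ^ 2), by positivity, fun j D hD c hc s hs => ?_⟩
  have hslice : ∀ᵐ δ ∂D, Integrable (fun y => mDiff P K c h j (s, δ) y ^ 2) (P.μ.prod P.μ) ∧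
      ∫ y, mDiff P K c h j (s, δ) y ^ 2 ∂(P.μ.prod P.μ)
        ≤ 4 * (|C| * (B / h) ^ 2 * (B / h) ^ 2) := by
    filter_upwards [hs.mem_perturb] with δ hδ
    refine h1.mDiff_sq_le (c := c) (t := s) (δ := δ) hP hK hh j (Bk := (B / h) ^ 2)
      (Bm := |C| * (B / h) ^ 2) (by positivity) hδ.1 hδ.2 (fun σ _ => hk _ _) fun σ hσ => ?_
    rcases hσ with rfl | rfl
    · exact hmk _ _ hδ.1.1 _ hδ.1.2.2 _
    · exact hmk _ _ hδ.2.1 _ hδ.2.2.2 _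
  have hmeas : Measurable fun z : Vec d × Ξ × Ξ => mDiff P K c h j (s, z.1) z.2 :=
    measurable_mDiff_right hP hK c h j s
  obtain ⟨-, r2, r3⟩ := hD.spQuot_second_moment (m := P.μ.prod P.μ)
    (a := fun δ y => mDiff P K c h j (s, δ) y) hmeas (cbar_pos hc s) hslice
  refine ⟨r2, r3.trans ?_⟩
  have := one_div_cbar_sq_le hc s
  have hcb := cbar_pos hc s
  calc (d : ℝ) * (4 * (|C| * (B / h) ^ 2 * (B / h) ^ 2)) / (4 * cbar c s ^ 2)
      = d * (|C| * (B / h) ^ 2 * (B / h) ^ 2) * (1 / cbar c s ^ 2) := by field_simp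
    _ ≤ _ := by gcongr

/-- Conditional mean and second moment of the increment of `G_j`. The product of the two kernel
weights turns the difference of `m_j` into the difference of products `(m̄_j f) f`, whose
derivative is `f² ∇m̄_j`. -/
lemma mDiff_moments [IsProbabilityMeasure Pr] (h1 : Regularity P T Pr A s Δ N Xε Λε)
    (hP : P.Standing) (hK : KernelCond K) {r : ℝ} (hr : 0 < r) :
    ∃ C, 0 ≤ C ∧ ∀ j, ∀ D : Measure (Vec d), IsRademacher D → ∀ c : ℝ, 0 < c → (1 + d) * c ≤ 1 →
      (1 + d) * c ≤ r / 2 → ∀ h, 0 < h → h ≤ 1 → ∀ s : State d p,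
      IsGood N Xε Λε D c s → Metric.ball s.ν r ⊆ Xε →
      Measurable (fun z : Vec d × Ξ × Ξ => spQuot (mDiff P K c h j (s, z.1) z.2) (cbar c s) z.1) ∧
      Integrable (fun z : Vec d × Ξ × Ξ =>
        ‖spQuot (mDiff P K c h j (s, z.1) z.2) (cbar c s) z.1‖ ^ 2) (D.prod (P.μ.prod P.μ)) ∧
      ∫ z, ‖spQuot (mDiff P K c h j (s, z.1) z.2) (cbar c s) z.1‖ ^ 2 ∂(D.prod (P.μ.prod P.μ))
        ≤ C * (gsize s / (c * h) ^ 2) ∧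
      ‖∫ z, spQuot (mDiff P K c h j (s, z.1) z.2) (cbar c s) z.1 ∂(D.prod (P.μ.prod P.μ))
        - fz T s.pt ^ 2 • chainGrad (fderiv ℝ (mz T j) s.pt) s.G s.Gν‖
        ≤ C * ((c ^ 2 + h ^ 2) * √(gsize s)) := by
  have := hP.prob
  obtain ⟨Ck, hCk0, hCk⟩ := h1.exists_integral_kern_sq_le hP hK
  obtain ⟨Cm, hCm0, hCm⟩ := h1.exists_integral_m_sq_mul_kern_sq_le hP hK (half_pos hr)
  obtain ⟨C, hC0, hf, hmf⟩ := h1.exists_linearGrowthC3 hP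
  have hk := hK.kmom_nonneg
  have hd : (0 : ℝ) ≤ d := Nat.cast_nonneg d
  have hconv : Convex ℝ (N ×ˢ Λε ×ˢ Xε) := h1.convex_N.prod (h1.convex_Λ.prod h1.convex_X)
  set C' := 48 * (C * kmom K) * (C + 12 * (C * kmom K)) with hC'
  have hC'0 : 0 ≤ C' := by positivity
  refine ⟨max (d * (Cm * Ck)) (√(d : ℝ) * (C' * (1 + d) ^ 3)), by positivity,
    fun j D hD c hc hc1 hcr h hh hh1 s hs hball => ?_⟩
  have hcb := cbar_pos hc s
  have hslice : ∀ᵐ δ ∂D, Integrable (fun y => mDiff P K c h j (s, δ) y ^ 2) (P.μ.prod P.μ) ∧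
      ∫ y, mDiff P K c h j (s, δ) y ^ 2 ∂(P.μ.prod P.μ) ≤ 4 * (Cm / h * (Ck / h)) := by
    filter_upwards [hs.mem_perturb, hD.sign] with δ hδ hsign
    have n2 := norm_cbar_smul_pdir_le hc s hsign
    have hν : |cbar c s * inner ℝ δ s.Gν| ≤ r / 2 :=
      (((norm_snd_le (cbar c s • pdir s δ).2).trans (norm_snd_le _)).trans n2).trans hcr
    -- the perturbation uses up half of the room around `ν`
    have hb : ∀ σ : ℝ, σ = 1 ∨ σ = -1 → Metric.ball (perturb σ c s δ).2.1 (r / 2) ⊆ Xε := by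
      intro σ hσ
      refine (Metric.ball_subset_ball' ?_).trans hball
      rw [Real.dist_eq]
      have : (perturb σ c s δ).2.1 - s.ν = σ * (cbar c s * inner ℝ δ s.Gν) := by
        simp only [perturb]; ring
      rw [this, abs_mul]
      rcases hσ with rfl | rfl <;> simp only [abs_neg, abs_one, one_mul] <;> linarith
    refine h1.mDiff_sq_le (c := c) (t := s) (δ := δ) hP hK hh j (Bk := Ck / h)
      (Bm := Cm / h) (by positivity) hδ.1 hδ.2 (fun σ hσ => ?_) fun σ hσ => ?_
    · rcases hσ with rfl | rfl
      · exact hCk h hh hh1 _ hδ.1.1 _ hδ.1.2.1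
      · exact hCk h hh hh1 _ hδ.2.1 _ hδ.2.2.1
    · have := hb σ hσ
      rcases hσ with rfl | rfl
      · exact hCm h hh hh1 _ hδ.1.1 _ hδ.1.2.2 _ _ this
      · exact hCm h hh hh1 _ hδ.2.1 _ hδ.2.2.2 _ _ this
  have hmean : ∀ᵐ δ ∂D, |∫ y, mDiff P K c h j (s, δ) y ∂(P.μ.prod P.μ)
      - 2 * cbar c s * inner ℝ δ (fz T s.pt ^ 2 • chainGrad (fderiv ℝ (mz T j) s.pt) s.G s.Gν)|
      ≤ 2 * cbar c s * (C' * (1 + d) ^ 3 * ((c ^ 2 + h ^ 2) * √(gsize s))) := by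
    filter_upwards [hs.mem_perturb, hD.sign] with δ hδ hsign
    obtain ⟨⟨a1, a2, a3⟩, b1, b2, b3⟩ := hδ
    have n1 := norm_smul_pdir_pow_le hc s hsign
    have n2 := norm_cbar_smul_pdir_le hc s hsign
    have key := (hmf j).abs_smooth_mul_sub_le hf hconv hK norm_ez_le hh.le hh1
      (x := s.pt) (v := cbar c s • pdir s δ)
      (by rw [pt_add]; exact ⟨a1, a3, a2⟩) (by rw [pt_sub]; exact ⟨b1, b3, b2⟩) (n2.trans hc1)
    rw [pt_add, pt_sub, ← h1.integral_sub_mul_kern_mul_kern hP hK hh j a1 b1 a3 b3] at key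
    have dm : DifferentiableAt ℝ (mz T j) s.pt :=
      (h1.m_smooth j).differentiableAt (h1.open_N.prod (h1.open_Λ.prod isOpen_univ))
        ⟨hs.mem_pt.1, hs.mem_pt.2.1, trivial⟩
    have df : DifferentiableAt ℝ (fz T) s.pt :=
      h1.fz_smooth.differentiableAt (h1.open_N.prod (isOpen_univ.prod isOpen_univ))
        ⟨hs.mem_pt.1, trivial, trivial⟩
    -- `D(m̄ f) f - m̄ f Df = f² Dm̄`
    have e : fderiv ℝ (fun z => mz T j z * fz T z) s.pt (cbar c s • pdir s δ) * fz T s.pt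
        - mz T j s.pt * fz T s.pt * fderiv ℝ (fz T) s.pt (cbar c s • pdir s δ)
        = cbar c s * inner ℝ δ (fz T s.pt ^ 2 •
          chainGrad (fderiv ℝ (mz T j) s.pt) s.G s.Gν) := by
      have e2 := fderiv_smul_pdir (fderiv ℝ (mz T j) s.pt) (cbar c s) s δ
      rw [inner_smul_right, fderiv_fun_mul dm df, add_apply, smul_apply, smul_apply, e2]
      simp only [smul_eq_mul]
      ring
    rw [e, ← mul_assoc 2] at key
    refine key.trans ?_
    have hd1 : (1 : ℝ) ≤ (1 + d) ^ 2 := one_le_pow₀ (by linarith)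
    calc C' * (‖cbar c s • pdir s δ‖ ^ 2 + h ^ 2) * ‖cbar c s • pdir s δ‖
        ≤ C' * (((1 + d) * c) ^ 2 + (1 + d) ^ 2 * h ^ 2)
          * (cbar c s * ((1 + d) * √(gsize s))) := by
          gcongr
          nlinarith [sq_nonneg h]
      _ = cbar c s * (C' * (1 + d) ^ 3 * ((c ^ 2 + h ^ 2) * √(gsize s))) := by ring
      _ ≤ _ := by
        have : 0 ≤ cbar c s * (C' * (1 + d) ^ 3 * ((c ^ 2 + h ^ 2) * √(gsize s))) := by positivity
        linarith
  have hmeas : Measurable fun z : Vec d × Ξ × Ξ => mDiff P K c h j (s, z.1) z.2 :=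
    measurable_mDiff_right hP hK c h j s
  obtain ⟨r1, r2, r3, r4⟩ := hD.spQuot_moments (m := P.μ.prod P.μ)
    (a := fun δ y => mDiff P K c h j (s, δ) y) hmeas hcb hslice hmean
  refine ⟨r1, r2, r3.trans ?_, r4.trans ?_⟩
  · have := one_div_cbar_sq_le hc s
    calc (d : ℝ) * (4 * (Cm / h * (Ck / h))) / (4 * cbar c s ^ 2)
        = d * (Cm * Ck) / h ^ 2 * (1 / cbar c s ^ 2) := by field_simp
      _ ≤ d * (Cm * Ck) / h ^ 2 * (gsize s / c ^ 2) := by gcongr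
      _ = d * (Cm * Ck) * (gsize s / (c * h) ^ 2) := by field_simp
      _ ≤ _ := by
        have := one_le_gsize s
        gcongr
        exact le_max_left _ _
  · rw [← mul_assoc]
    gcongr
    exact le_max_right _ _

/-- Conditional mean and second moment of the increment of `ν`. -/
lemma qUpd_moments (h1 : Regularity P T Pr A s Δ N Xε Λε) :
    ∃ C, 0 ≤ C ∧ ∀ s : State d p, s.pt ∈ N ×ˢ Λε ×ˢ Xε →
      Integrable (fun x => ‖qUpd P s x‖ ^ 2) P.μ ∧ ∫ x, ‖qUpd P s x‖ ^ 2 ∂P.μ ≤ C ∧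
      ∫ x, qUpd P s x ∂P.μ = qz P s.pt := by
  obtain ⟨C, hC⟩ := h1.q_moment
  refine ⟨|C|, abs_nonneg _, fun s hs => ?_⟩
  obtain ⟨i1, i2⟩ := hC s.θ hs.1 s.ν hs.2.2
  simp only [Real.norm_eq_abs, sq_abs, qUpd]
  exact ⟨i1, i2.trans (le_abs_self _), rfl⟩

lemma mUpd_integrable (h1 : Regularity P T Pr A s Δ N Xε Λε) (hP : P.Standing)
    (hK : KernelCond K) {h : ℝ} (hh : 0 < h) (j : Fin p) {s : State d p}
    (hs : s.pt ∈ N ×ˢ Λε ×ˢ Xε) : Integrable (fun x => ‖mUpd P K h j s x‖ ^ 2) P.μ := by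
  simp only [Real.norm_eq_abs, sq_abs, mUpd, mul_pow]
  exact h1.integrable_m_sq_mul_kern_sq hP hK hh hs.1 hs.2.1 j s.ν

/-- Conditional mean and second moment of the increment of `λ_j`: the mean is `m̄_j f` up to
`O(h²)`. -/
lemma mUpd_moments [IsProbabilityMeasure Pr] (h1 : Regularity P T Pr A s Δ N Xε Λε)
    (hP : P.Standing) (hK : KernelCond K) {r : ℝ} (hr : 0 < r) :
    ∃ C, 0 ≤ C ∧ ∀ j, ∀ h, 0 < h → h ≤ 1 → ∀ s : State d p, s.pt ∈ N ×ˢ Λε ×ˢ Xε →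
      Metric.ball s.ν r ⊆ Xε →
      ∫ x, ‖mUpd P K h j s x‖ ^ 2 ∂P.μ ≤ C / h ∧
      |∫ x, mUpd P K h j s x ∂P.μ - mz T j s.pt * fz T s.pt| ≤ C * h ^ 2 := by
  obtain ⟨Cm, hCm0, hCm⟩ := h1.exists_integral_m_sq_mul_kern_sq_le hP hK hr
  obtain ⟨C, hC0, hf, hmf⟩ := h1.exists_linearGrowthC3 hP
  have hk := hK.kmom_nonneg
  refine ⟨max Cm (6 * C * kmom K), by positivity, fun j h hh hh1 s hs hball => ⟨?_, ?_⟩⟩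
  · simp only [Real.norm_eq_abs, sq_abs, mUpd, mul_pow]
    refine (hCm h hh hh1 _ hs.1 _ hs.2.1 j _ hball).trans ?_
    gcongr
    exact le_max_left _ _
  · have e : ∫ x, mUpd P K h j s x ∂P.μ
        = smooth K h (fun z => mz T j z * fz T z) (ez d p) s.pt :=
      h1.integral_m_mul_kern hP hK hh hs.1 hs.2.1 j s.ν
    rw [e]
    refine ((hmf j).abs_smooth_sub_le hK norm_ez_le hh.le hh1 hs).trans ?_
    gcongr
    exact le_max_right _ _

end Regularity

end Moments

/-! ### The targets and their derivatives -/

section TargetDerivatives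

variable {d p : ℕ} {Ξ Ω : Type*} [MeasurableSpace Ξ] [MeasurableSpace Ω]
  {P : Problem d p Ξ} {T : Targets d p} {K : ℝ → ℝ} {A : Params} {Pr : Measure Ω}
  {s : ℕ → Ω → State d p} {Δ : ℕ → Ω → Vec d}
  {N : Set (Vec d)} {Xε : Set ℝ} {Λε : Set (Fin p → ℝ)} {θs : Vec d}

lemma inner_gradient (φ : Vec d → ℝ) (θ δ : Vec d) :
    inner ℝ δ (gradient φ θ) = fderiv ℝ φ θ δ := by
  rw [real_inner_comm, gradient, InnerProductSpace.toDual_symm_apply]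

lemma norm_gradient (φ : Vec d → ℝ) (θ : Vec d) : ‖gradient φ θ‖ = ‖fderiv ℝ φ θ‖ := by
  rw [gradient, LinearIsometryEquiv.norm_map]

lemma norm_gradient_sub (φ : Vec d → ℝ) (θ θ' : Vec d) :
    ‖gradient φ θ - gradient φ θ'‖ = ‖fderiv ℝ φ θ - fderiv ℝ φ θ'‖ := by
  rw [gradient, gradient, ← map_sub, LinearIsometryEquiv.norm_map]

lemma continuousOn_gradient {S : Set (Vec d)} {φ : Vec d → ℝ}
    (hφ : ∀ θ ∈ S, ContDiffAt ℝ 2 φ θ) : ContinuousOn (gradient φ) S := fun θ hθ =>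
  ((InnerProductSpace.toDual ℝ (Vec d)).symm.continuous.continuousAt.comp
    ((hφ θ hθ).fderiv_right (m := 1) (by norm_num)).continuousAt).continuousWithinAt

/-- A function that is `C²` near a compact convex set is Lipschitz there, with its gradient. -/
lemma exists_lipschitz_gradient {S : Set (Vec d)} (hS : IsCompact S) (hc : Convex ℝ S)
    {φ : Vec d → ℝ} (hφ : ∀ θ ∈ S, ContDiffAt ℝ 2 φ θ) :
    ∃ C, 0 ≤ C ∧ (∀ θ ∈ S, ‖gradient φ θ‖ ≤ C) ∧ ∀ θ ∈ S, ∀ θ' ∈ S,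
      ‖φ θ' - φ θ‖ ≤ C * ‖θ' - θ‖ ∧ ‖gradient φ θ' - gradient φ θ‖ ≤ C * ‖θ' - θ‖ := by
  have d1 : ∀ θ ∈ S, ContDiffAt ℝ 1 (fderiv ℝ φ) θ := fun θ hθ =>
    (hφ θ hθ).fderiv_right (m := 1) (by norm_num)
  have d2 : ∀ θ ∈ S, ContDiffAt ℝ 0 (fderiv ℝ (fderiv ℝ φ)) θ := fun θ hθ =>
    (d1 θ hθ).fderiv_right (m := 0) (by norm_num)
  obtain ⟨C₁, h1⟩ := hS.exists_bound_of_continuousOn (f := fderiv ℝ φ)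
    fun θ hθ => (d1 θ hθ).continuousAt.continuousWithinAt
  obtain ⟨C₂, h2⟩ := hS.exists_bound_of_continuousOn (f := fderiv ℝ (fderiv ℝ φ))
    fun θ hθ => (d2 θ hθ).continuousAt.continuousWithinAt
  refine ⟨max (max C₁ C₂) 0, le_max_right _ _, fun θ hθ => ?_, fun θ hθ θ' hθ' => ⟨?_, ?_⟩⟩
  · rw [norm_gradient]
    exact (h1 θ hθ).trans ((le_max_left _ _).trans (le_max_left _ _))
  · exact hc.norm_image_sub_le_of_norm_fderiv_le (𝕜 := ℝ)
      (fun z hz => (hφ z hz).differentiableAt two_ne_zero)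
      (fun z hz => (h1 z hz).trans ((le_max_left _ _).trans (le_max_left _ _))) hθ hθ'
  · rw [norm_gradient_sub]
    exact hc.norm_image_sub_le_of_norm_fderiv_le (𝕜 := ℝ)
      (fun z hz => (d1 z hz).differentiableAt one_ne_zero)
      (fun z hz => (h2 z hz).trans ((le_max_right _ _).trans (le_max_left _ _))) hθ hθ'

/-- The gradients of the functions `λ_i`. -/
noncomputable def lamGrad (T : Targets d p) (θ : Vec d) (i : Fin p) : Vec d :=
  gradient (fun t => T.lam t i) θ

/-- The point `(θ, λ(θ), ν(θ))`. -/
def Targets.pt (T : Targets d p) (θ : Vec d) : Vec d × (Fin p → ℝ) × ℝ := (θ, T.lam θ, T.nu θ)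

namespace RateCond

lemma lam_smooth_apply (h5 : RateCond P T Pr A s N θs) (j : Fin p) {θ : Vec d}
    (hθ : θ ∈ P.feasible ∪ N) : ContDiffAt ℝ 2 (fun t => T.lam t j) θ :=
  contDiffAt_pi.1 (h5.lam_smooth θ hθ) j

lemma exists_target_bound (h5 : RateCond P T Pr A s N θs) (hP : P.Standing) :
    ∃ C, 0 ≤ C ∧ ∀ θ ∈ P.feasible,
      (‖gradient T.nu θ‖ ≤ C ∧ ∀ j, ‖lamGrad T θ j‖ ≤ C) ∧ ∀ θ' ∈ P.feasible,
      ‖T.nu θ' - T.nu θ‖ ≤ C * ‖θ' - θ‖ ∧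
      ‖gradient T.nu θ' - gradient T.nu θ‖ ≤ C * ‖θ' - θ‖ ∧
      ∀ j, ‖T.lam θ' j - T.lam θ j‖ ≤ C * ‖θ' - θ‖ ∧
        ‖lamGrad T θ' j - lamGrad T θ j‖ ≤ C * ‖θ' - θ‖ := by
  obtain ⟨C₀, hC₀, a1, a2⟩ := exists_lipschitz_gradient hP.compact hP.convex
    fun θ hθ => h5.nu_smooth θ (Or.inl hθ)
  choose B hB b1 b2 using fun j => exists_lipschitz_gradient hP.compact hP.convex
    fun θ hθ => h5.lam_smooth_apply j (Or.inl hθ)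
  have hs : 0 ≤ ∑ j, B j := Finset.sum_nonneg fun j _ => hB j
  have hj : ∀ j, B j ≤ C₀ + ∑ j, B j := fun j => by
    have := Finset.single_le_sum (fun j _ => hB j) (Finset.mem_univ j)
    linarith
  have h0 : C₀ ≤ C₀ + ∑ j, B j := by linarith
  refine ⟨C₀ + ∑ j, B j, by positivity, fun θ hθ =>
    ⟨⟨(a1 θ hθ).trans h0, fun j => (b1 j θ hθ).trans (hj j)⟩, fun θ' hθ' =>
      ⟨(a2 θ hθ θ' hθ').1.trans (by gcongr), (a2 θ hθ θ' hθ').2.trans (by gcongr), fun j =>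
        ⟨(b2 j θ hθ θ' hθ').1.trans ?_, (b2 j θ hθ θ' hθ').2.trans ?_⟩⟩⟩⟩
  all_goals exact mul_le_mul_of_nonneg_right (hj j) (norm_nonneg _)

/-- Implicit differentiation: if `F(θ, λ(θ), ν(θ))` vanishes on `N`, so does its gradient. -/
lemma chainGrad_target_eq_zero (h5 : RateCond P T Pr A s N θs) (hN : IsOpen N)
    {F : Vec d × (Fin p → ℝ) × ℝ → ℝ} (hF0 : ∀ θ ∈ N, F (T.pt θ) = 0) {θ : Vec d} (hθ : θ ∈ N)
    (hF : DifferentiableAt ℝ F (T.pt θ)) :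
    chainGrad (fderiv ℝ F (T.pt θ)) (lamGrad T θ) (gradient T.nu θ) = 0 := by
  refine ext_inner_left ℝ fun δ => ?_
  rw [inner_chainGrad, inner_zero_right]
  have hl : HasFDerivAt T.lam (ContinuousLinearMap.pi fun i => fderiv ℝ (fun t => T.lam t i) θ) θ :=
    hasFDerivAt_pi.2 fun i =>
      ((h5.lam_smooth_apply i (Or.inr hθ)).differentiableAt two_ne_zero).hasFDerivAt
  have hn := ((h5.nu_smooth θ (Or.inr hθ)).differentiableAt two_ne_zero).hasFDerivAt
  have hc : HasFDerivAt (fun t => F (T.pt t)) _ θ :=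
    HasFDerivAt.comp (g := F) (f := T.pt) θ hF.hasFDerivAt
      ((hasFDerivAt_id θ).prodMk (hl.prodMk hn))
  have h0 : HasFDerivAt (fun t => F (T.pt t)) (0 : Vec d →L[ℝ] ℝ) θ :=
    (hasFDerivAt_const (0 : ℝ) θ).congr_of_eventuallyEq
      (Filter.eventually_of_mem (hN.mem_nhds hθ) hF0)
  have := DFunLike.congr_fun (hc.unique h0) δ
  rw [inner_gradient]
  simp only [lamGrad, inner_gradient]
  exact this

end RateCond

lemma norm_single_one_le (i : Fin p) : ‖(Pi.single i 1 : Fin p → ℝ)‖ ≤ 1 := by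
  rw [Pi.norm_single, norm_one]

lemma norm_searchDir_le (hg : ContDiff ℝ 1 P.g) {C : ℝ} (hC : ∀ z, ‖fderiv ℝ P.g z‖ ≤ C)
    (s : State d p) : ‖searchDir P s‖ ≤ C * (1 + p) * √(gsize s) := by
  have hC0 : 0 ≤ C := (norm_nonneg _).trans (hC 0)
  have h1 := one_le_sqrt_gsize s
  unfold searchDir
  rw [gradient_fst_eq hg]
  simp_rw [deriv_update_eq hg]
  have e1 : ‖(InnerProductSpace.toDual ℝ (Vec d)).symm ((fderiv ℝ P.g (s.θ, s.lam)).comp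
      (ContinuousLinearMap.inl ℝ (Vec d) (Fin p → ℝ)))‖ ≤ C * √(gsize s) := by
    rw [LinearIsometryEquiv.norm_map]
    calc _ ≤ ‖fderiv ℝ P.g (s.θ, s.lam)‖ * ‖ContinuousLinearMap.inl ℝ (Vec d) (Fin p → ℝ)‖ :=
          ContinuousLinearMap.opNorm_comp_le _ _
      _ ≤ C * 1 := by
          gcongr
          · exact hC _
          · exact ContinuousLinearMap.norm_inl_le_one _ _ _
      _ ≤ _ := by gcongr
  have e2 : ∀ j, ‖fderiv ℝ P.g (s.θ, s.lam) (0, Pi.single j 1) • s.G j‖ ≤ C * √(gsize s) := by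
    intro j
    rw [norm_smul]
    have h2 : ‖fderiv ℝ P.g (s.θ, s.lam) (0, Pi.single j 1)‖ ≤ C := by
      refine (ContinuousLinearMap.le_opNorm _ _).trans ?_
      calc _ ≤ C * 1 := by
            gcongr
            · exact hC _
            · simpa [Prod.norm_def] using norm_single_one_le j
        _ = C := mul_one C
    exact mul_le_mul h2 (norm_G_le s j) (norm_nonneg _) hC0
  calc _ ≤ C * √(gsize s) + ∑ _j : Fin p, C * √(gsize s) :=
        (norm_add_le _ _).trans (add_le_add e1 (norm_sum_le_of_le _ fun j _ => e2 j))
    _ = _ := by simp; ring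

lemma nextθ_mem (hP : P.Standing) (hne : P.feasible.Nonempty) (α : ℝ) (s : State d p) :
    nextθ P α s ∈ P.feasible := (proj_spec hP.compact hne _).1

lemma norm_nextθ_sub_le (hP : P.Standing) (hg : ContDiff ℝ 1 P.g) {C : ℝ}
    (hC : ∀ z, ‖fderiv ℝ P.g z‖ ≤ C) {α : ℝ} (hα : 0 ≤ α) {s : State d p}
    (hθ : s.θ ∈ P.feasible) :
    ‖nextθ P α s - s.θ‖ ≤ C * (1 + p) * (α * √(gsize s)) := by
  refine (norm_proj_sub_le hP.compact hP.convex _ hθ).trans ?_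
  rw [sub_sub_cancel_left, norm_neg, norm_smul, Real.norm_of_nonneg hα]
  have := norm_searchDir_le hg hC s
  nlinarith

/-! ### Triangular structure of the root problems -/

/-- `m̄_j` does not depend on the coordinates of `λ` after the `j`-th. -/
lemma fderiv_mz_single_of_lt {j i : Fin p} (hij : j < i) {z : Vec d × (Fin p → ℝ) × ℝ}
    (hz : DifferentiableAt ℝ (mz T j) z) : fderiv ℝ (mz T j) z (0, Pi.single i 1, 0) = 0 := by
  have hu : HasDerivAt (fun r : ℝ => z + r • ((0, Pi.single i 1, 0) : Vec d × (Fin p → ℝ) × ℝ))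
      (0, Pi.single i 1, 0) 0 := by
    simpa using ((hasDerivAt_id (0 : ℝ)).smul_const
      ((0, Pi.single i 1, 0) : Vec d × (Fin p → ℝ) × ℝ)).const_add z
  have h := hz.hasFDerivAt
  have e0 : z = z + (0 : ℝ) • ((0, Pi.single i 1, 0) : Vec d × (Fin p → ℝ) × ℝ) := by simp
  rw [e0] at h
  have h1 := h.comp_hasDerivAt (0 : ℝ) hu
  have e : (mz T j ∘ fun r : ℝ => z + r • ((0, Pi.single i 1, 0) : Vec d × (Fin p → ℝ) × ℝ))
      = fun _ => mz T j z := by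
    ext r
    have : head j (z.2.1 + r • Pi.single i 1) = head j z.2.1 := by
      ext k
      have hk : Fin.castLE j.isLt k ≠ i := fun h => by
        have h2 : (k : ℕ) = i := congrArg Fin.val h
        have := k.isLt
        have h3 : (j : ℕ) < i := hij
        omega
      simp [head, hk]
    simp [mz, this]
  rw [e] at h1
  rw [← e0] at h1
  exact h1.unique (hasDerivAt_const _ _)

lemma fderiv_mz_single_self {j : Fin p} {z : Vec d × (Fin p → ℝ) × ℝ}
    (hz : DifferentiableAt ℝ (mz T j) z) : fderiv ℝ (mz T j) z (0, Pi.single j 1, 0)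
      = deriv (fun r => T.mbar j z.1 (head j (Function.update z.2.1 j r)) z.2.2) (z.2.1 j) := by
  have hu : HasDerivAt (fun r => ((z.1, Function.update z.2.1 j r, z.2.2) :
      Vec d × (Fin p → ℝ) × ℝ)) (0, Pi.single j 1, 0) (z.2.1 j) :=
    (hasDerivAt_const _ z.1).prodMk ((hasDerivAt_update z.2.1 j (z.2.1 j)).prodMk
      (hasDerivAt_const _ z.2.2))
  have h := hz.hasFDerivAt
  have e0 : z = (z.1, Function.update z.2.1 j (z.2.1 j), z.2.2) := by
    rw [Function.update_eq_self]
  rw [e0] at h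
  have := (h.comp_hasDerivAt (z.2.1 j) hu).deriv
  rw [← e0] at this
  exact this.symm

lemma fderiv_qz_single (i : Fin p) {z : Vec d × (Fin p → ℝ) × ℝ}
    (hz : DifferentiableAt ℝ (qz P) z) : fderiv ℝ (qz P) z (0, Pi.single i 1, 0) = 0 := by
  have hu : HasDerivAt (fun r => ((z.1, Function.update z.2.1 i r, z.2.2) :
      Vec d × (Fin p → ℝ) × ℝ)) (0, Pi.single i 1, 0) (z.2.1 i) :=
    (hasDerivAt_const _ z.1).prodMk ((hasDerivAt_update z.2.1 i (z.2.1 i)).prodMk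
      (hasDerivAt_const _ z.2.2))
  have h := hz.hasFDerivAt
  have e0 : z = (z.1, Function.update z.2.1 i (z.2.1 i), z.2.2) := by
    rw [Function.update_eq_self]
  rw [e0] at h
  have h1 := h.comp_hasDerivAt (z.2.1 i) hu
  rw [← e0] at h1
  exact h1.unique (hasDerivAt_const (z.2.1 i) (qz P z))

lemma fderiv_qz_last {z : Vec d × (Fin p → ℝ) × ℝ} (hz : DifferentiableAt ℝ (qz P) z) :
    fderiv ℝ (qz P) z (0, 0, 1) = deriv (fun r => P.qbar z.1 r) z.2.2 := by
  have hu : HasDerivAt (fun r => ((z.1, z.2.1, r) : Vec d × (Fin p → ℝ) × ℝ)) (0, 0, 1) z.2.2 :=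
    (hasDerivAt_const _ z.1).prodMk ((hasDerivAt_const _ z.2.1).prodMk (hasDerivAt_id z.2.2))
  exact (HasFDerivAt.comp_hasDerivAt (z.2.2) (f := fun r => ((z.1, z.2.1, r) :
    Vec d × (Fin p → ℝ) × ℝ)) hz.hasFDerivAt hu).deriv.symm

/-- A triangular linear system with negative diagonal pulls its last component towards `0`, up to
the earlier components. -/
lemma inner_triangular_le {E : Type*} [NormedAddCommGroup E] [InnerProductSpace ℝ E]
    (L : (Vec d × (Fin p → ℝ) × ℝ) →L[ℝ] ℝ) {j : Fin p} {ε M φ f₀ F : ℝ} (hε : 0 ≤ ε)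
    (hz : ∀ i, j < i → L (0, Pi.single i 1, 0) = 0) (hj : L (0, Pi.single j 1, 0) ≤ -ε)
    (hL : ‖L‖ ≤ M) (hf0 : 0 ≤ f₀) (hf : f₀ ≤ φ) (hF : φ ≤ F) (x : Fin p → E) (y : E) :
    inner ℝ (x j) (φ • (∑ i, L (0, Pi.single i 1, 0) • x i + L (0, 0, 1) • y))
      ≤ -(f₀ * ε) * ‖x j‖ ^ 2 + ‖x j‖ * (F * M * (∑ i with i < j, ‖x i‖ + ‖y‖)) := by
  have hM : 0 ≤ M := (norm_nonneg _).trans hL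
  have hφ : 0 ≤ φ := hf0.trans hf
  have b1 : ∀ i, |L (0, Pi.single i 1, 0)| ≤ M := fun i => by
    refine (L.le_opNorm _).trans ((mul_le_mul hL ?_ (norm_nonneg _) hM).trans (mul_one M).le)
    simpa [Prod.norm_def] using norm_single_one_le i
  have b2 : |L (0, 0, 1)| ≤ M := by
    refine (L.le_opNorm _).trans ((mul_le_mul hL ?_ (norm_nonneg _) hM).trans (mul_one M).le)
    simp [Prod.norm_def]
  have hsplit : ∑ i, L (0, Pi.single i 1, 0) • x i = L (0, Pi.single j 1, 0) • x j
      + ∑ i with i < j, L (0, Pi.single i 1, 0) • x i := by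
    rw [← Finset.add_sum_erase _ _ (Finset.mem_univ j)]
    congr 1
    refine (Finset.sum_subset (fun i hi => ?_) fun i _ hi => ?_).symm
    · simp only [Finset.mem_filter_univ] at hi
      exact Finset.mem_erase.2 ⟨hi.ne, Finset.mem_univ i⟩
    · rename_i hi'
      simp only [Finset.mem_filter_univ, not_lt] at hi
      rw [hz i (lt_of_le_of_ne hi (Finset.ne_of_mem_erase hi').symm), zero_smul]
  have n1 : ‖∑ i with i < j, L (0, Pi.single i 1, 0) • x i + L (0, 0, 1) • y‖
      ≤ M * (∑ i with i < j, ‖x i‖ + ‖y‖) := by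
    rw [mul_add, Finset.mul_sum]
    refine (norm_add_le _ _).trans (add_le_add (norm_sum_le_of_le _ fun i _ => ?_) ?_)
    · rw [norm_smul]; exact mul_le_mul_of_nonneg_right (b1 i) (norm_nonneg _)
    · rw [norm_smul]; exact mul_le_mul_of_nonneg_right b2 (norm_nonneg _)
  rw [hsplit, add_assoc, smul_add, inner_add_right, inner_smul_right, inner_smul_right,
    inner_smul_right, real_inner_self_eq_norm_sq]
  have n2 := (real_inner_le_norm (x j) (∑ i with i < j, L (0, Pi.single i 1, 0) • x i
    + L (0, 0, 1) • y)).trans (mul_le_mul_of_nonneg_left n1 (norm_nonneg _))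
  have n3 : 0 ≤ ∑ i with i < j, ‖x i‖ + ‖y‖ :=
    add_nonneg (Finset.sum_nonneg fun i _ => norm_nonneg _) (norm_nonneg _)
  have t1 : φ * (L (0, Pi.single j 1, 0) * ‖x j‖ ^ 2) ≤ -(f₀ * ε) * ‖x j‖ ^ 2 := by
    have : φ * L (0, Pi.single j 1, 0) ≤ -(f₀ * ε) := by nlinarith
    nlinarith [sq_nonneg ‖x j‖]
  have t2 : φ * inner ℝ (x j) (∑ i with i < j, L (0, Pi.single i 1, 0) • x i + L (0, 0, 1) • y)
      ≤ ‖x j‖ * (F * M * (∑ i with i < j, ‖x i‖ + ‖y‖)) := by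
    calc _ ≤ φ * (‖x j‖ * (M * (∑ i with i < j, ‖x i‖ + ‖y‖))) := mul_le_mul_of_nonneg_left n2 hφ
      _ ≤ F * (‖x j‖ * (M * (∑ i with i < j, ‖x i‖ + ‖y‖))) := by gcongr
      _ = _ := by ring
  linarith

lemma chainGrad_sub (L : (Vec d × (Fin p → ℝ) × ℝ) →L[ℝ] ℝ) (G H : Fin p → Vec d)
    (Gν Hν : Vec d) : chainGrad L G Gν - chainGrad L H Hν
      = ∑ i, L (0, Pi.single i 1, 0) • (G i - H i) + L (0, 0, 1) • (Gν - Hν) := by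
  simp only [chainGrad, smul_sub, Finset.sum_sub_distrib]
  abel

/-- `chainGrad` is linear in the derivative, and bounded as long as the gradients are. -/
lemma norm_chainGrad_sub_le (L L' : (Vec d × (Fin p → ℝ) × ℝ) →L[ℝ] ℝ) {H : Fin p → Vec d}
    {Hν : Vec d} {C : ℝ} (hν : ‖Hν‖ ≤ C) (hH : ∀ i, ‖H i‖ ≤ C) :
    ‖chainGrad L H Hν - chainGrad L' H Hν‖ ≤ ‖L - L'‖ * (1 + C + p * C) := by
  have hC : 0 ≤ C := (norm_nonneg _).trans hν
  set D := L - L' with hD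
  have e : chainGrad L H Hν - chainGrad L' H Hν = chainGrad D H Hν := by
    refine ext_inner_left ℝ fun δ => ?_
    rw [inner_sub_right, inner_chainGrad, inner_chainGrad, inner_chainGrad, hD, sub_apply]
  have b1 : ∀ i, |D (0, Pi.single i 1, 0)| ≤ ‖D‖ := fun i => by
    refine (D.le_opNorm _).trans ((mul_le_mul_of_nonneg_left ?_ (norm_nonneg _)).trans
      (mul_one _).le)
    simpa [Prod.norm_def] using norm_single_one_le i
  have b2 : |D (0, 0, 1)| ≤ ‖D‖ := by
    refine (D.le_opNorm _).trans ((mul_le_mul_of_nonneg_left ?_ (norm_nonneg _)).trans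
      (mul_one _).le)
    simp [Prod.norm_def]
  rw [e, chainGrad]
  have n1 : ‖(InnerProductSpace.toDual ℝ (Vec d)).symm
      (D.comp (ContinuousLinearMap.inl ℝ (Vec d) ((Fin p → ℝ) × ℝ)))‖ ≤ ‖D‖ := by
    rw [LinearIsometryEquiv.norm_map]
    refine (ContinuousLinearMap.opNorm_comp_le _ _).trans
      ((mul_le_mul_of_nonneg_left ?_ (norm_nonneg _)).trans (mul_one _).le)
    exact ContinuousLinearMap.norm_inl_le_one _ _ _
  have n2 : ‖∑ i, D (0, Pi.single i 1, 0) • H i‖ ≤ ∑ _i : Fin p, ‖D‖ * C := by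
    refine norm_sum_le_of_le _ fun i _ => ?_
    rw [norm_smul]
    exact mul_le_mul (b1 i) (hH i) (norm_nonneg _) (norm_nonneg _)
  have n3 : ‖D (0, 0, 1) • Hν‖ ≤ ‖D‖ * C := by
    rw [norm_smul]
    exact mul_le_mul b2 hν (norm_nonneg _) (norm_nonneg _)
  calc _ ≤ ‖D‖ + (∑ _i : Fin p, ‖D‖ * C) + ‖D‖ * C :=
        (norm_add_le _ _).trans (add_le_add ((norm_add_le _ _).trans (add_le_add n1 n2)) n3)
    _ = _ := by simp; ring

/-- The mean value theorem on a segment, for functions vanishing at one end. -/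
lemma exists_fderiv_eq_of_zero {V : Type*} [NormedAddCommGroup V] [NormedSpace ℝ V] {S : Set V}
    (hS : Convex ℝ S) {F : V → ℝ} (hF : ∀ z ∈ S, DifferentiableAt ℝ F z) {x y : V} (hx : x ∈ S)
    (hy : y ∈ S) (h0 : F x = 0) : ∃ z ∈ S, F y = fderiv ℝ F z (y - x) := by
  obtain ⟨z, hz, h⟩ := domain_mvt (f := F) (s := S) (f' := fun z => fderiv ℝ F z)
    (fun z hz => (hF z hz).hasFDerivAt.hasFDerivWithinAt) hS hx hy
  exact ⟨z, hS.segment_subset hx hy hz, by rw [← h, h0, sub_zero]⟩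

end TargetDerivatives

/-! ### One step of the error recursions -/

section OneStep

variable {d p : ℕ} {Ξ Ω : Type*} [MeasurableSpace Ξ] [MeasurableSpace Ω]
  {P : Problem d p Ξ} {T : Targets d p} {K : ℝ → ℝ} {A : Params} {Pr : Measure Ω}
  {s : ℕ → Ω → State d p} {Δ : ℕ → Ω → Vec d}
  {N : Set (Vec d)} {Xε : Set ℝ} {Λε : Set (Fin p → ℝ)} {θs : Vec d}

/-- Indices of the tracked quantities: `ν` and the `λ_j` on the left, the gradient estimates `G_ν`
and `G_j` on the right. -/
abbrev Idx (p : ℕ) := Option (Fin p) ⊕ Option (Fin p)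

/-- The order in which the errors are controlled: the drift of an error involves only errors of
smaller rank. -/
def Idx.rank : Idx p → ℕ
  | Sum.inl none => 0
  | Sum.inr none => 1
  | Sum.inl (some j) => 2 + j
  | Sum.inr (some j) => p + 2 + j

/-- The distance of a tracked quantity to its target at the current `θ`. -/
noncomputable def errN (T : Targets d p) : Idx p → State d p → ℝ
  | Sum.inl none, s => ‖s.ν - T.nu s.θ‖
  | Sum.inl (some j), s => ‖s.lam j - T.lam s.θ j‖
  | Sum.inr none, s => ‖s.Gν - gradient T.nu s.θ‖
  | Sum.inr (some j), s => ‖s.G j - lamGrad T s.θ j‖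

/-- The sum of the errors of smaller rank. -/
noncomputable def lowSum (T : Targets d p) (k : Idx p) (s : State d p) : ℝ :=
  ∑ i : Idx p with i.rank < k.rank, errN T i s

/-- The squared rate of convergence of `G_j`. -/
noncomputable def rate (α β c h : ℝ) : ℝ := (α / β) ^ 2 + β / (c * h) ^ 2 + c ^ 4 + h ^ 4

/-- The squared rate of convergence of `G_ν`. -/
noncomputable def rateν (α β c : ℝ) : ℝ := (α / β) ^ 2 + β / c ^ 2 + c ^ 4

/-- The squared rate that governs the recursion of the error with index `k`. -/
noncomputable def rateOf (k : Idx p) (α β c h : ℝ) : ℝ :=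
  match k with
  | Sum.inl none => rateν α β c
  | Sum.inr none => rateν α β c
  | Sum.inl (some _) => rate α β c h
  | Sum.inr (some _) => rate α β c h

/-- The bound for the conditional second moment of the next error with index `k`. -/
noncomputable def stepBound (T : Targets d p) (k : Idx p) (a C α β c h : ℝ) (s : State d p) : ℝ :=
  (1 - a * β) * errN T k s ^ 2 + C * β * ((∑ i : Idx p with i.rank < k.rank, errN T i s ^ 2)
    + rateOf k α β c h * (1 + ∑ i, errN T i s ^ 2))

/-- Parameters that are positive and small enough for the one-step estimates. -/
structure Small (d : ℕ) (r α β c h : ℝ) : Prop where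
  α_pos : 0 < α
  β_pos : 0 < β
  β_le : β ≤ 1
  c_pos : 0 < c
  c_le : (1 + d) * c ≤ 1
  c_le_r : (1 + d) * c ≤ r / 2
  h_pos : 0 < h
  h_le : h ≤ 1

lemma Small.c_le_one {r α β c h : ℝ} (H : Small d r α β c h) : c ≤ 1 := by
  have := H.c_le
  have := H.c_pos
  nlinarith [(Nat.cast_nonneg d : (0 : ℝ) ≤ d)]

lemma errN_nonneg (T : Targets d p) (k : Idx p) (s : State d p) : 0 ≤ errN T k s := by
  rcases k with (_ | j) | (_ | j) <;> exact norm_nonneg _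

lemma lowSum_nonneg (T : Targets d p) (k : Idx p) (s : State d p) : 0 ≤ lowSum T k s :=
  Finset.sum_nonneg fun i _ => errN_nonneg T i s

lemma lowSum_eq (T : Targets d p) (k : Idx p) (s : State d p) :
    lowSum T k s
      = (if Idx.rank (p := p) (Sum.inl none) < k.rank then errN T (Sum.inl none) s else 0)
      + ∑ i, (if Idx.rank (p := p) (Sum.inl (some i)) < k.rank
          then errN T (Sum.inl (some i)) s else 0)
      + ((if Idx.rank (p := p) (Sum.inr none) < k.rank then errN T (Sum.inr none) s else 0)
      + ∑ i, (if Idx.rank (p := p) (Sum.inr (some i)) < k.rank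
          then errN T (Sum.inr (some i)) s else 0)) := by
  rw [lowSum, Finset.sum_filter, Fintype.sum_sum_type, Fintype.sum_option, Fintype.sum_option]

lemma lowSum_inl_some (T : Targets d p) (j : Fin p) (s : State d p) :
    ∑ i with i < j, ‖s.lam i - T.lam s.θ i‖ + ‖s.ν - T.nu s.θ‖
      ≤ lowSum T (Sum.inl (some j)) s := by
  rw [lowSum_eq, Finset.sum_filter]
  simp only [Idx.rank, errN, add_lt_add_iff_left, Fin.val_fin_lt]
  have h1 : ∀ i : Fin p, ¬ p + 2 + (i : ℕ) < 2 + j := fun i => by omega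
  have h2 : 1 < 2 + (j : ℕ) := by omega
  have h3 : 0 < 2 + (j : ℕ) := by omega
  simp only [h1, h2, h3, if_true, if_false, Finset.sum_const_zero]
  linarith [norm_nonneg (s.Gν - gradient T.nu s.θ)]

lemma lowSum_inr_none (T : Targets d p) (s : State d p) :
    ‖s.ν - T.nu s.θ‖ ≤ lowSum T (Sum.inr none) s := by
  rw [lowSum_eq]
  simp [Idx.rank, errN]

lemma lowSum_inr_some (T : Targets d p) (j : Fin p) (s : State d p) :
    (∑ i, ‖s.lam i - T.lam s.θ i‖ + ‖s.ν - T.nu s.θ‖)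
      + (∑ i with i < j, ‖s.G i - lamGrad T s.θ i‖ + ‖s.Gν - gradient T.nu s.θ‖)
      ≤ lowSum T (Sum.inr (some j)) s := by
  rw [lowSum_eq, Finset.sum_filter]
  simp only [Idx.rank, errN, add_lt_add_iff_left, Fin.val_fin_lt]
  have h1 : 0 < p + 2 + (j : ℕ) := by omega
  have h2 : 1 < p + 2 + (j : ℕ) := by omega
  have h3 : ∀ i : Fin p, 2 + (i : ℕ) < p + 2 + j := fun i => by omega
  simp only [h1, h2, h3, if_true]
  linarith

/-- The Cauchy–Schwarz inequality; there are `2 p + 2` errors altogether. -/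
lemma lowSum_sq_le (T : Targets d p) (k : Idx p) (s : State d p) :
    lowSum T k s ^ 2
      ≤ (2 * p + 2) * ∑ i : Idx p with i.rank < k.rank, errN T i s ^ 2 := by
  refine (sq_sum_le_card_mul_sum_sq).trans ?_
  refine mul_le_mul_of_nonneg_right ?_ (Finset.sum_nonneg fun i _ => sq_nonneg _)
  have : (Finset.univ.filter fun i : Idx p => i.rank < k.rank).card ≤ 2 * p + 2 :=
    (Finset.card_le_univ _).trans (by simp; omega)
  exact_mod_cast this

/-- As the gradients of the targets are bounded, the gradient estimates are large only if their
errors are. -/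
lemma gsize_le_sum {C : ℝ} {s : State d p} (hν : ‖gradient T.nu s.θ‖ ≤ C)
    (hl : ∀ j, ‖lamGrad T s.θ j‖ ≤ C) :
    gsize s ≤ (2 + 2 * C ^ 2 * (1 + p)) * (1 + ∑ i, errN T i s ^ 2) := by
  have hsq : ∀ u v : Vec d, ‖v‖ ≤ C → ‖u‖ ^ 2 ≤ 2 * ‖u - v‖ ^ 2 + 2 * C ^ 2 := fun u v hv => by
    have h1 : ‖u‖ ≤ ‖u - v‖ + C := by
      calc ‖u‖ = ‖(u - v) + v‖ := by rw [sub_add_cancel]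
        _ ≤ _ := (norm_add_le _ _).trans (by gcongr)
    have h2 := pow_le_pow_left₀ (norm_nonneg u) h1 2
    nlinarith [sq_nonneg (‖u - v‖ - C)]
  rw [Fintype.sum_sum_type, Fintype.sum_option, Fintype.sum_option]
  simp only [errN]
  have a1 := hsq s.Gν _ hν
  have a2 : ∑ j, ‖s.G j‖ ^ 2 ≤ 2 * ∑ j, ‖s.G j - lamGrad T s.θ j‖ ^ 2 + p * (2 * C ^ 2) := by
    calc _ ≤ ∑ j, (2 * ‖s.G j - lamGrad T s.θ j‖ ^ 2 + 2 * C ^ 2) :=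
          Finset.sum_le_sum fun j _ => hsq _ _ (hl j)
      _ = _ := by rw [Finset.sum_add_distrib, ← Finset.mul_sum]; simp
  have b1 : 0 ≤ ∑ j, ‖s.lam j - T.lam s.θ j‖ ^ 2 := Finset.sum_nonneg fun j _ => sq_nonneg _
  have b2 : 0 ≤ ∑ j, ‖s.G j - lamGrad T s.θ j‖ ^ 2 := Finset.sum_nonneg fun j _ => sq_nonneg _
  have b3 : 0 ≤ 2 * C ^ 2 * (1 + p) := by positivity
  have b4 := sq_nonneg ‖s.ν - T.nu s.θ‖
  have b5 := sq_nonneg ‖s.Gν - gradient T.nu s.θ‖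
  rw [gsize]
  nlinarith [mul_nonneg b3 (add_nonneg (add_nonneg b4 b1) (add_nonneg b5 b2))]

/-- The constant produced by `le_stepBound`. -/
noncomputable def stepConst (p : ℕ) (a C : ℝ) : ℝ :=
  (2 / a + 2) * ((2 * C ^ 2 + C) * (2 * p + 2 + 4 * C))

lemma stepConst_nonneg (p : ℕ) {a C : ℝ} (ha : 0 < a) (hC : 0 ≤ C) : 0 ≤ stepConst p a C := by
  unfold stepConst; positivity

/-- The arithmetic of `le_stepBound`: drift, bias and variance, with squares `A g`, `ϱ² g` and
`β w g`, are collected into the squared rate `R`, and the lower errors `lo` into `L`. -/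
lemma sq_error_le {C A q lo L R S g ϱ w β : ℝ} (hC : 0 ≤ C) (hlo : lo ^ 2 ≤ q * L) (hL : 0 ≤ L)
    (hg : g ≤ C * (1 + S)) (hg0 : 0 ≤ g) (hS : 0 ≤ S) (hq : 0 ≤ q)
    (hR : A + ϱ ^ 2 + β * w ≤ 4 * R) (hA : 0 ≤ A) (hβw : 0 ≤ β * w) :
    C ^ 2 * (A * g) + (C * (lo + ϱ * √g)) ^ 2 + β * (C * (w * g))
      ≤ (2 * C ^ 2 + C) * (q + 4 * C) * (L + R * (1 + S)) := by
  have hsg : (ϱ * √g) ^ 2 = ϱ ^ 2 * g := by rw [mul_pow, Real.sq_sqrt hg0]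
  have hC2 : 0 ≤ C ^ 2 := sq_nonneg C
  have hR0 : 0 ≤ R := by linarith [sq_nonneg ϱ]
  have e2 : (lo + ϱ * √g) ^ 2 ≤ 2 * (lo ^ 2 + ϱ ^ 2 * g) := by
    rw [← hsg]
    linarith [sq_nonneg (lo - ϱ * √g), add_sq lo (ϱ * √g), sub_sq lo (ϱ * √g)]
  have e3 : (A + ϱ ^ 2 + β * w) * g ≤ 4 * C * (R * (1 + S)) := by
    calc _ ≤ 4 * R * (C * (1 + S)) := by gcongr
      _ = _ := by ring
  have k1 : 0 ≤ A * g := by positivity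
  have k2 : 0 ≤ ϱ ^ 2 * g := by positivity
  have k3 : 0 ≤ β * w * g := by positivity
  have k4 : 0 ≤ lo ^ 2 := sq_nonneg _
  have k5 : 0 ≤ R * (1 + S) := by positivity
  calc C ^ 2 * (A * g) + (C * (lo + ϱ * √g)) ^ 2 + β * (C * (w * g))
      ≤ C ^ 2 * (A * g) + C ^ 2 * (2 * (lo ^ 2 + ϱ ^ 2 * g)) + C * (β * w * g) := by
        rw [mul_pow]
        linarith [mul_le_mul_of_nonneg_left e2 hC2]
    _ ≤ (2 * C ^ 2 + C) * (lo ^ 2 + (A + ϱ ^ 2 + β * w) * g) := by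
        linarith [mul_nonneg hC2 k1, mul_nonneg hC2 k3, mul_nonneg hC k4, mul_nonneg hC k1,
          mul_nonneg hC k2]
    _ ≤ (2 * C ^ 2 + C) * (q * L + 4 * C * (R * (1 + S))) := by gcongr
    _ ≤ (2 * C ^ 2 + C) * ((q + 4 * C) * (L + R * (1 + S))) := by
        refine mul_le_mul_of_nonneg_left ?_ (by positivity)
        linarith [mul_nonneg hC hL, mul_nonneg hq k5]
    _ = _ := by ring

/-- From mean and second moment of the increment to the bound on the next squared error. -/
lemma le_stepBound {E Y : Type*} [NormedAddCommGroup E] [InnerProductSpace ℝ E] [CompleteSpace E]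
    [MeasurableSpace Y] {ρ : Measure Y} [IsProbabilityMeasure ρ] {U : Y → E}
    (hU : AEStronglyMeasurable U ρ) (hU2 : Integrable (fun y => ‖U y‖ ^ 2) ρ)
    {k : Idx p} {s : State d p} {a C₁ C₂ C₃ α β c h r w ϱ : ℝ} (ha : 0 < a)
    (hC₁ : 0 ≤ C₁) (hC₂ : 0 ≤ C₂) (hC₃ : 0 ≤ C₃) (H : Small d r α β c h) (hw : 0 ≤ w) (hϱ : 0 ≤ ϱ)
    (hW : ∫ y, ‖U y‖ ^ 2 ∂ρ ≤ C₁ * (w * gsize s)) {x b : E} (hx : ‖x‖ = errN T k s)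
    (hin : inner ℝ x (∫ y, U y ∂ρ) ≤ -a * ‖x‖ ^ 2
      + ‖x‖ * (C₂ * (lowSum T k s + ϱ * √(gsize s))))
    (hb : ‖b‖ ≤ C₃ * (α * √(gsize s)))
    (hg : gsize s ≤ C₃ * (1 + ∑ i, errN T i s ^ 2))
    (hR : (α / β) ^ 2 + ϱ ^ 2 + β * w ≤ 4 * rateOf k α β c h) :
    Integrable (fun y => ‖x + β • U y - b‖ ^ 2) ρ ∧ ∫ y, ‖x + β • U y - b‖ ^ 2 ∂ρ
      ≤ stepBound T k a (stepConst p a (C₁ + C₂ + C₃)) α β c h s := by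
  have hβ := H.β_pos
  have hα := H.α_pos
  have hg1 := one_le_gsize s
  have hlo0 := lowSum_nonneg T k s
  have hS1 : 0 ≤ ∑ i, errN T i s ^ 2 := Finset.sum_nonneg fun i _ => sq_nonneg _
  unfold stepConst
  set C := C₁ + C₂ + C₃ with hCdef
  have hC : 0 ≤ C := by positivity
  replace hW := hW.trans (mul_le_mul_of_nonneg_right (by linarith : C₁ ≤ C) (by positivity))
  replace hin := hin.trans (add_le_add_right (mul_le_mul_of_nonneg_left
    (mul_le_mul_of_nonneg_right (by linarith : C₂ ≤ C) (by positivity)) (norm_nonneg x)) _)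
  replace hb := hb.trans (mul_le_mul_of_nonneg_right (by linarith : C₃ ≤ C) (by positivity))
  replace hg := hg.trans (mul_le_mul_of_nonneg_right (by linarith : C₃ ≤ C) (by positivity))
  obtain ⟨h1, h2⟩ := integral_norm_sq_step_le hU hU2 ha hβ H.β_le hW hin hb
  refine ⟨h1, h2.trans ?_⟩
  have hsg : √(gsize s) ^ 2 = gsize s := Real.sq_sqrt (by linarith)
  rw [stepBound, hx, add_le_add_iff_left, mul_assoc (2 / a + 2), mul_assoc (2 / a + 2),
    mul_assoc (2 / a + 2)]
  refine mul_le_mul_of_nonneg_left ?_ (by positivity)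
  rw [mul_comm β, mul_right_comm]
  refine mul_le_mul_of_nonneg_right ?_ hβ.le
  have e1 : (C * (α * √(gsize s))) ^ 2 / β ^ 2 = C ^ 2 * ((α / β) ^ 2 * gsize s) := by
    rw [div_pow, mul_pow, mul_pow, hsg]; ring
  rw [e1]
  exact sq_error_le hC (lowSum_sq_le T k s) (Finset.sum_nonneg fun i _ => sq_nonneg _) hg
    (by linarith) hS1 (by positivity) hR (sq_nonneg _) (by positivity)

end OneStep

/-! ### The four error recursions -/

section Recursions

variable {d p : ℕ} {Ξ Ω : Type*} [MeasurableSpace Ξ] [MeasurableSpace Ω]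
  {P : Problem d p Ξ} {T : Targets d p} {K : ℝ → ℝ} {A : Params} {Pr : Measure Ω}
  {s : ℕ → Ω → State d p} {Δ : ℕ → Ω → Vec d}
  {N : Set (Vec d)} {Xε : Set ℝ} {Λε : Set (Fin p → ℝ)} {θs : Vec d}

lemma Small.rate_inl_none {r α β c h : ℝ} (H : Small d r α β c h) :
    (α / β) ^ 2 + (0 : ℝ) ^ 2 + β * 1 ≤ 4 * rateOf (Sum.inl none : Idx p) α β c h := by
  have hβ := H.β_pos
  have hc := H.c_pos
  have h1 : β ≤ β / c ^ 2 := by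
    rw [le_div_iff₀ (by positivity)]
    exact mul_le_of_le_one_right hβ.le (pow_le_one₀ hc.le H.c_le_one)
  have h2 : 0 ≤ (α / β) ^ 2 := sq_nonneg _
  have h3 : 0 ≤ c ^ 4 := by positivity
  simp only [rateOf, rateν]
  linarith

lemma Small.rate_inl_some {r α β c h : ℝ} (H : Small d r α β c h) (j : Fin p) :
    (α / β) ^ 2 + (h ^ 2) ^ 2 + β * (1 / h) ≤ 4 * rateOf (Sum.inl (some j)) α β c h := by
  have hβ := H.β_pos
  have hc := H.c_pos
  have hh := H.h_pos
  have h1 : β * (1 / h) ≤ β / (c * h) ^ 2 := by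
    rw [mul_one_div]
    refine div_le_div_of_nonneg_left hβ.le (by positivity) ?_
    rw [mul_pow]
    have : c ^ 2 ≤ 1 := pow_le_one₀ hc.le H.c_le_one
    have : h ^ 2 ≤ h := by nlinarith [H.h_le]
    nlinarith [sq_nonneg h]
  have h2 : 0 ≤ (α / β) ^ 2 := sq_nonneg _
  have h3 : 0 ≤ c ^ 4 := by positivity
  have h4 : 0 ≤ h ^ 4 := by positivity
  have h5 : 0 ≤ β / (c * h) ^ 2 := by positivity
  simp only [rateOf, rate]
  nlinarith

lemma Small.rate_inr_none {r α β c h : ℝ} (H : Small d r α β c h) :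
    (α / β) ^ 2 + (c ^ 2) ^ 2 + β * (1 / c ^ 2)
      ≤ 4 * rateOf (Sum.inr none : Idx p) α β c h := by
  have hβ := H.β_pos
  have hc := H.c_pos
  have h2 : 0 ≤ (α / β) ^ 2 := sq_nonneg _
  have h3 : 0 ≤ c ^ 4 := by positivity
  have h5 : 0 ≤ β / c ^ 2 := by positivity
  simp only [rateOf, rateν, mul_one_div]
  nlinarith

lemma Small.rate_inr_some {r α β c h : ℝ} (H : Small d r α β c h) (j : Fin p) :
    (α / β) ^ 2 + (c ^ 2 + h ^ 2) ^ 2 + β * (1 / (c * h) ^ 2)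
      ≤ 4 * rateOf (Sum.inr (some j)) α β c h := by
  have hβ := H.β_pos
  have hc := H.c_pos
  have hh := H.h_pos
  have h2 : 0 ≤ (α / β) ^ 2 := sq_nonneg _
  have h5 : 0 ≤ β / (c * h) ^ 2 := by positivity
  simp only [rateOf, rate, mul_one_div]
  nlinarith [sq_nonneg (c ^ 2 - h ^ 2), sq_nonneg (c ^ 2), sq_nonneg (h ^ 2)]

/-- What is used about the current state: it and its perturbations lie in the neighborhood, with
room `r` in the second coordinate, and `θ` is feasible. -/
structure IsAdmissible (P : Problem d p Ξ) (N : Set (Vec d)) (Xε : Set ℝ) (Λε : Set (Fin p → ℝ))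
    (D : Measure (Vec d)) (r c : ℝ) (s : State d p) : Prop extends IsGood N Xε Λε D c s where
  ball_subset : Metric.ball s.ν r ⊆ Xε
  feasible : s.θ ∈ P.feasible

namespace Regularity

lemma convex_Z (h1 : Regularity P T Pr A s Δ N Xε Λε) : Convex ℝ (N ×ˢ Λε ×ˢ Xε) :=
  h1.convex_N.prod (h1.convex_Λ.prod h1.convex_X)

lemma target_mem (h1 : Regularity P T Pr A s Δ N Xε Λε) {θ : Vec d} (hθ : θ ∈ P.feasible)
    (hN : θ ∈ N) : T.pt θ ∈ N ×ˢ Λε ×ˢ Xε :=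
  ⟨hN, (h1.nhd_target θ ⟨hθ, hN⟩).2, (h1.nhd_target θ ⟨hθ, hN⟩).1⟩

lemma differentiableAt_qz (h1 : Regularity P T Pr A s Δ N Xε Λε) {z}
    (hz : z ∈ N ×ˢ Λε ×ˢ Xε) : DifferentiableAt ℝ (qz P) z :=
  h1.qz_smooth.differentiableAt (h1.open_N.prod (isOpen_univ.prod h1.open_X))
    ⟨hz.1, trivial, hz.2.2⟩

lemma differentiableAt_mz (h1 : Regularity P T Pr A s Δ N Xε Λε) (j : Fin p) {z}
    (hz : z ∈ N ×ˢ Λε ×ˢ Xε) : DifferentiableAt ℝ (mz T j) z :=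
  (h1.m_smooth j).differentiableAt (h1.open_N.prod (h1.open_Λ.prod isOpen_univ))
    ⟨hz.1, hz.2.1, trivial⟩

lemma exists_lipschitz_mz (h1 : Regularity P T Pr A s Δ N Xε Λε) (j : Fin p) :
    ∃ M, 0 ≤ M ∧ (∀ z ∈ N ×ˢ Λε ×ˢ Xε, ‖fderiv ℝ (mz T j) z‖ ≤ M) ∧
      ∀ z ∈ N ×ˢ Λε ×ˢ Xε, ∀ z' ∈ N ×ˢ Λε ×ˢ Xε,
        ‖fderiv ℝ (mz T j) z - fderiv ℝ (mz T j) z'‖ ≤ M * ‖z - z'‖ := by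
  obtain ⟨M, hM0, hM1, -, hM2⟩ := (h1.m_smooth j).exists_lipschitz
    (h1.open_N.prod (h1.open_Λ.prod isOpen_univ)) (h1.convex_N.prod (h1.convex_Λ.prod convex_univ))
  exact ⟨M, hM0, fun z hz => hM1 z ⟨hz.1, hz.2.1, trivial⟩, fun z hz z' hz' =>
    hM2 z ⟨hz.1, hz.2.1, trivial⟩ z' ⟨hz'.1, hz'.2.1, trivial⟩⟩

lemma norm_pt_sub_le (t : State d p) : ‖t.pt - T.pt t.θ‖
    ≤ ∑ i, ‖t.lam i - T.lam t.θ i‖ + ‖t.ν - T.nu t.θ‖ := by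
  have h0 : 0 ≤ ∑ i, ‖t.lam i - T.lam t.θ i‖ := Finset.sum_nonneg fun _ _ => norm_nonneg _
  have h1 := norm_nonneg (t.ν - T.nu t.θ)
  refine max_le ?_ (max_le ?_ ?_)
  · simp only [State.pt, Targets.pt, Prod.fst_sub, sub_self, norm_zero]
    positivity
  · refine ((pi_norm_le_iff_of_nonneg (by positivity)).2 fun i => ?_)
    have := Finset.single_le_sum (f := fun i => ‖t.lam i - T.lam t.θ i‖)
      (fun _ _ => norm_nonneg _) (Finset.mem_univ i)
    exact this.trans (by linarith)
  · exact le_add_of_nonneg_left h0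

/-- The targets move by at most a multiple of `α √gsize` in one step, as the search direction is
bounded by a multiple of `√gsize` and projecting does not increase the distance. -/
lemma exists_target_drift (h1 : Regularity P T Pr A s Δ N Xε Λε) (h5 : RateCond P T Pr A s N θs)
    (hP : P.Standing) :
    ∃ C, 0 ≤ C ∧ ∀ t : State d p, t.θ ∈ P.feasible →
      gsize t ≤ C * (1 + ∑ i, errN T i t ^ 2) ∧ ‖gradient T.nu t.θ‖ ≤ C ∧
      (∀ j, ‖lamGrad T t.θ j‖ ≤ C) ∧ ∀ α, 0 < α →
      ‖T.nu (nextθ P α t) - T.nu t.θ‖ ≤ C * (α * √(gsize t)) ∧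
      ‖gradient T.nu (nextθ P α t) - gradient T.nu t.θ‖ ≤ C * (α * √(gsize t)) ∧
      ∀ j, ‖T.lam (nextθ P α t) j - T.lam t.θ j‖ ≤ C * (α * √(gsize t)) ∧
        ‖lamGrad T (nextθ P α t) j - lamGrad T t.θ j‖ ≤ C * (α * √(gsize t)) := by
  obtain ⟨Ct, hCt0, hCt⟩ := h5.exists_target_bound hP
  obtain ⟨Cg, hCg⟩ := h1.g_bounded
  have hCg0 : 0 ≤ Cg := (norm_nonneg _).trans (hCg 0)
  have e0 : 0 ≤ 2 + 2 * Ct ^ 2 * (1 + p) := by positivity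
  have e1 : 0 ≤ Ct * (Cg * (1 + p)) := by positivity
  refine ⟨2 + 2 * Ct ^ 2 * (1 + p) + Ct + Ct * (Cg * (1 + p)), by positivity, fun t ht => ?_⟩
  obtain ⟨⟨b1, b2⟩, b3⟩ := hCt _ ht
  have hS : 0 ≤ ∑ i, errN T i t ^ 2 := Finset.sum_nonneg fun i _ => sq_nonneg _
  refine ⟨(gsize_le_sum b1 b2).trans
    (mul_le_mul_of_nonneg_right (by linarith) (by positivity)), by linarith,
    fun j => (b2 j).trans (by linarith), fun α hα => ?_⟩
  obtain ⟨c1, c2, c3⟩ := b3 _ (nextθ_mem hP ⟨_, ht⟩ α t)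
  have hle : Ct * ‖nextθ P α t - t.θ‖
      ≤ (2 + 2 * Ct ^ 2 * (1 + p) + Ct + Ct * (Cg * (1 + p))) * (α * √(gsize t)) := by
    have := norm_nextθ_sub_le hP h1.g_smooth hCg hα.le ht
    calc _ ≤ Ct * (Cg * (1 + p) * (α * √(gsize t))) := by gcongr
      _ = Ct * (Cg * (1 + p)) * (α * √(gsize t)) := by ring
      _ ≤ _ := by gcongr; linarith
  exact ⟨c1.trans hle, c2.trans hle, fun j => ⟨(c3 j).1.trans hle, (c3 j).2.trans hle⟩⟩

/-- The recursion for the error of `ν`. By the mean value theorem, the mean increment `q̄` is a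
derivative, at most `-ε`, times the error. -/
lemma step_inl_none (h1 : Regularity P T Pr A s Δ N Xε Λε) (h5 : RateCond P T Pr A s N θs)
    (hP : P.Standing) :
    ∃ a C, 0 < a ∧ 0 ≤ C ∧ ∀ D r α β c h, Small d r α β c h →
      ∀ t : State d p, IsAdmissible P N Xε Λε D r c t →
      Integrable (fun y => ‖t.ν + β * qUpd P t y - T.nu (nextθ P α t)‖ ^ 2) P.μ ∧
      ∫ y, ‖t.ν + β * qUpd P t y - T.nu (nextθ P α t)‖ ^ 2 ∂P.μ
        ≤ stepBound T (Sum.inl none) a C α β c h t := by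
  have := hP.prob
  obtain ⟨C₁, hC₁, hq⟩ := h1.qUpd_moments
  obtain ⟨ε, hε, hdε⟩ := h1.q_deriv
  obtain ⟨C₃, hC₃, hC⟩ := h1.exists_target_drift h5 hP
  refine ⟨ε, _, hε, stepConst_nonneg p hε (by positivity : 0 ≤ C₁ + 0 + C₃),
    fun D r α β c h H t ht => ?_⟩
  obtain ⟨hg, -, -, hmove⟩ := hC t ht.feasible
  obtain ⟨m1, m2, m3⟩ := hq t ht.mem_pt
  have hmeas : AEStronglyMeasurable (qUpd P t) P.μ :=
    ((measurable_qUpd hP).comp (measurable_const.prodMk measurable_id)).aestronglyMeasurable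
  have e : ∀ y, t.ν + β * qUpd P t y - T.nu (nextθ P α t)
      = t.ν - T.nu t.θ + β • qUpd P t y - (T.nu (nextθ P α t) - T.nu t.θ) := fun y => by
    rw [smul_eq_mul]; ring
  simp only [e]
  refine le_stepBound hmeas m1 hε hC₁ le_rfl hC₃ H zero_le_one le_rfl (m2.trans ?_) rfl ?_
    (hmove α H.α_pos).1 hg H.rate_inl_none
  · rw [one_mul]
    exact le_mul_of_one_le_right hC₁ (one_le_gsize t)
  · obtain ⟨z, hz, e⟩ := exists_fderiv_eq_of_zero h1.convex_Z
      (fun z hz => h1.differentiableAt_qz hz) (h1.target_mem ht.feasible ht.mem_pt.1) ht.mem_pt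
      (h1.describes.nu_root t.θ (Or.inl ht.feasible))
    have e2 : t.pt - T.pt t.θ = (0, t.lam - T.lam t.θ, t.ν - T.nu t.θ) := by
      simp [State.pt, Targets.pt]
    have hz' := h1.differentiableAt_qz hz
    rw [m3, e, e2, clm_apply_eq]
    simp only [fderiv_qz_single _ hz', mul_zero, Finset.sum_const_zero]
    have h0 : fderiv ℝ (qz P) z (0, 0, 0) = 0 := map_zero _
    have hd := hdε z.1 hz.1 z.2.2 hz.2.2
    rw [← fderiv_qz_last hz'] at hd
    rw [h0, real_inner_comm]
    simp only [RCLike.inner_apply, conj_trivial, Real.norm_eq_abs, sq_abs, zero_add, zero_mul,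
      mul_zero, add_zero]
    nlinarith [sq_nonneg (t.ν - T.nu t.θ)]

/-- The recursion for the error of `λ_j`. By the mean value theorem, `m̄_j` is a triangular linear
form in the errors of `λ_1, …, λ_j` and `ν`; the density is a factor bounded from both sides. -/
lemma step_inl_some [IsProbabilityMeasure Pr] (h1 : Regularity P T Pr A s Δ N Xε Λε)
    (h5 : RateCond P T Pr A s N θs) (hP : P.Standing) (hK : KernelCond K) {r : ℝ} (hr : 0 < r)
    (j : Fin p) :
    ∃ a C, 0 < a ∧ 0 ≤ C ∧ ∀ D α β c h, Small d r α β c h →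
      ∀ t : State d p, IsAdmissible P N Xε Λε D r c t →
      Integrable (fun y => ‖t.lam j + β * mUpd P K h j t y - T.lam (nextθ P α t) j‖ ^ 2) P.μ ∧
      ∫ y, ‖t.lam j + β * mUpd P K h j t y - T.lam (nextθ P α t) j‖ ^ 2 ∂P.μ
        ≤ stepBound T (Sum.inl (some j)) a C α β c h t := by
  have := hP.prob
  obtain ⟨C₁, hC₁, hm⟩ := h1.mUpd_moments hP hK hr
  obtain ⟨ε, hε, hdε⟩ := h1.m_deriv
  obtain ⟨f₀, hf₀, hf⟩ := h1.f_lower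
  obtain ⟨F, hF0, hF⟩ := h1.exists_f_le hP
  obtain ⟨M, hM0, hM, -⟩ := h1.exists_lipschitz_mz j
  obtain ⟨C₃, hC₃, hC⟩ := h1.exists_target_drift h5 hP
  have ha : 0 < f₀ * ε := by positivity
  refine ⟨f₀ * ε, _, ha, stepConst_nonneg p ha (by positivity : 0 ≤ C₁ + (F * M + C₁) + C₃),
    fun D α β c h H t ht => ?_⟩
  obtain ⟨hg, -, -, hmove⟩ := hC t ht.feasible
  have m1 := h1.mUpd_integrable hP hK H.h_pos j ht.mem_pt
  obtain ⟨m2, m3⟩ := hm j h H.h_pos H.h_le t ht.mem_pt ht.ball_subset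
  have hmeas : AEStronglyMeasurable (mUpd P K h j t) P.μ :=
    ((measurable_mUpd hP hK h j).comp (measurable_const.prodMk measurable_id)).aestronglyMeasurable
  have e : ∀ y, t.lam j + β * mUpd P K h j t y - T.lam (nextθ P α t) j
      = t.lam j - T.lam t.θ j + β • mUpd P K h j t y
        - (T.lam (nextθ P α t) j - T.lam t.θ j) := fun y => by
    rw [smul_eq_mul]; ring
  have hh := H.h_pos
  simp only [e]
  refine le_stepBound hmeas m1 ha hC₁ (by positivity) hC₃ H (w := 1 / h) (by positivity)
    (sq_nonneg h) (m2.trans ?_) rfl ?_ ((hmove α H.α_pos).2.2 j).1 hg (H.rate_inl_some j)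
  · rw [div_eq_mul_one_div]
    exact mul_le_mul_of_nonneg_left (le_mul_of_one_le_right (by positivity) (one_le_gsize t)) hC₁
  · obtain ⟨z, hz, e⟩ := exists_fderiv_eq_of_zero h1.convex_Z
      (fun z hz => h1.differentiableAt_mz j hz) (h1.target_mem ht.feasible ht.mem_pt.1) ht.mem_pt
      (h1.describes.lam_root t.θ (Or.inl ht.feasible) j)
    have e2 : t.pt - T.pt t.θ = (0, fun i => t.lam i - T.lam t.θ i, t.ν - T.nu t.θ) := by
      simp only [State.pt, Targets.pt, Prod.mk_sub_mk, sub_self]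
      rfl
    have hz' := h1.differentiableAt_mz j hz
    have hd := hdε j z.1 hz.1 z.2.2 hz.2.2 z.2.1 hz.2.1
    rw [← fderiv_mz_single_self hz'] at hd
    have tri := inner_triangular_le (fderiv ℝ (mz T j) z) hε.le
      (fun i hi => fderiv_mz_single_of_lt hi hz') hd (hM z hz) hf₀.le
      (hf t.ν ht.mem_pt.2.2 t.θ ht.mem_pt.1) ((le_abs_self _).trans (hF t.θ ht.mem_pt.1 t.ν))
      (fun i => t.lam i - T.lam t.θ i) (t.ν - T.nu t.θ)
    have e3 : mz T j t.pt * fz T t.pt = T.f t.ν t.θ • (∑ i, fderiv ℝ (mz T j) z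
        (0, Pi.single i 1, 0) • (t.lam i - T.lam t.θ i)
        + fderiv ℝ (mz T j) z (0, 0, 1) • (t.ν - T.nu t.θ)) := by
      have h0 : fderiv ℝ (mz T j) z (0, 0, 0) = 0 := map_zero _
      rw [e, e2, clm_apply_eq, h0, zero_add, mul_comm, smul_eq_mul]
      simp only [smul_eq_mul, mul_comm]
      rfl
    rw [← e3] at tri
    have hlo := lowSum_inl_some T j t
    have hFM : 0 ≤ F * M := by positivity
    have h4 : inner ℝ (t.lam j - T.lam t.θ j)
        (∫ y, mUpd P K h j t y ∂P.μ - mz T j t.pt * fz T t.pt)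
        ≤ ‖t.lam j - T.lam t.θ j‖ * (C₁ * h ^ 2) :=
      (real_inner_le_norm _ _).trans (mul_le_mul_of_nonneg_left m3 (norm_nonneg _))
    rw [inner_sub_right] at h4
    have hsg := one_le_sqrt_gsize t
    have hl0 := lowSum_nonneg T (Sum.inl (some j)) t
    have h5 : F * M * (∑ i with i < j, ‖t.lam i - T.lam t.θ i‖ + ‖t.ν - T.nu t.θ‖) + C₁ * h ^ 2
        ≤ (F * M + C₁) * (lowSum T (Sum.inl (some j)) t + h ^ 2 * √(gsize t)) := by
      have q1 := mul_le_mul_of_nonneg_left hlo hFM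
      have q2 : C₁ * h ^ 2 ≤ C₁ * (h ^ 2 * √(gsize t)) :=
        mul_le_mul_of_nonneg_left (le_mul_of_one_le_right (sq_nonneg h) hsg) hC₁
      have q3 : 0 ≤ F * M * (h ^ 2 * √(gsize t)) := by positivity
      have q4 : 0 ≤ C₁ * lowSum T (Sum.inl (some j)) t := by positivity
      linarith
    have h6 := mul_le_mul_of_nonneg_left h5 (norm_nonneg (t.lam j - T.lam t.θ j))
    linarith

/-- A mean `m` splits into a contracting part `u`, up to lower errors, and two error terms. -/
lemma inner_add_error_le {E : Type*} [NormedAddCommGroup E] [InnerProductSpace ℝ E] {x m u v w : E}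
    {a e₁ e₂ e₃ : ℝ} (hm : m = u + v + w) (hu : inner ℝ x u ≤ -a * ‖x‖ ^ 2 + ‖x‖ * e₁)
    (hv : ‖v‖ ≤ e₂) (hw : ‖w‖ ≤ e₃) :
    inner ℝ x m ≤ -a * ‖x‖ ^ 2 + ‖x‖ * (e₁ + e₂ + e₃) := by
  have h2 := (real_inner_le_norm x v).trans (mul_le_mul_of_nonneg_left hv (norm_nonneg x))
  have h3 := (real_inner_le_norm x w).trans (mul_le_mul_of_nonneg_left hw (norm_nonneg x))
  rw [hm, inner_add_right, inner_add_right]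
  linarith

/-- `q̄` does not depend on `λ`. -/
lemma fderiv_qz_congr (z : Vec d × (Fin p → ℝ) × ℝ) (l : Fin p → ℝ) :
    fderiv ℝ (qz P) z = fderiv ℝ (qz P) (z.1, l, z.2.2) := by
  have e : (fun x : Vec d × (Fin p → ℝ) × ℝ => qz P (x + (0, l - z.2.1, 0))) = qz P := by
    ext x; simp [qz]
  have h := fderiv_comp_add_right (𝕜 := ℝ) (f := qz P) (x := z) (0, l - z.2.1, 0)
  rw [e] at h
  rw [h]
  congr 1
  refine Prod.ext ?_ (Prod.ext ?_ ?_) <;> simp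

/-- The recursion for the error of `G_ν`. The mean increment is `chainGrad` of the derivative of
`q̄` at the current point, which vanishes when both point and gradients are replaced by the targets.
It is split into the change of the gradients (`u`), the change of the derivative (`v`, of the order
of the error of `ν`) and the bias of the symmetric difference (`w`). -/
lemma step_inr_none (h1 : Regularity P T Pr A s Δ N Xε Λε) (h5 : RateCond P T Pr A s N θs)
    (hP : P.Standing) :
    ∃ a C, 0 < a ∧ 0 ≤ C ∧ ∀ D, IsRademacher D → ∀ r α β c h, Small d r α β c h →
      ∀ t : State d p, IsAdmissible P N Xε Λε D r c t →
      Integrable (fun z : Vec d × Ξ × Ξ =>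
        ‖t.Gν + β • spQuot (qDiff P c (t, z.1) z.2) (cbar c t) z.1
        - gradient T.nu (nextθ P α t)‖ ^ 2) (D.prod (P.μ.prod P.μ)) ∧
      ∫ z, ‖t.Gν + β • spQuot (qDiff P c (t, z.1) z.2) (cbar c t) z.1
        - gradient T.nu (nextθ P α t)‖ ^ 2 ∂(D.prod (P.μ.prod P.μ))
        ≤ stepBound T (Sum.inr none) a C α β c h t := by
  have := hP.prob
  obtain ⟨C₁, hC₁, hq⟩ := h1.qDiff_moments hP
  obtain ⟨ε, hε, hdε⟩ := h1.q_deriv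
  obtain ⟨C₃, hC₃, hC⟩ := h1.exists_target_drift h5 hP
  obtain ⟨M, hM0, -, -, hM⟩ := h1.qz_smooth.exists_lipschitz
    (h1.open_N.prod (isOpen_univ.prod h1.open_X)) (h1.convex_N.prod (convex_univ.prod h1.convex_X))
  refine ⟨ε, _, hε, stepConst_nonneg p hε
    (by positivity : 0 ≤ C₁ + (M * (1 + C₃ + p * C₃) + C₁) + C₃),
    fun D hD r α β c h H t ht => ?_⟩
  have := hD.prob
  obtain ⟨hg, hn, hl, hmove⟩ := hC t ht.feasible
  obtain ⟨m0, m1, m2, m3⟩ := hq D hD c H.c_pos t ht.toIsGood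
  have e : ∀ z : Vec d × Ξ × Ξ, t.Gν + β • spQuot (qDiff P c (t, z.1) z.2) (cbar c t) z.1
        - gradient T.nu (nextθ P α t)
      = t.Gν - gradient T.nu t.θ + β • spQuot (qDiff P c (t, z.1) z.2) (cbar c t) z.1
        - (gradient T.nu (nextθ P α t) - gradient T.nu t.θ) := fun z => by abel
  have hc := H.c_pos
  simp only [e]
  refine le_stepBound m0.aestronglyMeasurable m1 hε hC₁ (by positivity) hC₃ H (w := 1 / c ^ 2)
    (by positivity) (sq_nonneg c) (m2.trans ?_) rfl ?_ (hmove α H.α_pos).2.1 hg H.rate_inr_none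
  · rw [one_div_mul_eq_div]
  · have hθN : t.θ ∈ N := ht.mem_pt.1
    have hT := h1.target_mem ht.feasible hθN
    have h0 := h5.chainGrad_target_eq_zero h1.open_N (F := qz P)
      (fun θ hθ => h1.describes.nu_root θ (Or.inr hθ)) hθN (h1.differentiableAt_qz hT)
    have hz' := h1.differentiableAt_qz ht.mem_pt
    have hd := hdε t.θ ht.mem_pt.1 t.ν ht.mem_pt.2.2
    set L := fderiv ℝ (qz P) t.pt with hL
    set L' := fderiv ℝ (qz P) (T.pt t.θ) with hL'
    have hLL : ‖L - L'‖ ≤ M * ‖t.ν - T.nu t.θ‖ := by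
      rw [hL, fderiv_qz_congr t.pt (T.lam t.θ)]
      refine (hM (t.pt.1, T.lam t.θ, t.pt.2.2) ⟨ht.mem_pt.1, trivial, ht.mem_pt.2.2⟩ _
        ⟨hT.1, trivial, hT.2.2⟩).trans ?_
      refine mul_le_mul_of_nonneg_left (le_of_eq ?_) hM0
      simp [State.pt, Targets.pt]
    have hlo := lowSum_inr_none T t
    have key := inner_add_error_le (x := t.Gν - gradient T.nu t.θ) (a := ε) (e₁ := 0)
      (m := ∫ z, spQuot (qDiff P c (t, z.1) z.2) (cbar c t) z.1 ∂(D.prod (P.μ.prod P.μ)))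
      (u := chainGrad L t.G t.Gν - chainGrad L (lamGrad T t.θ) (gradient T.nu t.θ))
      (v := chainGrad L (lamGrad T t.θ) (gradient T.nu t.θ)
        - chainGrad L' (lamGrad T t.θ) (gradient T.nu t.θ))
      (w := ∫ z, spQuot (qDiff P c (t, z.1) z.2) (cbar c t) z.1 ∂(D.prod (P.μ.prod P.μ))
        - chainGrad L t.G t.Gν)
      (by rw [h0]; abel) ?_ (norm_chainGrad_sub_le L L' hn hl) m3
    · refine key.trans (add_le_add_right (mul_le_mul_of_nonneg_left ?_ (norm_nonneg _)) _)
      have q1 : ‖L - L'‖ * (1 + C₃ + p * C₃)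
          ≤ M * (1 + C₃ + p * C₃) * lowSum T (Sum.inr none) t := by
        calc _ ≤ M * lowSum T (Sum.inr none) t * (1 + C₃ + p * C₃) := by
              gcongr
              exact hLL.trans (by gcongr)
          _ = _ := by ring
      have q2 : 0 ≤ C₁ * lowSum T (Sum.inr none) t := mul_nonneg hC₁ (lowSum_nonneg T _ t)
      have q3 : 0 ≤ M * (1 + C₃ + p * C₃) * (c ^ 2 * √(gsize t)) := by positivity
      linarith
    · rw [chainGrad_sub]
      have hs : ∀ i, L (0, Pi.single i 1, 0) = 0 := fun i => fderiv_qz_single i hz'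
      have hl' : L (0, 0, 1) ≤ -ε := (fderiv_qz_last hz').trans_le hd
      simp only [hs, zero_smul, Finset.sum_const_zero, zero_add, mul_zero, add_zero]
      rw [inner_smul_right, real_inner_self_eq_norm_sq]
      exact mul_le_mul_of_nonneg_right hl' (sq_nonneg _)

/-- The recursion for the error of `G_j`, with the same decomposition as for `G_ν`; the change of
the gradients now enters through a triangular linear form. -/
lemma step_inr_some [IsProbabilityMeasure Pr] (h1 : Regularity P T Pr A s Δ N Xε Λε)
    (h5 : RateCond P T Pr A s N θs) (hP : P.Standing) (hK : KernelCond K) {r : ℝ} (hr : 0 < r)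
    (j : Fin p) :
    ∃ a C, 0 < a ∧ 0 ≤ C ∧ ∀ D, IsRademacher D → ∀ α β c h, Small d r α β c h →
      ∀ t : State d p, IsAdmissible P N Xε Λε D r c t →
      Integrable (fun z : Vec d × Ξ × Ξ => ‖t.G j
        + β • spQuot (mDiff P K c h j (t, z.1) z.2) (cbar c t) z.1
        - lamGrad T (nextθ P α t) j‖ ^ 2) (D.prod (P.μ.prod P.μ)) ∧
      ∫ z, ‖t.G j + β • spQuot (mDiff P K c h j (t, z.1) z.2) (cbar c t) z.1
        - lamGrad T (nextθ P α t) j‖ ^ 2 ∂(D.prod (P.μ.prod P.μ))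
        ≤ stepBound T (Sum.inr (some j)) a C α β c h t := by
  have := hP.prob
  obtain ⟨C₁, hC₁, hq⟩ := h1.mDiff_moments hP hK hr
  obtain ⟨ε, hε, hdε⟩ := h1.m_deriv
  obtain ⟨f₀, hf₀, hf⟩ := h1.f_lower
  obtain ⟨F, hF0, hF⟩ := h1.exists_f_le hP
  obtain ⟨C₃, hC₃, hC⟩ := h1.exists_target_drift h5 hP
  obtain ⟨M, hM0, hM1, hM⟩ := h1.exists_lipschitz_mz j
  have ha : 0 < f₀ ^ 2 * ε := by positivity
  refine ⟨f₀ ^ 2 * ε, _, ha, stepConst_nonneg p ha (by positivity :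
      0 ≤ C₁ + (F ^ 2 * M + F ^ 2 * (M * (1 + C₃ + p * C₃)) + C₁) + C₃),
    fun D hD α β c h H t ht => ?_⟩
  have := hD.prob
  obtain ⟨hg, hn, hl, hmove⟩ := hC t ht.feasible
  obtain ⟨m0, m1, m2, m3⟩ := hq j D hD c H.c_pos H.c_le H.c_le_r h H.h_pos H.h_le t ht.toIsGood
    ht.ball_subset
  have e : ∀ z : Vec d × Ξ × Ξ, t.G j + β • spQuot (mDiff P K c h j (t, z.1) z.2) (cbar c t) z.1
        - lamGrad T (nextθ P α t) j
      = t.G j - lamGrad T t.θ j + β • spQuot (mDiff P K c h j (t, z.1) z.2) (cbar c t) z.1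
        - (lamGrad T (nextθ P α t) j - lamGrad T t.θ j) := fun z => by abel
  have hc := H.c_pos
  have hh := H.h_pos
  simp only [e]
  refine le_stepBound m0.aestronglyMeasurable m1 ha hC₁ (by positivity) hC₃ H
    (w := 1 / (c * h) ^ 2) (by positivity) (add_nonneg (sq_nonneg c) (sq_nonneg h)) (m2.trans ?_)
    rfl ?_ ((hmove α H.α_pos).2.2 j).2 hg (H.rate_inr_some j)
  · rw [one_div_mul_eq_div]
  · have hθN : t.θ ∈ N := ht.mem_pt.1
    have hT := h1.target_mem ht.feasible hθN
    have h0 := h5.chainGrad_target_eq_zero h1.open_N (F := mz T j)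
      (fun θ hθ => h1.describes.lam_root θ (Or.inr hθ) j) hθN
      (h1.differentiableAt_mz j hT)
    have hz' := h1.differentiableAt_mz j ht.mem_pt
    have hd := hdε j t.θ ht.mem_pt.1 t.ν ht.mem_pt.2.2 t.lam ht.mem_pt.2.1
    have hfl := hf t.ν ht.mem_pt.2.2 t.θ ht.mem_pt.1
    have hfu : T.f t.ν t.θ ≤ F := (le_abs_self _).trans (hF t.θ ht.mem_pt.1 t.ν)
    have hf2 : f₀ ^ 2 ≤ fz T t.pt ^ 2 := pow_le_pow_left₀ hf₀.le hfl 2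
    have hF2 : fz T t.pt ^ 2 ≤ F ^ 2 := pow_le_pow_left₀ (hf₀.le.trans hfl) hfu 2
    set L := fderiv ℝ (mz T j) t.pt with hL
    set L' := fderiv ℝ (mz T j) (T.pt t.θ) with hL'
    set φ := fz T t.pt ^ 2 with hφ
    have hφ0 : 0 ≤ φ := sq_nonneg _
    have tri := inner_triangular_le L hε.le (fun i hi => fderiv_mz_single_of_lt hi hz')
      ((fderiv_mz_single_self hz').trans_le hd) (hM1 _ ht.mem_pt) (sq_nonneg f₀) hf2 hF2
      (fun i => t.G i - lamGrad T t.θ i) (t.Gν - gradient T.nu t.θ)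
    rw [← chainGrad_sub] at tri
    set e₀ := ∑ i, ‖t.lam i - T.lam t.θ i‖ + ‖t.ν - T.nu t.θ‖ with he₀
    have hLL : ‖L - L'‖ ≤ M * e₀ :=
      (hM _ ht.mem_pt _ hT).trans (mul_le_mul_of_nonneg_left (norm_pt_sub_le t) hM0)
    have hlo := lowSum_inr_some T j t
    set e₁ := ∑ i with i < j, ‖t.G i - lamGrad T t.θ i‖ + ‖t.Gν - gradient T.nu t.θ‖ with he₁
    have he₀0 : 0 ≤ e₀ := add_nonneg (Finset.sum_nonneg fun _ _ => norm_nonneg _) (norm_nonneg _)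
    have he₁0 : 0 ≤ e₁ := add_nonneg (Finset.sum_nonneg fun _ _ => norm_nonneg _) (norm_nonneg _)
    have hv : ‖φ • (chainGrad L (lamGrad T t.θ) (gradient T.nu t.θ)
        - chainGrad L' (lamGrad T t.θ) (gradient T.nu t.θ))‖
        ≤ F ^ 2 * (M * e₀ * (1 + C₃ + p * C₃)) := by
      rw [norm_smul, Real.norm_of_nonneg hφ0]
      have := norm_chainGrad_sub_le L L' hn hl
      exact mul_le_mul hF2 (this.trans (by gcongr)) (norm_nonneg _) (sq_nonneg F)
    have key := inner_add_error_le (x := t.G j - lamGrad T t.θ j) (a := f₀ ^ 2 * ε)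
      (m := ∫ z, spQuot (mDiff P K c h j (t, z.1) z.2) (cbar c t) z.1 ∂(D.prod (P.μ.prod P.μ)))
      (w := ∫ z, spQuot (mDiff P K c h j (t, z.1) z.2) (cbar c t) z.1 ∂(D.prod (P.μ.prod P.μ))
        - φ • chainGrad L t.G t.Gν)
      (by rw [h0, sub_zero, smul_sub]; abel) tri hv m3
    refine key.trans (add_le_add_right (mul_le_mul_of_nonneg_left ?_ (norm_nonneg _)) _)
    set lo := lowSum T (Sum.inr (some j)) t
    have hlo0 : 0 ≤ lo := lowSum_nonneg T _ t
    have hρ0 : 0 ≤ (c ^ 2 + h ^ 2) * √(gsize t) := by positivity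
    have q1 : F ^ 2 * M * e₁ ≤ F ^ 2 * M * lo := by gcongr; linarith
    have q2 : F ^ 2 * (M * e₀ * (1 + C₃ + p * C₃)) ≤ F ^ 2 * (M * (1 + C₃ + p * C₃)) * lo := by
      calc _ ≤ F ^ 2 * (M * lo * (1 + C₃ + p * C₃)) := by gcongr; linarith
        _ = _ := by ring
    have q3 : 0 ≤ C₁ * lo := by positivity
    have q4 : 0 ≤ (F ^ 2 * M + F ^ 2 * (M * (1 + C₃ + p * C₃)))
      * ((c ^ 2 + h ^ 2) * √(gsize t)) := by positivity
    linarith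

end Regularity

end Recursions

/-! ### Rates of convergence -/

section Rates

variable {d p : ℕ} {A : Params}

/-- A triangular system of contractions, with inhomogeneities `R k` that vary slowly compared with
`β`: the `k`-th sequence is of the order `R k`. The factor `1 + ∑ i, v i` is first shown to be
bounded; the rates follow by induction on the rank. -/
lemma exists_le_mul_of_triangular {ι : Type*} [Fintype ι] (rk : ι → ℕ) {v R : ι → ℕ → ℝ}
    {β η : ℕ → ℝ} {a C : ℝ} (ha : 0 < a) (hC : 0 ≤ C) (hv0 : ∀ k n, 0 ≤ v k n)
    (hR : ∀ k n, 0 < R k n) (hβ0 : ∀ᶠ n in atTop, 0 ≤ β n) (hβ : Tendsto β atTop (𝓝 0))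
    (hη : Tendsto η atTop (𝓝 0)) (hRη : ∀ k, ∀ᶠ n in atTop, R k n ≤ η n)
    (hRR : ∀ i k, rk i < rk k → ∀ᶠ n in atTop, R i n ≤ R k n)
    (hslow : ∀ k, ∀ᶠ n in atTop, (1 - a / 2 * β n) * R k n ≤ R k (n + 1))
    (hv : ∀ k, ∀ᶠ n in atTop, v k (n + 1) ≤ (1 - a * β n) * v k n
      + C * β n * ((∑ i with rk i < rk k, v i n) + R k n * (1 + ∑ i, v i n))) (k : ι) :
    ∃ M, 0 ≤ M ∧ ∀ᶠ n in atTop, v k n ≤ M * R k n := by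
  have hη0 : ∀ᶠ n in atTop, 0 ≤ η n := by
    filter_upwards [hRη k] with n h1 using (hR k n).le.trans h1
  obtain ⟨B, hB0, hB⟩ := exists_forall_le_of_triangular rk ha hC (fun i n => hv0 i n) hβ0 hβ hη hη0
    (by
      rw [eventually_all]
      intro i
      filter_upwards [hv i, hRη i, hβ0] with n h1 h2 h3
      refine h1.trans ?_
      have : 0 ≤ ∑ i, v i n := Finset.sum_nonneg fun i _ => hv0 i n
      gcongr)
  have hβ1 : ∀ᶠ n in atTop, a * β n ≤ 1 := by
    have : Tendsto (fun n => a * β n) atTop (𝓝 0) := by simpa using hβ.const_mul a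
    exact this.eventually_le_const one_pos
  suffices H : ∀ r : ℕ, ∀ k, rk k = r → ∃ M, 0 ≤ M ∧ ∀ᶠ n in atTop, v k n ≤ M * R k n from
    H _ k rfl
  intro r
  induction r using Nat.strong_induction_on with
  | _ r ih =>
  intro k hk
  have hlow : ∀ i, ∃ M, 0 ≤ M ∧ (rk i < rk k → ∀ᶠ n in atTop, v i n ≤ M * R k n) := by
    intro i
    by_cases hi : rk i < rk k
    · obtain ⟨M, hM0, hM⟩ := ih (rk i) (hk ▸ hi) i rfl
      refine ⟨M, hM0, fun _ => ?_⟩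
      filter_upwards [hM, hRR i k hi] with n h1 h2
      exact h1.trans (by gcongr)
    · exact ⟨0, le_rfl, fun h => absurd h hi⟩
  choose M hM0 hM using hlow
  have hlow' : ∀ᶠ n in atTop, ∀ i, rk i < rk k → v i n ≤ M i * R k n := by
    rw [eventually_all]
    intro i
    by_cases hi : rk i < rk k
    · filter_upwards [hM i hi] with n h1 _ using h1
    · exact Eventually.of_forall fun n h => absurd h hi
  have hall : ∀ᶠ n in atTop, ∀ i, v i n ≤ B := eventually_all.2 hB
  refine exists_le_mul_of_contraction (C := C * ((∑ i with rk i < rk k, M i)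
    + (1 + Fintype.card ι * B))) ha (hR k) hβ0 hβ1 (hslow k) ?_
  filter_upwards [hv k, hlow', hall, hβ0] with n h1 h2 h3 h4
  refine h1.trans ?_
  have e1 : ∑ i with rk i < rk k, v i n ≤ (∑ i with rk i < rk k, M i) * R k n := by
    rw [Finset.sum_mul]
    exact Finset.sum_le_sum fun i hi => h2 i (Finset.mem_filter.1 hi).2
  have e2 : ∑ i, v i n ≤ Fintype.card ι * B := by
    refine (Finset.sum_le_sum fun i _ => h3 i).trans ?_
    simp
  have e3 : R k n * (1 + ∑ i, v i n) ≤ R k n * (1 + Fintype.card ι * B) :=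
    mul_le_mul_of_nonneg_left (by linarith) (hR k n).le
  have e4 := mul_le_mul_of_nonneg_left (add_le_add e1 e3) (mul_nonneg hC h4)
  linarith

/-- The sequence does not increase, and the ratio of consecutive terms is at least
`(n + 1) / (n + 2)`. -/
def SlowDecay (x : ℕ → ℝ) : Prop :=
  ∀ n : ℕ, 0 < x n ∧ x (n + 1) ≤ x n ∧ ((n : ℝ) + 1) / (n + 2) * x n ≤ x (n + 1)

/-- For exponents `e ≤ 1` and shifts `m ≥ 0`, the ratio of consecutive terms is
`((n + 1 + m) / (n + 2 + m)) ^ e ≥ (n + 1) / (n + 2)`. -/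
lemma slowDecay_of_poly {x : ℕ → ℝ} {C m e : ℝ} (hC : 0 < C) (hm : 0 ≤ m) (he0 : 0 ≤ e)
    (he1 : e ≤ 1) (hx : ∀ n : ℕ, 1 ≤ n → x n = C / ((n : ℝ) + m) ^ e) :
    SlowDecay fun n => x (n + 1) := by
  intro n
  have hn : (0 : ℝ) ≤ n := n.cast_nonneg
  have e1 : x (n + 1) = C / ((n : ℝ) + 1 + m) ^ e := by
    rw [hx _ (by omega)]; push_cast; rfl
  have e2 : x (n + 1 + 1) = C / ((n : ℝ) + 2 + m) ^ e := by
    rw [hx _ (by omega)]; push_cast; ring_nf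
  have p1 : 0 < ((n : ℝ) + 1 + m) ^ e := by positivity
  have p2 : 0 < ((n : ℝ) + 2 + m) ^ e := by positivity
  simp only [e1, e2]
  refine ⟨by positivity, ?_, ?_⟩
  · gcongr
    linarith
  · have h1 : ((n : ℝ) + 1) / (n + 2) ≤ ((n : ℝ) + 1 + m) / (n + 2 + m) := by
      rw [div_le_div_iff₀ (by positivity) (by positivity)]
      nlinarith
    have h2 : ((n : ℝ) + 1 + m) / (n + 2 + m) ≤ (((n : ℝ) + 1 + m) / (n + 2 + m)) ^ e := by
      conv_lhs => rw [← Real.rpow_one (((n : ℝ) + 1 + m) / (n + 2 + m))]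
      refine Real.rpow_le_rpow_of_exponent_ge (by positivity) ?_ he1
      rw [div_le_one (by positivity)]
      linarith
    rw [Real.div_rpow (by positivity) (by positivity)] at h2
    have h3 := h1.trans h2
    rw [le_div_iff₀ p2] at h3
    rw [← mul_div_assoc, div_le_div_iff₀ p1 p2]
    calc _ = C * (((n : ℝ) + 1) / (n + 2) * ((n : ℝ) + 2 + m) ^ e) := by ring
      _ ≤ _ := by gcongr

lemma PolyParams.slowDecay (hA : PolyParams A) :
    SlowDecay (fun n => A.α (n + 1)) ∧ SlowDecay (fun n => A.β (n + 1)) ∧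
    SlowDecay (fun n => A.c (n + 1)) ∧ SlowDecay (fun n => A.h (n + 1)) := by
  obtain ⟨Cα, Cβ, Cc, Ch, nα, nβ, nc, nh, a, b, ec, eh, h1, h2, h3, h4, h5, h6, h7, h8, h9, h10,
    h11, h12, h13, h14, h15, h, -⟩ := hA
  exact ⟨slowDecay_of_poly h1 h5 (by linarith) h10 fun n hn => (h n hn).1,
    slowDecay_of_poly h2 h6 (by linarith) h12 fun n hn => (h n hn).2.1,
    slowDecay_of_poly h3 h7 h13.le (by linarith) fun n hn => (h n hn).2.2.1,
    slowDecay_of_poly h4 h8 h14.le (by linarith) fun n hn => (h n hn).2.2.2⟩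

lemma rateOf_pos (k : Idx p) {α β c h : ℝ} (hα : 0 < α) (hβ : 0 < β) (hc : 0 < c) (hh : 0 < h) :
    0 < rateOf k α β c h := by
  rcases k with (_ | j) | (_ | j) <;> simp only [rateOf, rate, rateν] <;> positivity

lemma rateν_le_rate {α β c h : ℝ} (hβ : 0 < β) (hc : 0 < c) (hh : 0 < h)
    (hh1 : h ≤ 1) : rateν α β c ≤ rate α β c h := by
  have h1 : β / c ^ 2 ≤ β / (c * h) ^ 2 := by
    gcongr
    nlinarith
  have h2 : 0 ≤ h ^ 4 := by positivity
  rw [rateν, rate]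
  linarith

/-- If the four parameters change at most by the factor `ρ ≤ 1` in one step, the squared rates
change at most by the factor `ρ ^ 4`. -/
lemma pow_mul_rateOf_le (k : Idx p) {ρ α β c h α' β' c' h' : ℝ} (hρ : 0 < ρ) (hρ1 : ρ ≤ 1)
    (hα : 0 < α) (hβ : 0 < β) (hc : 0 < c) (hh : 0 < h) (hβ' : 0 < β') (hc' : 0 < c')
    (hh' : 0 < h') (a1 : ρ * α ≤ α') (b1 : ρ * β ≤ β') (b2 : β' ≤ β) (c1 : ρ * c ≤ c')
    (c2 : c' ≤ c) (e1 : ρ * h ≤ h') (e2 : h' ≤ h) :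
    ρ ^ 4 * rateOf k α β c h ≤ rateOf k α' β' c' h' := by
  have hp2 : ρ ^ 4 ≤ ρ ^ 2 := pow_le_pow_of_le_one hρ.le hρ1 (by norm_num)
  have hp1 : ρ ^ 4 ≤ ρ := pow_le_of_le_one hρ.le hρ1 (by norm_num)
  have hα' : 0 < α' := (mul_pos hρ hα).trans_le a1
  have t1 : ρ ^ 4 * (α / β) ^ 2 ≤ (α' / β') ^ 2 := by
    calc ρ ^ 4 * (α / β) ^ 2 ≤ ρ ^ 2 * (α / β) ^ 2 := by gcongr
      _ = (ρ * α / β) ^ 2 := by ring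
      _ ≤ (α' / β') ^ 2 := by gcongr
  have t2 : ρ ^ 4 * (β / (c * h) ^ 2) ≤ β' / (c' * h') ^ 2 := by
    calc ρ ^ 4 * (β / (c * h) ^ 2) ≤ ρ * (β / (c * h) ^ 2) := by gcongr
      _ = (ρ * β) / (c * h) ^ 2 := by ring
      _ ≤ _ := by gcongr
  have t2' : ρ ^ 4 * (β / c ^ 2) ≤ β' / c' ^ 2 := by
    calc ρ ^ 4 * (β / c ^ 2) ≤ ρ * (β / c ^ 2) := by gcongr
      _ = (ρ * β) / c ^ 2 := by ring
      _ ≤ _ := by gcongr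
  have t3 : ρ ^ 4 * c ^ 4 ≤ c' ^ 4 := by
    rw [← mul_pow]; gcongr
  have t4 : ρ ^ 4 * h ^ 4 ≤ h' ^ 4 := by
    rw [← mul_pow]; gcongr
  rcases k with (_ | j) | (_ | j) <;> simp only [rateOf, rate, rateν] <;> linarith

lemma StepSizes.tendsto_div (hA : StepSizes A) :
    Tendsto (fun n => A.α (n + 1) / A.β (n + 1)) atTop (𝓝 0) :=
  (hA.α_little.tendsto_div_nhds_zero).comp (tendsto_add_atTop_nat 1)

lemma StepSizes.tendsto_noise (hA : StepSizes A) :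
    Tendsto (fun n => A.β (n + 1) / (A.c (n + 1) * A.h (n + 1)) ^ 2) atTop (𝓝 0) := by
  have := (hA.β_little.tendsto_div_nhds_zero).comp (tendsto_add_atTop_nat 1)
  simpa only [Function.comp_def, mul_pow] using this

lemma StepSizes.tendsto_c (hA : StepSizes A) :
    Tendsto (fun n => A.c (n + 1)) atTop (𝓝 0) := hA.c_lim.comp (tendsto_add_atTop_nat 1)

lemma StepSizes.tendsto_h (hA : StepSizes A) :
    Tendsto (fun n => A.h (n + 1)) atTop (𝓝 0) := hA.h_lim.comp (tendsto_add_atTop_nat 1)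

lemma StepSizes.tendsto_β (hA : StepSizes A) :
    Tendsto (fun n => A.β (n + 1)) atTop (𝓝 0) := by
  have h1 := hA.tendsto_noise.mul ((hA.tendsto_c.mul hA.tendsto_h).pow 2)
  simp only [mul_zero, zero_mul] at h1
  refine h1.congr fun n => ?_
  have := hA.c_pos (n + 1) (by omega)
  have := hA.h_pos (n + 1) (by omega)
  field_simp

lemma StepSizes.tendsto_rate (hA : StepSizes A) :
    Tendsto (fun n => rate (A.α (n + 1)) (A.β (n + 1)) (A.c (n + 1)) (A.h (n + 1))) atTop
      (𝓝 0) := by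
  have := (((hA.tendsto_div.pow 2).add hA.tendsto_noise).add (hA.tendsto_c.pow 4)).add
    (hA.tendsto_h.pow 4)
  simpa [rate] using this

lemma StepSizes.eventually_small (hA : StepSizes A) (d : ℕ) {r : ℝ} (hr : 0 < r) :
    ∀ᶠ n in atTop, Small d r (A.α (n + 1)) (A.β (n + 1)) (A.c (n + 1)) (A.h (n + 1)) := by
  have hc : Tendsto (fun n => (1 + d) * A.c (n + 1)) atTop (𝓝 0) := by
    simpa using hA.tendsto_c.const_mul (1 + (d : ℝ))
  filter_upwards [hA.tendsto_β.eventually_le_const one_pos, hc.eventually_le_const one_pos,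
    hc.eventually_le_const (half_pos hr), hA.tendsto_h.eventually_le_const one_pos]
    with n h1 h2 h3 h4
  exact ⟨hA.α_pos _ (by omega), hA.β_pos _ (by omega), h1, hA.c_pos _ (by omega), h2, h3,
    hA.h_pos _ (by omega), h4⟩

/-- The squared rates vary slowly compared with `β`: they change by a factor `1 - O(1 / n)`, and
`1 / n ≤ α_n = o(β_n)`. -/
lemma PolyParams.eventually_rateOf_slow (hA : PolyParams A) (h3 : StepSizes A) (k : Idx p) {a : ℝ}
    (ha : 0 < a) : ∀ᶠ n in atTop,
      (1 - a / 2 * A.β (n + 1)) * rateOf k (A.α (n + 1)) (A.β (n + 1)) (A.c (n + 1)) (A.h (n + 1))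
        ≤ rateOf k (A.α (n + 1 + 1)) (A.β (n + 1 + 1)) (A.c (n + 1 + 1)) (A.h (n + 1 + 1)) := by
  obtain ⟨sα, sβ, sc, sh⟩ := hA.slowDecay
  obtain ⟨n₀, hn₀⟩ : ∃ n₀ : ℕ, ∀ n : ℕ, n₀ ≤ n → 1 / (n : ℝ) ≤ A.α n := by
    obtain ⟨Cα, Cβ, Cc, Ch, nα, nβ, nc, nh, a, b, ec, eh, h1, h2, h3, h4, h5, h6, h7, h8, h9, h10,
      h11, h12, h13, h14, h15, -, n₀, -, h⟩ := hA
    exact ⟨n₀, fun n hn => (h n hn).1⟩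
  filter_upwards [h3.tendsto_div.eventually_le_const (show (0 : ℝ) < a / 8 by positivity),
    eventually_ge_atTop n₀] with n h4 h5
  have hβ := (sβ n).1
  rw [div_le_iff₀ hβ] at h4
  have h6 := hn₀ (n + 1) (by omega)
  push_cast at h6
  set ρ : ℝ := ((n : ℝ) + 1) / (n + 2) with hρ
  have hρ0 : 0 < ρ := by positivity
  have hρ1 : ρ ≤ 1 := by
    rw [hρ, div_le_one (by positivity)]; linarith
  have hρ4 : 1 - a / 2 * A.β (n + 1) ≤ ρ ^ 4 := by
    have e1 : 1 - 4 * (1 - ρ) ≤ ρ ^ 4 := by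
      nlinarith [sq_nonneg (ρ ^ 2 - 1), sq_nonneg (ρ - 1)]
    have e2 : 1 - ρ ≤ 1 / ((n : ℝ) + 1) := by
      have : 1 - ρ = 1 / ((n : ℝ) + 2) := by rw [hρ]; field_simp; ring
      rw [this]
      gcongr
      linarith
    linarith
  refine le_trans (mul_le_mul_of_nonneg_right hρ4
    (rateOf_pos k (sα n).1 hβ (sc n).1 (sh n).1).le) ?_
  exact pow_mul_rateOf_le k hρ0 hρ1 (sα n).1 hβ (sc n).1 (sh n).1 (sβ (n + 1)).1 (sc (n + 1)).1
    (sh (n + 1)).1 (sα n).2.2 (sβ n).2.2 (sβ n).2.1 (sc n).2.2 (sc n).2.1 (sh n).2.2 (sh n).2.1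

end Rates

/-! ### Second moments of the iterates -/

section Moments

variable {d p : ℕ} {Ξ Ω : Type*} [MeasurableSpace Ξ] [MeasurableSpace Ω]
  {P : Problem d p Ξ} {T : Targets d p} {K : ℝ → ℝ} {A : Params} {s₀ : State d p} {Pr : Measure Ω}
  {Δ : ℕ → Ω → Vec d} {ξ : ℕ → Fin 3 → Ω → Ξ}
  {N : Set (Vec d)} {Xε : Set ℝ} {Λε : Set (Fin p → ℝ)} {θs : Vec d}

lemma Sampling.measurable_iter (hS : Sampling P Pr Δ ξ) (hP : P.Standing) (hK : KernelCond K)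
    (hne : P.feasible.Nonempty) (hg : ContDiff ℝ 1 P.g) (A : Params) (s₀ : State d p) (n : ℕ) :
    Measurable (iter P K A s₀ Δ ξ n) :=
  KBSA.measurable_iter hP hK hne hg A s₀ n fun k _ => ⟨hS.meas_Δ k, hS.meas_ξ k⟩

lemma Sampling.measurable_noise (hS : Sampling P Pr Δ ξ) (n : ℕ) :
    Measurable fun ω => (Δ n ω, ξ n 1 ω, ξ n 2 ω) :=
  (hS.meas_Δ n).prodMk ((hS.meas_ξ n 1).prodMk (hS.meas_ξ n 2))

/-- As the direction is independent of the current state, the perturbed points lie in the regular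
neighborhood for almost every direction, with the current state held fixed. -/
lemma Regularity.ae_isGood [IsProbabilityMeasure Pr]
    (h1 : Regularity P T Pr A (iter P K A s₀ Δ ξ) Δ N Xε Λε) (hS : Sampling P Pr Δ ξ)
    (hP : P.Standing) (hK : KernelCond K) (hne : P.feasible.Nonempty) (n : ℕ) :
    ∀ᵐ ω ∂Pr, IsGood N Xε Λε (Pr.map (Δ n)) (A.c (n + 1)) (iter P K A s₀ Δ ξ n ω) := by
  have hm := hS.measurable_iter hP hK hne h1.g_smooth A s₀ n
  have hΔ := hS.meas_Δ n
  have hi : IndepFun (iter P K A s₀ Δ ξ n) (Δ n) Pr :=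
    (hS.indepFun_iter_noise hP hK hne h1.g_smooth A s₀ n).comp measurable_id measurable_fst
  have := Measure.isProbabilityMeasure_map (μ := Pr) hΔ.aemeasurable
  have := Measure.isProbabilityMeasure_map (μ := Pr) hm.aemeasurable
  have hO : MeasurableSet (N ×ˢ Xε ×ˢ Λε) :=
    h1.open_N.measurableSet.prod (h1.open_X.measurableSet.prod h1.open_Λ.measurableSet)
  have hmeas : MeasurableSet {z : State d p × Vec d |
      perturb 1 (A.c (n + 1)) z.1 z.2 ∈ N ×ˢ Xε ×ˢ Λε ∧
      perturb (-1) (A.c (n + 1)) z.1 z.2 ∈ N ×ˢ Xε ×ˢ Λε} :=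
    ((measurable_perturb 1 _) hO).inter ((measurable_perturb (-1) _) hO)
  have h2 : ∀ᵐ z ∂(Pr.map fun ω => (iter P K A s₀ Δ ξ n ω, Δ n ω)),
      perturb 1 (A.c (n + 1)) z.1 z.2 ∈ N ×ˢ Xε ×ˢ Λε ∧
      perturb (-1) (A.c (n + 1)) z.1 z.2 ∈ N ×ˢ Xε ×ˢ Λε := by
    refine (ae_map_iff (hm.prodMk hΔ).aemeasurable hmeas).2 ?_
    filter_upwards [h1.nhd_perturb] with ω hω using hω n
  rw [(indepFun_iff_map_prod_eq_prod_map_map hm.aemeasurable hΔ.aemeasurable).1 hi] at h2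
  have h3 := ae_of_ae_map hm.aemeasurable (Measure.ae_ae_of_ae_prod h2)
  obtain ⟨r, hr, hnhd⟩ := h1.nhd
  filter_upwards [h3, hnhd] with ω h4 h5
  obtain ⟨h6, h7, h8⟩ := h5 n
  exact ⟨⟨h6 (Metric.mem_ball_self hr), h8 (Metric.mem_ball_self hr),
    h7 (Metric.mem_ball_self hr)⟩, h4⟩

/-- The initial `θ` need not be feasible; all later ones are, by the projection. -/
lemma Regularity.exists_ae_isAdmissible [IsProbabilityMeasure Pr]
    (h1 : Regularity P T Pr A (iter P K A s₀ Δ ξ) Δ N Xε Λε) (hS : Sampling P Pr Δ ξ)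
    (hP : P.Standing) (hK : KernelCond K) (hne : P.feasible.Nonempty) :
    ∃ r > 0, ∀ n, 1 ≤ n → ∀ᵐ ω ∂Pr, IsAdmissible P N Xε Λε (Pr.map (Δ n)) r (A.c (n + 1))
      (iter P K A s₀ Δ ξ n ω) := by
  obtain ⟨r, hr, hnhd⟩ := h1.nhd
  refine ⟨r, hr, fun n hn => ?_⟩
  obtain ⟨n, rfl⟩ : ∃ k, n = k + 1 := ⟨n - 1, by omega⟩
  filter_upwards [h1.ae_isGood hS hP hK hne (n + 1), hnhd] with ω h2 h3
  exact ⟨h2, (h3 (n + 1)).2.1, nextθ_mem hP hne _ _⟩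

lemma measurable_comp_nextθ {E : Type*} [TopologicalSpace E] [MeasurableSpace E] [BorelSpace E]
    (hP : P.Standing) (hne : P.feasible.Nonempty) (hg : ContDiff ℝ 1 P.g) (α : ℝ) {F : Vec d → E}
    (hF : ContinuousOn F P.feasible) : Measurable fun t : State d p => F (nextθ P α t) :=
  (continuousOn_iff_continuous_domRestrict.1 hF).measurable.comp
    ((measurable_nextθ hP hne hg α).subtype_mk (h := nextθ_mem hP hne α))

section Components

variable {Ω' : Type*} (P : Problem d p Ξ) (K : ℝ → ℝ) (A : Params) (s₀ : State d p)
  (Δ : ℕ → Ω' → Vec d) (ξ : ℕ → Fin 3 → Ω' → Ξ) (n : ℕ) (ω : Ω')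

lemma iter_succ_θ : (iter P K A s₀ Δ ξ (n + 1) ω).θ
    = nextθ P (A.α (n + 1)) (iter P K A s₀ Δ ξ n ω) := rfl

lemma iter_succ_ν : (iter P K A s₀ Δ ξ (n + 1) ω).ν = (iter P K A s₀ Δ ξ n ω).ν
    + A.β (n + 1) * qUpd P (iter P K A s₀ Δ ξ n ω) (ξ n 0 ω) := rfl

lemma iter_succ_lam (j : Fin p) : (iter P K A s₀ Δ ξ (n + 1) ω).lam j
    = (iter P K A s₀ Δ ξ n ω).lam j
      + A.β (n + 1) * mUpd P K (A.h (n + 1)) j (iter P K A s₀ Δ ξ n ω) (ξ n 0 ω) := rfl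

lemma iter_succ_Gν : (iter P K A s₀ Δ ξ (n + 1) ω).Gν = (iter P K A s₀ Δ ξ n ω).Gν
    + A.β (n + 1) • spQuot (qDiff P (A.c (n + 1)) (iter P K A s₀ Δ ξ n ω, Δ n ω)
      (ξ n 1 ω, ξ n 2 ω)) (cbar (A.c (n + 1)) (iter P K A s₀ Δ ξ n ω)) (Δ n ω) := rfl

lemma iter_succ_G (j : Fin p) : (iter P K A s₀ Δ ξ (n + 1) ω).G j
    = (iter P K A s₀ Δ ξ n ω).G j
      + A.β (n + 1) • spQuot (mDiff P K (A.c (n + 1)) (A.h (n + 1)) j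
        (iter P K A s₀ Δ ξ n ω, Δ n ω) (ξ n 1 ω, ξ n 2 ω))
        (cbar (A.c (n + 1)) (iter P K A s₀ Δ ξ n ω)) (Δ n ω) := rfl

end Components

section Generic

variable {E Y : Type*} [NormedAddCommGroup E] [NormedSpace ℝ E] [MeasurableSpace E] [BorelSpace E]
  [SecondCountableTopology E] [MeasurableSpace Y]

lemma measurable_norm_sq_next (hP : P.Standing) (hne : P.feasible.Nonempty)
    (hg : ContDiff ℝ 1 P.g) (α β : ℝ) {F : Vec d → E} (hF : ContinuousOn F P.feasible)
    {x : State d p → E} (hx : Measurable x) {U : State d p × Y → E} (hU : Measurable U) :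
    Measurable fun z : State d p × Y => ‖x z.1 + β • U z - F (nextθ P α z.1)‖ ^ 2 := by
  have h1 : Measurable fun z : State d p × Y => x z.1 := hx.comp measurable_fst
  have h2 : Measurable fun z : State d p × Y => F (nextθ P α z.1) :=
    (measurable_comp_nextθ hP hne hg α hF).comp measurable_fst
  exact (((h1.add (hU.const_smul β)).sub h2).norm).pow_const 2

/-- One update `x + β U` of a square integrable quantity is square integrable, also after
subtracting a function of `θ` that is continuous on the feasible region. -/
lemma integrable_norm_sq_next [IsProbabilityMeasure Pr] (hP : P.Standing)
    (hne : P.feasible.Nonempty) (hg : ContDiff ℝ 1 P.g) (α β : ℝ) {F : Vec d → E}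
    (hF : ContinuousOn F P.feasible) {a : Ω → State d p} {b : Ω → Y} (ha : Measurable a)
    (hb : Measurable b) (hab : IndepFun a b Pr) {ρ : Measure Y} (hρ : Pr.map b = ρ)
    {x : State d p → E} (hx : Measurable x) {U : State d p × Y → E} (hU : Measurable U)
    (hx2 : Integrable (fun ω => ‖x (a ω)‖ ^ 2) Pr) {B : State d p → ℝ}
    (hB : Integrable (fun ω => B (a ω)) Pr)
    (h : ∀ᵐ ω ∂Pr, Integrable (fun y => ‖U (a ω, y)‖ ^ 2) ρ ∧
      ∫ y, ‖U (a ω, y)‖ ^ 2 ∂ρ ≤ B (a ω)) :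
    Integrable (fun ω => ‖x (a ω) + β • U (a ω, b ω) - F (nextθ P α (a ω))‖ ^ 2) Pr := by
  obtain ⟨C, hC⟩ := hP.compact.exists_bound_of_continuousOn hF
  have i1 : Integrable (fun ω => ‖U (a ω, b ω)‖ ^ 2) Pr :=
    (integral_comp_le_of_indepFun ha hb hab hρ (Φ := fun z => ‖U z‖ ^ 2)
      (hU.norm.pow_const 2) (fun z => sq_nonneg _) hB h).1
  have i2 : Integrable (fun ω => 3 * (‖x (a ω)‖ ^ 2 + β ^ 2 * ‖U (a ω, b ω)‖ ^ 2 + C ^ 2)) Pr :=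
    ((hx2.add (i1.const_mul (β ^ 2))).add (integrable_const _)).const_mul 3
  have hm : Measurable fun ω => ‖x (a ω) + β • U (a ω, b ω) - F (nextθ P α (a ω))‖ ^ 2 :=
    (measurable_norm_sq_next hP hne hg α β hF hx hU).comp (ha.prodMk hb)
  refine i2.mono' hm.aestronglyMeasurable (ae_of_all _ fun ω => ?_)
  rw [Real.norm_of_nonneg (sq_nonneg _)]
  have e1 : ‖x (a ω) + β • U (a ω, b ω) - F (nextθ P α (a ω))‖
      ≤ ‖x (a ω)‖ + |β| * ‖U (a ω, b ω)‖ + C := by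
    refine (norm_sub_le _ _).trans (add_le_add ((norm_add_le _ _).trans ?_)
      (hC _ (nextθ_mem hP hne α _)))
    rw [norm_smul, Real.norm_eq_abs]
  refine (pow_le_pow_left₀ (norm_nonneg _) e1 2).trans ?_
  rw [← sq_abs β]
  nlinarith [sq_nonneg (‖x (a ω)‖ - |β| * ‖U (a ω, b ω)‖), sq_nonneg (‖x (a ω)‖ - C),
    sq_nonneg (|β| * ‖U (a ω, b ω)‖ - C)]

end Generic

lemma measurable_spQuot_qDiff (hP : P.Standing) (c : ℝ) :
    Measurable fun z : State d p × Vec d × Ξ × Ξ =>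
      spQuot (qDiff P c (z.1, z.2.1) z.2.2) (cbar c z.1) z.2.1 := by
  have h1 : Measurable fun z : State d p × Vec d × Ξ × Ξ => qDiff P c (z.1, z.2.1) z.2.2 := by
    have := Measurable.comp (g := fun z : (State d p × Vec d) × Ξ × Ξ => qDiff P c z.1 z.2)
      (f := fun z : State d p × Vec d × Ξ × Ξ => ((z.1, z.2.1), z.2.2)) (measurable_qDiff hP c)
      ((measurable_fst.prodMk measurable_snd.fst).prodMk measurable_snd.snd)
    simpa only [Function.comp_def] using this
  have h2 : Measurable fun z : State d p × Vec d × Ξ × Ξ => cbar c z.1 :=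
    (measurable_cbar c).comp measurable_fst
  have := Measurable.comp (g := fun z : ℝ × ℝ × Vec d => spQuot z.1 z.2.1 z.2.2)
    (f := fun z : State d p × Vec d × Ξ × Ξ => (qDiff P c (z.1, z.2.1) z.2.2, cbar c z.1, z.2.1))
    measurable_spQuot (h1.prodMk (h2.prodMk measurable_snd.fst))
  simpa only [Function.comp_def] using this

lemma measurable_spQuot_mDiff (hP : P.Standing) (hK : KernelCond K) (c h : ℝ) (j : Fin p) :
    Measurable fun z : State d p × Vec d × Ξ × Ξ =>
      spQuot (mDiff P K c h j (z.1, z.2.1) z.2.2) (cbar c z.1) z.2.1 := by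
  have h1 : Measurable fun z : State d p × Vec d × Ξ × Ξ =>
      mDiff P K c h j (z.1, z.2.1) z.2.2 := by
    have := Measurable.comp (g := fun z : (State d p × Vec d) × Ξ × Ξ => mDiff P K c h j z.1 z.2)
      (f := fun z : State d p × Vec d × Ξ × Ξ => ((z.1, z.2.1), z.2.2))
      (measurable_mDiff hP hK c h j)
      ((measurable_fst.prodMk measurable_snd.fst).prodMk measurable_snd.snd)
    simpa only [Function.comp_def] using this
  have h2 : Measurable fun z : State d p × Vec d × Ξ × Ξ => cbar c z.1 :=
    (measurable_cbar c).comp measurable_fst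
  have := Measurable.comp (g := fun z : ℝ × ℝ × Vec d => spQuot z.1 z.2.1 z.2.2)
    (f := fun z : State d p × Vec d × Ξ × Ξ =>
      (mDiff P K c h j (z.1, z.2.1) z.2.2, cbar c z.1, z.2.1))
    measurable_spQuot (h1.prodMk (h2.prodMk measurable_snd.fst))
  simpa only [Function.comp_def] using this

/-- For a fixed bandwidth, the increments of `λ_j` have bounded second moments. -/
lemma Regularity.exists_integral_mUpd_sq_le {s : ℕ → Ω → State d p}
    (h1 : Regularity P T Pr A s Δ N Xε Λε) (hP : P.Standing)
    (hK : KernelCond K) {h : ℝ} (hh : 0 < h) :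
    ∃ C, ∀ j, ∀ t : State d p, t.pt ∈ N ×ˢ Λε ×ˢ Xε →
      Integrable (fun x => ‖mUpd P K h j t x‖ ^ 2) P.μ ∧
      ∫ x, ‖mUpd P K h j t x‖ ^ 2 ∂P.μ ≤ C := by
  obtain ⟨C, hC⟩ := h1.m_moment
  obtain ⟨B, hB⟩ := hK.bounded
  refine ⟨C * (B / h) ^ 2, fun j t ht => ?_⟩
  have hi := h1.mUpd_integrable hP hK hh j ht
  obtain ⟨hm, hmC⟩ := hC j t.θ ht.1 t.lam ht.2.1
  refine ⟨hi, ?_⟩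
  calc ∫ x, ‖mUpd P K h j t x‖ ^ 2 ∂P.μ
      ≤ ∫ x, P.m j t.θ (P.Y t.θ x) (head j t.lam) ^ 2 * (B / h) ^ 2 ∂P.μ := by
        refine integral_mono hi (hm.mul_const _) fun x => ?_
        simp only [Real.norm_eq_abs, sq_abs, mUpd, mul_pow]
        exact mul_le_mul_of_nonneg_left (pow_le_pow_left₀ (hK.kern_nonneg hh _ _)
          (kern_le hB hh _ _) 2) (sq_nonneg _)
    _ = (∫ x, P.m j t.θ (P.Y t.θ x) (head j t.lam) ^ 2 ∂P.μ) * (B / h) ^ 2 :=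
        integral_mul_const _ _
    _ ≤ _ := mul_le_mul_of_nonneg_right hmC (sq_nonneg _)

/-- All components of a random state, except `θ`, are square integrable. -/
structure HasSecondMoments (Pr : Measure Ω) (a : Ω → State d p) : Prop where
  ν : Integrable (fun ω => ‖(a ω).ν‖ ^ 2) Pr
  lam : ∀ j, Integrable (fun ω => ‖(a ω).lam j‖ ^ 2) Pr
  Gν : Integrable (fun ω => ‖(a ω).Gν‖ ^ 2) Pr
  G : ∀ j, Integrable (fun ω => ‖(a ω).G j‖ ^ 2) Pr

lemma HasSecondMoments.integrable_gsize [IsProbabilityMeasure Pr] {a : Ω → State d p}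
    (ha : HasSecondMoments Pr a) (C : ℝ) : Integrable (fun ω => C * gsize (a ω)) Pr :=
  (((integrable_const 1).add ha.Gν).add (integrable_finsetSum _ fun j _ => ha.G j)).const_mul C

section Next

variable [IsProbabilityMeasure Pr] (h1 : Regularity P T Pr A (iter P K A s₀ Δ ξ) Δ N Xε Λε)
  (hS : Sampling P Pr Δ ξ) (hP : P.Standing) (hK : KernelCond K)
  (hne : P.feasible.Nonempty)
include h1 hS hP hK hne

lemma integrable_ν_succ {n : ℕ} (hm : HasSecondMoments Pr (iter P K A s₀ Δ ξ n)) {F : Vec d → ℝ}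
    (hF : ContinuousOn F P.feasible) :
    Integrable (fun ω => ‖(iter P K A s₀ Δ ξ (n + 1) ω).ν - F (iter P K A s₀ Δ ξ (n + 1) ω).θ‖ ^ 2)
      Pr := by
  obtain ⟨C, -, hC⟩ := h1.qUpd_moments
  have := integrable_norm_sq_next (x := State.ν)
    (U := fun z => qUpd P z.1 z.2)
    hP hne h1.g_smooth (A.α (n + 1)) (A.β (n + 1)) hF
    (hS.measurable_iter hP hK hne h1.g_smooth A s₀ n) (hS.meas_ξ n 0)
    (hS.indepFun_iter_run hP hK hne h1.g_smooth A s₀ n) (hS.law_ξ n 0) State.measurable_ν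
    (measurable_qUpd hP) hm.ν (B := fun _ => C) (integrable_const _) (by
    filter_upwards [h1.ae_isGood hS hP hK hne n] with ω hω
    exact ⟨(hC _ hω.mem_pt).1, (hC _ hω.mem_pt).2.1⟩)
  simpa only [iter_succ_ν, iter_succ_θ, smul_eq_mul] using this

variable (h3 : StepSizes A)
include h3

lemma integrable_lam_succ {n : ℕ} (hm : HasSecondMoments Pr (iter P K A s₀ Δ ξ n)) (j : Fin p)
    {F : Vec d → ℝ} (hF : ContinuousOn F P.feasible) :
    Integrable (fun ω =>
      ‖(iter P K A s₀ Δ ξ (n + 1) ω).lam j - F (iter P K A s₀ Δ ξ (n + 1) ω).θ‖ ^ 2) Pr := by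
  obtain ⟨C, hC⟩ := h1.exists_integral_mUpd_sq_le hP hK (h3.h_pos (n + 1) (by omega))
  have := integrable_norm_sq_next (x := fun t => t.lam j)
    (U := fun z => mUpd P K (A.h (n + 1)) j z.1 z.2)
    hP hne h1.g_smooth (A.α (n + 1)) (A.β (n + 1)) hF
    (hS.measurable_iter hP hK hne h1.g_smooth A s₀ n) (hS.meas_ξ n 0)
    (hS.indepFun_iter_run hP hK hne h1.g_smooth A s₀ n) (hS.law_ξ n 0)
    ((measurable_pi_apply j).comp State.measurable_lam)
    (measurable_mUpd hP hK (A.h (n + 1)) j) (hm.lam j) (B := fun _ => C) (integrable_const _) (by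
    filter_upwards [h1.ae_isGood hS hP hK hne n] with ω hω
    exact hC j _ hω.mem_pt)
  simpa only [iter_succ_lam, iter_succ_θ, smul_eq_mul] using this

lemma integrable_Gν_succ {n : ℕ} (hm : HasSecondMoments Pr (iter P K A s₀ Δ ξ n))
    {F : Vec d → Vec d} (hF : ContinuousOn F P.feasible) :
    Integrable (fun ω => ‖(iter P K A s₀ Δ ξ (n + 1) ω).Gν - F (iter P K A s₀ Δ ξ (n + 1) ω).θ‖ ^ 2)
      Pr := by
  obtain ⟨C, -, hC⟩ := h1.qDiff_moments hP
  have := integrable_norm_sq_next (x := State.Gν)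
    (U := fun z => spQuot (qDiff P (A.c (n + 1)) (z.1, z.2.1) z.2.2) (cbar (A.c (n + 1)) z.1) z.2.1)
    hP hne h1.g_smooth (A.α (n + 1)) (A.β (n + 1)) hF
    (hS.measurable_iter hP hK hne h1.g_smooth A s₀ n) (hS.measurable_noise n)
    (hS.indepFun_iter_noise hP hK hne h1.g_smooth A s₀ n) (hS.map_noise n) State.measurable_Gν
    (measurable_spQuot_qDiff hP (A.c (n + 1))) hm.Gν
    (B := fun t => C / A.c (n + 1) ^ 2 * gsize t) (hm.integrable_gsize _) (by
    filter_upwards [h1.ae_isGood hS hP hK hne n] with ω hω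
    obtain ⟨-, h4, h5, -⟩ := hC _ (hS.isRademacher n) _ (h3.c_pos (n + 1) (by omega)) _ hω
    exact ⟨h4, h5.trans_eq (by ring)⟩)
  simpa only [iter_succ_Gν, iter_succ_θ, smul_eq_mul] using this

lemma integrable_G_succ {n : ℕ} (hm : HasSecondMoments Pr (iter P K A s₀ Δ ξ n)) (j : Fin p)
    {F : Vec d → Vec d} (hF : ContinuousOn F P.feasible) :
    Integrable (fun ω =>
      ‖(iter P K A s₀ Δ ξ (n + 1) ω).G j - F (iter P K A s₀ Δ ξ (n + 1) ω).θ‖ ^ 2) Pr := by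
  obtain ⟨C, -, hC⟩ := h1.mDiff_integrable hP hK (h3.h_pos (n + 1) (by omega))
  have := integrable_norm_sq_next (x := fun t => t.G j)
    (U := fun z => spQuot (mDiff P K (A.c (n + 1)) (A.h (n + 1)) j (z.1, z.2.1) z.2.2)
      (cbar (A.c (n + 1)) z.1) z.2.1)
    hP hne h1.g_smooth (A.α (n + 1)) (A.β (n + 1)) hF
    (hS.measurable_iter hP hK hne h1.g_smooth A s₀ n) (hS.measurable_noise n)
    (hS.indepFun_iter_noise hP hK hne h1.g_smooth A s₀ n) (hS.map_noise n)
    ((measurable_pi_apply j).comp State.measurable_G)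
    (measurable_spQuot_mDiff hP hK (A.c (n + 1)) (A.h (n + 1)) j) (hm.G j)
    (B := fun t => C / A.c (n + 1) ^ 2 * gsize t) (hm.integrable_gsize _) (by
    filter_upwards [h1.ae_isGood hS hP hK hne n] with ω hω
    obtain ⟨h4, h5⟩ := hC j _ (hS.isRademacher n) _ (h3.c_pos (n + 1) (by omega)) _ hω
    exact ⟨h4, h5.trans_eq (by ring)⟩)
  simpa only [iter_succ_G, iter_succ_θ, smul_eq_mul] using this

/-- By induction, with the target `0` in the preceding lemmas. -/
lemma hasSecondMoments_iter (n : ℕ) : HasSecondMoments Pr (iter P K A s₀ Δ ξ n) := by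
  induction n with
  | zero => exact ⟨integrable_const (‖s₀.ν‖ ^ 2), fun j => integrable_const (‖s₀.lam j‖ ^ 2),
      integrable_const (‖s₀.Gν‖ ^ 2), fun j => integrable_const (‖s₀.G j‖ ^ 2)⟩
  | succ n ih =>
    refine ⟨?_, fun j => ?_, ?_, fun j => ?_⟩
    · simpa using integrable_ν_succ h1 hS hP hK hne ih (F := fun _ => 0) continuousOn_const
    · simpa using integrable_lam_succ h1 hS hP hK hne h3 ih j (F := fun _ => 0) continuousOn_const
    · simpa using integrable_Gν_succ h1 hS hP hK hne h3 ih (F := fun _ => 0) continuousOn_const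
    · simpa using integrable_G_succ h1 hS hP hK hne h3 ih j (F := fun _ => 0) continuousOn_const

end Next

end Moments

/-! ### The mean square errors -/

section MeanSquare

variable {d p : ℕ} {Ξ Ω : Type*} [MeasurableSpace Ξ] [MeasurableSpace Ω]
  {P : Problem d p Ξ} {T : Targets d p} {K : ℝ → ℝ} {A : Params} {s₀ : State d p} {Pr : Measure Ω}
  {Δ : ℕ → Ω → Vec d} {ξ : ℕ → Fin 3 → Ω → Ξ}
  {N : Set (Vec d)} {Xε : Set ℝ} {Λε : Set (Fin p → ℝ)} {θs : Vec d}

lemma RateCond.feasible_nonempty {s : ℕ → Ω → State d p} (h5 : RateCond P T Pr A s N θs) :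
    P.feasible.Nonempty := ⟨θs, interior_subset h5.interior⟩

lemma RateCond.continuousOn_targets {s : ℕ → Ω → State d p} (h5 : RateCond P T Pr A s N θs) :
    ContinuousOn T.nu P.feasible ∧ ContinuousOn (gradient T.nu) P.feasible ∧
    ∀ j, ContinuousOn (fun θ => T.lam θ j) P.feasible ∧
      ContinuousOn (fun θ => lamGrad T θ j) P.feasible :=
  ⟨fun _ hθ => (h5.nu_smooth _ (Or.inl hθ)).continuousAt.continuousWithinAt,
    continuousOn_gradient fun θ hθ => h5.nu_smooth θ (Or.inl hθ),
    fun j => ⟨fun _ hθ => (h5.lam_smooth_apply j (Or.inl hθ)).continuousAt.continuousWithinAt,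
      continuousOn_gradient fun _ hθ => h5.lam_smooth_apply j (Or.inl hθ)⟩⟩

lemma stepBound_mono {k : Idx p} {a a' C C' α β c h r : ℝ} (H : Small d r α β c h) (ha : a' ≤ a)
    (hC : C ≤ C') (t : State d p) :
    stepBound T k a C α β c h t ≤ stepBound T k a' C' α β c h t := by
  have hβ := H.β_pos
  have h1 := (rateOf_pos k H.α_pos H.β_pos H.c_pos H.h_pos).le
  have h2 : 0 ≤ ∑ i : Idx p with i.rank < k.rank, errN T i t ^ 2 :=
    Finset.sum_nonneg fun i _ => sq_nonneg _
  have h3 : 0 ≤ ∑ i : Idx p, errN T i t ^ 2 := Finset.sum_nonneg fun i _ => sq_nonneg _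
  unfold stepBound
  gcongr

/-- The mean square of the error with index `k`. -/
noncomputable def mse (T : Targets d p) (Pr : Measure Ω) (s : ℕ → Ω → State d p) (k : Idx p)
    (n : ℕ) : ℝ := ∫ ω, errN T k (s n ω) ^ 2 ∂Pr

lemma mse_nonneg {s : ℕ → Ω → State d p} (k : Idx p) (n : ℕ) : 0 ≤ mse T Pr s k n :=
  integral_nonneg fun _ => sq_nonneg _

lemma integral_stepBound [IsProbabilityMeasure Pr] {s : ℕ → Ω → State d p} {n : ℕ}
    (hi : ∀ k, Integrable (fun ω => errN T k (s n ω) ^ 2) Pr) (k : Idx p) (a C α β c h : ℝ) :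
    Integrable (fun ω => stepBound T k a C α β c h (s n ω)) Pr ∧
    ∫ ω, stepBound T k a C α β c h (s n ω) ∂Pr = (1 - a * β) * mse T Pr s k n
      + C * β * ((∑ i : Idx p with i.rank < k.rank, mse T Pr s i n)
        + rateOf k α β c h * (1 + ∑ i, mse T Pr s i n)) := by
  have i1 := (hi k).const_mul (1 - a * β)
  have i2 : Integrable (fun ω => ∑ i : Idx p with i.rank < k.rank, errN T i (s n ω) ^ 2) Pr :=
    integrable_finsetSum _ fun i _ => hi i
  have i3 : Integrable (fun ω => ∑ i : Idx p, errN T i (s n ω) ^ 2) Pr :=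
    integrable_finsetSum _ fun i _ => hi i
  have i4 : Integrable (fun ω => 1 + ∑ i : Idx p, errN T i (s n ω) ^ 2) Pr :=
    (integrable_const 1).add i3
  have i5 := i4.const_mul (rateOf k α β c h)
  have i6 : Integrable (fun ω => (∑ i : Idx p with i.rank < k.rank, errN T i (s n ω) ^ 2)
      + rateOf k α β c h * (1 + ∑ i, errN T i (s n ω) ^ 2)) Pr := i2.add i5
  have i7 := i6.const_mul (C * β)
  unfold stepBound
  refine ⟨i1.add i7, ?_⟩
  rw [integral_add i1 i7, integral_const_mul, integral_const_mul, integral_add i2 i5,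
    integral_const_mul, integral_add (integrable_const 1) i3,
    integral_finsetSum _ (fun i _ => hi i), integral_finsetSum _ (fun i _ => hi i)]
  simp [mse]

section Recursion

variable [IsProbabilityMeasure Pr] (h1 : Regularity P T Pr A (iter P K A s₀ Δ ξ) Δ N Xε Λε)
  (hS : Sampling P Pr Δ ξ) (hP : P.Standing) (hK : KernelCond K) (h3 : StepSizes A)
  (h5 : RateCond P T Pr A (iter P K A s₀ Δ ξ) N θs)
include h1 hS hP hK h3 h5

lemma integrable_errN_sq (k : Idx p) (n : ℕ) :
    Integrable (fun ω => errN T k (iter P K A s₀ Δ ξ n ω) ^ 2) Pr := by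
  have hne := h5.feasible_nonempty
  obtain ⟨c1, c2, c3⟩ := h5.continuousOn_targets
  cases n with
  | zero => exact integrable_const (errN T k s₀ ^ 2)
  | succ n =>
    have hm := hasSecondMoments_iter h1 hS hP hK hne h3 n
    rcases k with (_ | j) | (_ | j)
    · simpa only [errN] using integrable_ν_succ h1 hS hP hK hne hm c1
    · simpa only [errN] using integrable_lam_succ h1 hS hP hK hne h3 hm j (c3 j).1
    · simpa only [errN] using integrable_Gν_succ h1 hS hP hK hne h3 hm c2
    · simpa only [errN] using integrable_G_succ h1 hS hP hK hne h3 hm j (c3 j).2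

/-- The constants of the one-step estimate carry over from states to mean square errors. -/
lemma exists_mse_succ_le_stepBound {r : ℝ} (hr : 0 < r)
    (hadm : ∀ n, 1 ≤ n → ∀ᵐ ω ∂Pr, IsAdmissible P N Xε Λε (Pr.map (Δ n)) r (A.c (n + 1))
      (iter P K A s₀ Δ ξ n ω)) (k : Idx p) :
    ∃ a C, 0 < a ∧ 0 ≤ C ∧ ∀ n, 1 ≤ n →
      Small d r (A.α (n + 1)) (A.β (n + 1)) (A.c (n + 1)) (A.h (n + 1)) →
      mse T Pr (iter P K A s₀ Δ ξ) k (n + 1) ≤ ∫ ω, stepBound T k a C (A.α (n + 1)) (A.β (n + 1))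
        (A.c (n + 1)) (A.h (n + 1)) (iter P K A s₀ Δ ξ n ω) ∂Pr := by
  have hne := h5.feasible_nonempty
  have hg := h1.g_smooth
  obtain ⟨c1, c2, c3⟩ := h5.continuousOn_targets
  have hB := fun n a C α β c h => (integral_stepBound (s := iter P K A s₀ Δ ξ) (n := n)
    (fun k => integrable_errN_sq h1 hS hP hK h3 h5 k n) k a C α β c h).1
  have hmeas := hS.measurable_iter hP hK hne hg A s₀
  rcases k with (_ | j) | (_ | j)
  · obtain ⟨a, C, ha, hC, H⟩ := h1.step_inl_none h5 hP
    refine ⟨a, C, ha, hC, fun n hn hsm => ?_⟩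
    have hm := measurable_norm_sq_next hP hne hg (A.α (n + 1)) (A.β (n + 1)) c1
      State.measurable_ν (measurable_qUpd hP)
    refine (integral_comp_le_of_indepFun (hmeas n) (hS.meas_ξ n 0)
      (hS.indepFun_iter_run hP hK hne hg A s₀ n) (hS.law_ξ n 0) hm (fun z => sq_nonneg _)
      (hB n a C _ _ _ _) ?_).2
    filter_upwards [hadm n hn] with ω hω
    exact H _ r _ _ _ _ hsm _ hω
  · obtain ⟨a, C, ha, hC, H⟩ := h1.step_inl_some h5 hP hK hr j
    refine ⟨a, C, ha, hC, fun n hn hsm => ?_⟩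
    have hm := measurable_norm_sq_next hP hne hg (A.α (n + 1)) (A.β (n + 1)) (c3 j).1
      (x := fun t => t.lam j) ((measurable_pi_apply j).comp State.measurable_lam)
      (measurable_mUpd hP hK (A.h (n + 1)) j)
    refine (integral_comp_le_of_indepFun (hmeas n) (hS.meas_ξ n 0)
      (hS.indepFun_iter_run hP hK hne hg A s₀ n) (hS.law_ξ n 0) hm (fun z => sq_nonneg _)
      (hB n a C _ _ _ _) ?_).2
    filter_upwards [hadm n hn] with ω hω
    exact H _ _ _ _ _ hsm _ hω
  · obtain ⟨a, C, ha, hC, H⟩ := h1.step_inr_none h5 hP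
    refine ⟨a, C, ha, hC, fun n hn hsm => ?_⟩
    have hm := measurable_norm_sq_next hP hne hg (A.α (n + 1)) (A.β (n + 1)) c2
      State.measurable_Gν (measurable_spQuot_qDiff hP (A.c (n + 1)))
    refine (integral_comp_le_of_indepFun (hmeas n) (hS.measurable_noise n)
      (hS.indepFun_iter_noise hP hK hne hg A s₀ n) (hS.map_noise n) hm (fun z => sq_nonneg _)
      (hB n a C _ _ _ _) ?_).2
    filter_upwards [hadm n hn] with ω hω
    exact H _ (hS.isRademacher n) r _ _ _ _ hsm _ hω
  · obtain ⟨a, C, ha, hC, H⟩ := h1.step_inr_some h5 hP hK hr j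
    refine ⟨a, C, ha, hC, fun n hn hsm => ?_⟩
    have hm := measurable_norm_sq_next hP hne hg (A.α (n + 1)) (A.β (n + 1)) (c3 j).2
      (x := fun t => t.G j) ((measurable_pi_apply j).comp State.measurable_G)
      (measurable_spQuot_mDiff hP hK (A.c (n + 1)) (A.h (n + 1)) j)
    refine (integral_comp_le_of_indepFun (hmeas n) (hS.measurable_noise n)
      (hS.indepFun_iter_noise hP hK hne hg A s₀ n) (hS.map_noise n) hm (fun z => sq_nonneg _)
      (hB n a C _ _ _ _) ?_).2
    filter_upwards [hadm n hn] with ω hω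
    exact H _ (hS.isRademacher n) _ _ _ _ hsm _ hω

/-- The triangular system of recursive inequalities for the mean square errors. -/
lemma exists_mse_recursion : ∃ a C, 0 < a ∧ 0 ≤ C ∧ ∀ k : Idx p, ∀ᶠ n in atTop,
    mse T Pr (iter P K A s₀ Δ ξ) k (n + 1)
      ≤ (1 - a * A.β (n + 1)) * mse T Pr (iter P K A s₀ Δ ξ) k n
        + C * A.β (n + 1) * ((∑ i : Idx p with i.rank < k.rank, mse T Pr (iter P K A s₀ Δ ξ) i n)
          + rateOf k (A.α (n + 1)) (A.β (n + 1)) (A.c (n + 1)) (A.h (n + 1))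
            * (1 + ∑ i, mse T Pr (iter P K A s₀ Δ ξ) i n)) := by
  obtain ⟨r, hr, hadm⟩ := h1.exists_ae_isAdmissible hS hP hK h5.feasible_nonempty
  choose a C ha hC H using exists_mse_succ_le_stepBound h1 hS hP hK h3 h5 hr hadm
  obtain ⟨k₀, hk₀⟩ := Finite.exists_min a
  refine ⟨a k₀, ∑ k, C k, ha k₀, Finset.sum_nonneg fun k _ => hC k, fun k => ?_⟩
  filter_upwards [h3.eventually_small d hr, eventually_ge_atTop 1] with n hsm hn
  have hi := fun k => integrable_errN_sq h1 hS hP hK h3 h5 k n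
  have hb := fun a C => integral_stepBound (s := iter P K A s₀ Δ ξ) hi k a C (A.α (n + 1))
    (A.β (n + 1)) (A.c (n + 1)) (A.h (n + 1))
  rw [← (hb _ _).2]
  refine (H k n hn hsm).trans (integral_mono (hb _ _).1 (hb _ _).1 fun ω => ?_)
  exact stepBound_mono hsm (hk₀ k) (Finset.single_le_sum (fun k _ => hC k) (Finset.mem_univ k)) _

/-- Every mean square error is of the order of its squared rate. -/
theorem exists_mse_le_rate (k : Idx p) : ∃ M, 0 ≤ M ∧ ∀ᶠ n in atTop,
    mse T Pr (iter P K A s₀ Δ ξ) k n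
      ≤ M * rateOf k (A.α (n + 1)) (A.β (n + 1)) (A.c (n + 1)) (A.h (n + 1)) := by
  obtain ⟨a, C, ha, hC, H⟩ := exists_mse_recursion h1 hS hP hK h3 h5
  have hν : ∀ᶠ n in atTop, rateν (A.α (n + 1)) (A.β (n + 1)) (A.c (n + 1))
      ≤ rate (A.α (n + 1)) (A.β (n + 1)) (A.c (n + 1)) (A.h (n + 1)) := by
    filter_upwards [h3.eventually_small d one_pos] with n hn
    exact rateν_le_rate hn.β_pos hn.c_pos hn.h_pos hn.h_le
  refine exists_le_mul_of_triangular Idx.rank (β := fun n => A.β (n + 1))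
    (R := fun k n => rateOf k (A.α (n + 1)) (A.β (n + 1)) (A.c (n + 1)) (A.h (n + 1)))
    ha hC mse_nonneg ?_ ?_ h3.tendsto_β h3.tendsto_rate ?_ ?_ ?_ H k
  · exact fun k n => rateOf_pos k (h3.α_pos _ (by omega)) (h3.β_pos _ (by omega))
      (h3.c_pos _ (by omega)) (h3.h_pos _ (by omega))
  · exact Eventually.of_forall fun n => (h3.β_pos _ (by omega)).le
  · rintro ((_ | j) | (_ | j))
    · exact hν
    · exact Eventually.of_forall fun n => le_rfl
    · exact hν
    · exact Eventually.of_forall fun n => le_rfl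
  · rintro ((_ | i) | (_ | i)) ((_ | j) | (_ | j)) hij
    all_goals first
      | exact Eventually.of_forall fun n => le_rfl
      | exact hν
      | (simp only [Idx.rank] at hij; omega)
  · exact fun k => h5.poly.eventually_rateOf_slow h3 k ha

end Recursion

/-- Root mean square errors, from bounds for mean square errors. -/
lemma isBigO_sqrt_of_le_sq {v R r : ℕ → ℝ} {M : ℝ} (hM : 0 ≤ M) (hr : ∀ n, 0 ≤ r n)
    (hRr : ∀ n, R n ≤ r n ^ 2) (h : ∀ᶠ n in atTop, v n ≤ M * R n) :
    (fun n => √(v n)) =O[atTop] r := by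
  refine IsBigO.of_bound √M ?_
  filter_upwards [h] with n hn
  rw [Real.norm_of_nonneg (Real.sqrt_nonneg _), Real.norm_of_nonneg (hr n)]
  calc √(v n) ≤ √(M * r n ^ 2) :=
        Real.sqrt_le_sqrt (hn.trans (mul_le_mul_of_nonneg_left (hRr n) hM))
    _ = √M * r n := by rw [Real.sqrt_mul hM, Real.sqrt_sq (hr n)]

lemma rateν_le_sq {α β c : ℝ} (hα : 0 < α) (hβ : 0 < β) (hc : 0 < c) :
    rateν α β c ≤ (α / β + √β / c + c ^ 2) ^ 2 := by
  have e : β / c ^ 2 = (√β / c) ^ 2 := by rw [div_pow, Real.sq_sqrt hβ.le]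
  have h1 : 0 ≤ α / β := by positivity
  have h2 : 0 ≤ √β / c := by positivity
  have h3 : 0 ≤ c ^ 2 := by positivity
  rw [rateν, e]
  nlinarith [mul_nonneg h1 h2, mul_nonneg h1 h3, mul_nonneg h2 h3]

lemma rate_le_sq {α β c h : ℝ} (hα : 0 < α) (hβ : 0 < β) (hc : 0 < c) (hh : 0 < h) :
    rate α β c h ≤ (α / β + √β / (c * h) + c ^ 2 + h ^ 2) ^ 2 := by
  have e : β / (c * h) ^ 2 = (√β / (c * h)) ^ 2 := by rw [div_pow, Real.sq_sqrt hβ.le]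
  have h1 : 0 ≤ α / β := by positivity
  have h2 : 0 ≤ √β / (c * h) := by positivity
  have h3 : 0 ≤ c ^ 2 := by positivity
  have h4 : 0 ≤ h ^ 2 := by positivity
  rw [rate, e]
  nlinarith [mul_nonneg h1 h2, mul_nonneg h1 h3, mul_nonneg h2 h3, mul_nonneg h1 h4,
    mul_nonneg h2 h4, mul_nonneg h3 h4]

end MeanSquare

end KBSA

theorem mainTheorem7 {d p : ℕ} {Ξ Ω : Type*} [MeasurableSpace Ξ] [MeasurableSpace Ω]
    (P : Problem d p Ξ) (T : Targets d p) (K : ℝ → ℝ) (A : Params) (s₀ : State d p)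
    (Pr : Measure Ω) [IsProbabilityMeasure Pr]
    (Δ : ℕ → Ω → Vec d) (ξ : ℕ → Fin 3 → Ω → Ξ)
    (N : Set (Vec d)) (Xε : Set ℝ) (Λε : Set (Fin p → ℝ)) (θs : Vec d)
    (hP : P.Standing)
    (hS : Sampling P Pr Δ ξ)
    (h1 : Regularity P T Pr A (iter P K A s₀ Δ ξ) Δ N Xε Λε)
    (h3 : StepSizes A)
    (h4 : KernelCond K)
    (h5 : RateCond P T Pr A (iter P K A s₀ Δ ξ) N θs) :
    ((∀ n, Integrable (fun ω => ‖(iter P K A s₀ Δ ξ n ω).Gν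
          - gradient T.nu (iter P K A s₀ Δ ξ n ω).θ‖ ^ 2) Pr) ∧
      (fun n => √(∫ ω, ‖(iter P K A s₀ Δ ξ n ω).Gν
          - gradient T.nu (iter P K A s₀ Δ ξ n ω).θ‖ ^ 2 ∂Pr))
        =O[atTop] fun n => A.α (n + 1) / A.β (n + 1)
          + √(A.β (n + 1)) / A.c (n + 1) + A.c (n + 1) ^ 2) ∧
    ∀ j : Fin p,
      (∀ n, Integrable (fun ω => ‖(iter P K A s₀ Δ ξ n ω).G j
          - gradient (fun θ => T.lam θ j) (iter P K A s₀ Δ ξ n ω).θ‖ ^ 2) Pr) ∧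
      (fun n => √(∫ ω, ‖(iter P K A s₀ Δ ξ n ω).G j
          - gradient (fun θ => T.lam θ j) (iter P K A s₀ Δ ξ n ω).θ‖ ^ 2 ∂Pr))
        =O[atTop] fun n => A.α (n + 1) / A.β (n + 1)
          + √(A.β (n + 1)) / (A.c (n + 1) * A.h (n + 1))
          + A.c (n + 1) ^ 2 + A.h (n + 1) ^ 2 := by
  have hp := fun n : ℕ => And.intro (h3.α_pos (n + 1) (by omega)) (h3.β_pos (n + 1) (by omega))
  have hq := fun n : ℕ => And.intro (h3.c_pos (n + 1) (by omega)) (h3.h_pos (n + 1) (by omega))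
  refine ⟨⟨integrable_errN_sq h1 hS hP h4 h3 h5 (Sum.inr none), ?_⟩, fun j =>
    ⟨integrable_errN_sq h1 hS hP h4 h3 h5 (Sum.inr (some j)), ?_⟩⟩
  · obtain ⟨M, hM, H⟩ := exists_mse_le_rate h1 hS hP h4 h3 h5 (Sum.inr none)
    refine isBigO_sqrt_of_le_sq hM (fun n => ?_) (fun n => ?_) H
    · obtain ⟨⟨hα, hβ⟩, hc, hh⟩ := And.intro (hp n) (hq n)
      positivity
    · exact rateν_le_sq (hp n).1 (hp n).2 (hq n).1
  · obtain ⟨M, hM, H⟩ := exists_mse_le_rate h1 hS hP h4 h3 h5 (Sum.inr (some j))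
    refine isBigO_sqrt_of_le_sq hM (fun n => ?_) (fun n => ?_) H
    · obtain ⟨⟨hα, hβ⟩, hc, hh⟩ := And.intro (hp n) (hq n)
      positivity
    · exact rate_le_sq (hp n).1 (hp n).2 (hq n).1 (hq n).2
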